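/- Let $\Omega=[0,2\pi]\times[-\tfrac12,\tfrac12]$ with coordinates $(\theta,z)$, and describe deformations $\Phi:\Omega\to\mathbb{R}^3$ of the unit cylinder in cylindrical coordinates, $\Phi=(\Phi_\rho,\Phi_\theta,\Phi_z)$, the deformed position being $\Phi_\rho E_\rho(\Phi)+\Phi_z E_z$, where $E_\rho,E_\theta,E_z$ is the unit frame of cylindrical coordinates. For $h>0$ let $$E_h^{NL}(\Phi)=\int_\Omega |D\Phi^T D\Phi-\mathrm{id}|^2+h^2|D^2\Phi|^2\,d\theta\,dz ,$$ where, for $i,k\in\{\theta,z\}$, the entries of $D\Phi^TD\Phi$ are $\partial_i\Phi_\rho\,\partial_k\Phi_\rho+\Phi_\rho^2\,\partial_i\Phi_\theta\,\partial_k\Phi_\theta+\partial_i\Phi_z\,\partial_k\Phi_z$, and $|D^2\Phi|^2=\sum_{i,k}|\partial_{i}\partial_k\Phi|^2$ with $$\partial_i\partial_k\Phi=(\partial_i\partial_k\Phi_\rho-\Phi_\rho\,\partial_i\Phi_\theta\,\partial_k\Phi_\theta)E_\rho(\Phi)+(\partial_i\Phi_\rho\,\partial_k\Phi_\theta+\partial_k\Phi_\rho\,\partial_i\Phi_\theta+\Phi_\rho\,\partial_i\partial_k\Phi_\theta)E_\theta(\Phi)+\partial_i\partial_k\Phi_z\,E_z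 .$$ For $\lambda\in(0,1)$, $\varrho>0$ and $m\in(0,\infty]$ let $A^{NL}_{\lambda,\varrho,m}$ be the set of all $\Phi$ such that $\Phi_\rho$, $\Phi_\theta-\theta$ and $\Phi_z-(1-\lambda)z$ belong to the periodic Sobolev space $H^2_{\mathrm{per}}(\Omega)$, $\Phi_\rho\ge\varrho$ a.e., $\|\partial_i\Phi_j\|_{L^\infty(\Omega)}\le m$ for all $i\in\{\theta,z\}$, $j\in\{\rho,\theta,z\}$, and $\partial_z\Phi_z\ge0$ a.e. Let $$\mathcal{E}_b^{NL}(\varrho,h)=|\Omega|(\varrho^2-1)^2+|\Omega|\varrho^2h^2 .$$ For every $m\in[1,\infty)$ there are constants $c,C>0$, depending only on $m$, such that for all $h,\lambda\in(0,\tfrac12]$ with $h\ge\lambda^{5/6}$ the minimum of $E_h^{NL}$ over $A^{NL}_{\lambda,1,m}$ is attained and $$c\,\lambda^2\;\le\;\min_{A^{NL}_{\lambda,1,m}}E_h^{NL}-\mathcal{E}_b^{NL}(1,h)\;\le\;C\,\lambda^2 .$$ -/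

import Mathlib

open MeasureTheory
open scoped ENNReal ContDiff Matrix

noncomputable section

namespace Cylinder

/-- Points of the reference plane are pairs `(θ, z)`. Functions on the reference cylinder are
represented by functions of `(θ, z) ∈ ℝ²`, periodic with period `2π` in `θ` and `1` in `z`. -/
abbrev Pt : Type := ℝ × ℝ

/-- The reference domain `Ω = [0, 2π] × [-1/2, 1/2]`. -/
def refDomain : Set Pt := Set.Icc 0 (2 * Real.pi) ×ˢ Set.Icc (-(1 / 2)) (1 / 2)

/-- Lebesgue measure on the reference domain `Ω`. -/
def refMeasure : Measure Pt := (volume : Measure Pt).restrict refDomain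

/-- The reference basis vectors: index `0` is `e_θ`, index `1` is `e_z`. -/
def dir (i : Fin 2) : Pt := ![((1 : ℝ), (0 : ℝ)), ((0 : ℝ), (1 : ℝ))] i

/-- Periodicity with respect to the reference cell `Ω`. -/
def IsPeriodic (f : Pt → ℝ) : Prop :=
  ∀ x : Pt, f (x + (2 * Real.pi, 0)) = f x ∧ f (x + (0, 1)) = f x

/-- `g` is the weak partial derivative `∂_i f` on `ℝ²`, tested against `C_c^∞(ℝ²)`. -/
def HasWeakPartial (i : Fin 2) (f g : Pt → ℝ) : Prop :=
  LocallyIntegrable f volume ∧ LocallyIntegrable g volume ∧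
    ∀ φ : Pt → ℝ, ContDiff ℝ ∞ φ → HasCompactSupport φ →
      ∫ x, f x * fderiv ℝ φ x (dir i) = -∫ x, g x * φ x

open Classical in
/-- The weak partial derivative `∂_i f` (unique up to null sets when it exists; the default
value is `0` if there is none). -/
def weakPartial (i : Fin 2) (f : Pt → ℝ) : Pt → ℝ :=
  if h : ∃ g, HasWeakPartial i f g then h.choose else 0

/-- The periodic Sobolev space `H^k_per(Ω)`: periodic functions which are square integrable on
`Ω`, together with their weak partial derivatives on `ℝ²` up to order `k` (every periodic
function that is square integrable on `Ω` is locally square integrable on `ℝ²`). -/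
def MemHPer : ℕ → (Pt → ℝ) → Prop
  | 0, f => IsPeriodic f ∧ MemLp f 2 refMeasure
  | k + 1, f => IsPeriodic f ∧ MemLp f 2 refMeasure ∧
      ∀ i : Fin 2, ∃ g : Pt → ℝ, HasWeakPartial i f g ∧ MemHPer k g

/-- A deformation of the cylinder in cylindrical coordinates of `ℝ³`: the components
`0, 1, 2` of `Φ x` are `Φ_ρ, Φ_θ, Φ_z`. The deformed position of the point `x` is
`Φ_ρ E_ρ(Φ) + Φ_z E_z`, where `E_ρ, E_θ, E_z` is the unit frame of the cylindrical coordinates. -/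
abbrev Deformation : Type := Pt → Fin 3 → ℝ

/-- The component functions `Φ_ρ, Φ_θ, Φ_z`. -/
def Deformation.comp (Φ : Deformation) (j : Fin 3) : Pt → ℝ := fun x => Φ x j

/-- The weak partial derivative `∂_i Φ_j`. -/
def Deformation.d (Φ : Deformation) (i : Fin 2) (j : Fin 3) : Pt → ℝ :=
  weakPartial i (Φ.comp j)

/-- The weak second partial derivative `∂_i ∂_k Φ_j`. -/
def Deformation.dd (Φ : Deformation) (i k : Fin 2) (j : Fin 3) : Pt → ℝ :=
  weakPartial i (weakPartial k (Φ.comp j))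

/-- The deformation gradient `DΦ` as a `3 × 2` matrix, in the orthonormal bases
`E_ρ(Φ), E_θ(Φ), E_z` of `ℝ³` and `e_θ, e_z` of the reference plane: its column `i` is
`∂_i Φ = ∂_i Φ_ρ E_ρ + Φ_ρ ∂_i Φ_θ E_θ + ∂_i Φ_z E_z`. -/
def Deformation.grad (Φ : Deformation) (x : Pt) : Matrix (Fin 3) (Fin 2) ℝ :=
  Matrix.of fun j i => ![Φ.d i 0 x, Φ x 0 * Φ.d i 1 x, Φ.d i 2 x] j

/-- The metric tensor `g = DΦᵀ DΦ`. -/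
def Deformation.metric (Φ : Deformation) (x : Pt) : Matrix (Fin 2) (Fin 2) ℝ :=
  (Φ.grad x)ᵀ * Φ.grad x

/-- The components in the frame `E_ρ(Φ), E_θ(Φ), E_z` of the second derivative `∂_i ∂_k Φ` of
the deformed position, computed with `∂_i (E_ρ(Φ)) = ∂_i Φ_θ E_θ(Φ)` and
`∂_i (E_θ(Φ)) = -∂_i Φ_θ E_ρ(Φ)`. -/
def Deformation.hess (Φ : Deformation) (i k : Fin 2) (x : Pt) : Fin 3 → ℝ :=
  ![Φ.dd i k 0 x - Φ x 0 * Φ.d i 1 x * Φ.d k 1 x,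
    Φ.d i 0 x * Φ.d k 1 x + Φ.d k 0 x * Φ.d i 1 x + Φ x 0 * Φ.dd i k 1 x,
    Φ.dd i k 2 x]

/-- The nonlinear elastic energy `E_h^NL(Φ) = ∫_Ω |DΦᵀ DΦ - id|² + h² |D²Φ|² dθ dz`
(with the Euclidean norms of the arrays). -/
def energyNL (h : ℝ) (Φ : Deformation) : ℝ :=
  ∫ x, ((∑ i, ∑ k, ((Φ.metric x - 1) i k) ^ 2)
    + h ^ 2 * ∑ i, ∑ k, ∑ j, (Φ.hess i k x j) ^ 2) ∂refMeasure

/-- The admissible set `A^NL_{λ,ϱ,m}`; the slope bound `m` may be `∞`. -/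
def admissibleNL (lam ϱ : ℝ) (m : ℝ≥0∞) : Set Deformation :=
  {Φ | MemHPer 2 (Φ.comp 0) ∧
    MemHPer 2 (fun x => Φ.comp 1 x - x.1) ∧
    MemHPer 2 (fun x => Φ.comp 2 x - (1 - lam) * x.2) ∧
    (∀ᵐ x ∂refMeasure, ϱ ≤ Φ x 0) ∧
    (∀ (i : Fin 2) (j : Fin 3), eLpNorm (Φ.d i j) ∞ refMeasure ≤ m) ∧
    (∀ᵐ x ∂refMeasure, 0 ≤ Φ.d 1 2 x)}

/-- The bulk energy `|Ω| (ϱ² - 1)² + |Ω| ϱ² h²`. -/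
def bulkEnergyNL (ϱ h : ℝ) : ℝ :=
  volume.real refDomain * (ϱ ^ 2 - 1) ^ 2 + volume.real refDomain * ϱ ^ 2 * h ^ 2

end Cylinder

end

/-! Upper bound. The unbuckled cylinder `(1, θ, (1-λ)z)` is admissible. Its bending is exactly the
bulk term, and its only strain is `(1-λ)²-1` in the axial direction, so the excess is at most
`8πλ²`.

Lower bound. Bending already costs the bulk energy: since `Φ_ρ ≥ 1`, while `∂_θΦ_θ` has mean 1 and
`∂_θ²Φ_ρ` has mean 0, convexity gives `bending_lower_bound`. The excess therefore controls the `L²`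
norms of the strains and, with weight `h²`, the radial part of `∂_z²Φ` (`excess_bound`). Suppose the
excess is below `(ελ)²`. Because of the mandrel, the hoop strain minus `2(∂_θΦ_θ-1)`, a term of zero
mean on every circle, dominates a sum of nonnegative terms containing `Φ_ρ-1`, `(∂_θΦ_ρ)²`,
`(∂_θΦ_z)²` and `(∂_θΦ_θ-1)²` (`hoop_le`). So these have integrals of order `ελ`, and the integral
of `Φ_ρ-1` over circles is small even in `L²` in `z`. Interpolating on circles at length `δ =
λ^{1/3}` gives `∫(Φ_ρ-1)² ≲ ελ²/δ + δ²ελ ~ ελ^{5/3}`. The hypothesis `h² ≥ λ^{5/3}` bounds the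
squared axial bending by `ελ²/h² ≤ ελ^{1/3}`. Interpolation in `z` then gives `∫(∂_zΦ_ρ)² ≲ ελ`, and
the shear strain gives `∫(∂_zΦ_θ)² ≲ ελ`. But the imposed shortening `2πλ` must be paid for by axial
strain, `(∂_zΦ_ρ)²` or `(∂_zΦ_θ)²` (`compression_le`), which is impossible for small `ε`.

Attainment. This is the direct method along a free ultrafilter. The slope bound makes the fields
equi-Lipschitz, so they converge uniformly; second derivatives converge weakly in `L²`; integration
by parts makes the first derivatives converge strongly. The strain terms then converge, the bending
terms are lower semicontinuous, and all constraints pass to the limit (`exists_jet_limit`). -/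

open Filter Topology

noncomputable section

namespace Cylinder

/-! ### Cells of the period lattice -/

/-- The lattice vector `(2πk, l)`. -/
def latticeVec (k : ℤ × ℤ) : Pt := (2 * Real.pi * k.1, k.2)

/-- The index of the cell of the period lattice which contains the point `x`. -/
def cellIndex (x : Pt) : ℤ × ℤ := (⌊x.1 / (2 * Real.pi)⌋, ⌊x.2 + 1 / 2⌋)

/-- The cell of the period lattice with index `k`. -/
def cell (k : ℤ × ℤ) : Set Pt := cellIndex ⁻¹' {k}

lemma measurable_cellIndex : Measurable cellIndex := by
  unfold cellIndex
  fun_prop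

lemma measurableSet_cell (k : ℤ × ℤ) : MeasurableSet (cell k) :=
  measurable_cellIndex (measurableSet_singleton k)

lemma cellIndex_add_latticeVec (x : Pt) (k : ℤ × ℤ) :
    cellIndex (x + latticeVec k) = cellIndex x + k := by
  have hpi : (2 * Real.pi) ≠ 0 := by positivity
  have h1 : (x.1 + 2 * Real.pi * k.1) / (2 * Real.pi) = x.1 / (2 * Real.pi) + k.1 := by
    field_simp
  have h2 : x.2 + k.2 + 1 / 2 = x.2 + 1 / 2 + k.2 := by ring
  simp only [cellIndex, latticeVec, Prod.fst_add, Prod.snd_add, h1, h2, Int.floor_add_intCast]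
  rfl

lemma latticeVec_neg (k : ℤ × ℤ) : latticeVec (-k) = -latticeVec k := by
  simp [latticeVec]

lemma latticeVec_zero : latticeVec 0 = 0 := by
  simp [latticeVec]

lemma latticeVec_add (k l : ℤ × ℤ) : latticeVec (k + l) = latticeVec k + latticeVec l := by
  ext <;> simp [latticeVec]; ring

lemma preimage_add_cell (k : ℤ × ℤ) : (fun x => x + latticeVec k) ⁻¹' cell k = cell 0 := by
  ext x
  simp [cell, cellIndex_add_latticeVec]

lemma cell_zero : cell 0 = Set.Ico 0 (2 * Real.pi) ×ˢ Set.Ico (-(1 / 2)) (1 / 2) := by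
  have hpi : 0 < 2 * Real.pi := by positivity
  ext x
  simp only [cell, cellIndex, Set.mem_preimage, Set.mem_singleton_iff, Prod.ext_iff,
    Set.mem_prod, Set.mem_Ico, Prod.fst_zero, Prod.snd_zero, Int.floor_eq_zero_iff]
  rw [div_lt_one hpi, le_div_iff₀ hpi, zero_mul]
  constructor
  · rintro ⟨⟨h1, h2⟩, h3, h4⟩
    exact ⟨⟨h1, h2⟩, by linarith, by linarith⟩
  · rintro ⟨⟨h1, h2⟩, h3, h4⟩
    exact ⟨⟨h1, h2⟩, by linarith, by linarith⟩

lemma refMeasure_eq_prod : refMeasure =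
    ((volume : Measure ℝ).restrict (Set.Icc 0 (2 * Real.pi))).prod
      ((volume : Measure ℝ).restrict (Set.Icc (-(1 / 2)) (1 / 2))) := by
  rw [Measure.prod_restrict]
  rfl

/-- The edges of the closed rectangle are null, so `Ω` may be replaced by the half-open cell, whose
lattice translates tile the plane. -/
lemma refMeasure_eq_cell : refMeasure = (volume : Measure Pt).restrict (cell 0) := by
  rw [refMeasure_eq_prod, cell_zero, ← restrict_Ico_eq_restrict_Icc,
    ← restrict_Ico_eq_restrict_Icc, Measure.prod_restrict]
  rfl

lemma volume_real_refDomain : volume.real refDomain = 2 * Real.pi := by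
  have hpi : 0 < 2 * Real.pi := by positivity
  rw [refDomain, Measure.real, Measure.volume_eq_prod, Measure.prod_prod, Real.volume_Icc,
    Real.volume_Icc, ENNReal.toReal_mul, ENNReal.toReal_ofReal (by linarith),
    ENNReal.toReal_ofReal (by norm_num)]
  norm_num

instance : IsFiniteMeasure refMeasure := by
  rw [refMeasure_eq_prod]
  infer_instance

lemma refMeasure_real_univ : refMeasure.real Set.univ = 2 * Real.pi := by
  rw [refMeasure, measureReal_restrict_apply_univ, volume_real_refDomain]

lemma isCompact_refDomain : IsCompact refDomain := isCompact_Icc.prod isCompact_Icc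

lemma measurableSet_refDomain : MeasurableSet refDomain := isCompact_refDomain.measurableSet

lemma IsPeriodic.add_latticeVec {f : Pt → ℝ} (hf : IsPeriodic f) (k : ℤ × ℤ) (x : Pt) :
    f (x + latticeVec k) = f x := by
  have h1 : Function.Periodic f ((2 * Real.pi, 0) : Pt) := fun y => (hf y).1
  have h2 : Function.Periodic f ((0, 1) : Pt) := fun y => (hf y).2
  have e : x + latticeVec k = x + k.1 • ((2 * Real.pi, 0) : Pt) + k.2 • ((0, 1) : Pt) := by
    ext <;> simp [latticeVec]; ring
  rw [e, h2.zsmul, h1.zsmul]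

lemma isPeriodic_iff {f : Pt → ℝ} :
    IsPeriodic f ↔ ∀ k x, f (x + latticeVec k) = f x := by
  refine ⟨fun hf k x => hf.add_latticeVec k x, fun h x => ⟨?_, ?_⟩⟩
  · simpa [latticeVec] using h (1, 0) x
  · simpa [latticeVec] using h (0, 1) x

lemma map_add_latticeVec (k : ℤ × ℤ) :
    MeasurePreserving (fun x : Pt => x + latticeVec k) (volume.restrict (cell 0))
      (volume.restrict (cell k)) := by
  have := (measurePreserving_add_right (volume : Measure Pt) (latticeVec k)).restrict_preimage
    (measurableSet_cell k)
  rwa [preimage_add_cell] at this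

lemma measurableEmbedding_add (v : Pt) : MeasurableEmbedding (fun x : Pt => x + v) :=
  (MeasurableEquiv.addRight v).measurableEmbedding

lemma iUnion_cell : ⋃ k, cell k = Set.univ :=
  Set.eq_univ_of_forall fun x => Set.mem_iUnion.2 ⟨cellIndex x, rfl⟩

/-- A lattice invariant property which holds almost everywhere in the reference cell holds
almost everywhere in the plane. -/
lemma ae_of_ae_refMeasure {P : Pt → Prop} (hP : ∀ k x, P (x + latticeVec k) ↔ P x)
    (h : ∀ᵐ x ∂refMeasure, P x) : ∀ᵐ x, P x := by
  rw [← Measure.restrict_univ (μ := (volume : Measure Pt)), ← iUnion_cell,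
    ae_restrict_iUnion_iff]
  intro k
  rw [← (map_add_latticeVec k).map_eq, (measurableEmbedding_add _).ae_map_iff,
    ← refMeasure_eq_cell]
  simpa only [hP] using h

lemma ae_refMeasure_of_ae {P : Pt → Prop} (h : ∀ᵐ x, P x) : ∀ᵐ x ∂refMeasure, P x :=
  ae_restrict_of_ae h

lemma exists_finset_cell {K : Set Pt} (hK : IsCompact K) :
    ∃ N : ℕ, K ⊆ ⋃ k ∈ Finset.Icc (-(N : ℤ)) N ×ˢ Finset.Icc (-(N : ℤ)) N, cell k := by
  obtain ⟨R, hR⟩ := hK.isBounded.exists_norm_le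
  obtain ⟨N, hN⟩ := exists_nat_ge (R + 3)
  refine ⟨N, fun x hx => ?_⟩
  have hx' := hR x hx
  have h1 : |x.1| ≤ R := (norm_fst_le x).trans hx'
  have h2 : |x.2| ≤ R := (norm_snd_le x).trans hx'
  have hpi : 1 ≤ 2 * Real.pi := by linarith [Real.pi_gt_three]
  have h3 : |x.1 / (2 * Real.pi)| ≤ R := by
    rw [abs_div, abs_of_pos (by linarith : 0 < 2 * Real.pi)]
    exact (div_le_self (abs_nonneg _) hpi).trans h1
  have key : ∀ y : ℝ, |y| ≤ R + 1 → ⌊y⌋ ∈ Finset.Icc (-(N : ℤ)) N := by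
    intro y hy
    rw [abs_le] at hy
    rw [Finset.mem_Icc]
    constructor
    · rw [Int.le_floor]; push_cast; linarith [hy.1]
    · have : (⌊y⌋ : ℝ) ≤ (N : ℤ) := (Int.floor_le y).trans (by push_cast; linarith [hy.2])
      exact_mod_cast this
  refine Set.mem_iUnion₂.2 ⟨cellIndex x, ?_, rfl⟩
  rw [Finset.mem_product]
  refine ⟨key _ (by linarith), key _ ?_⟩
  refine (abs_add_le _ _).trans ?_
  rw [abs_of_pos (by norm_num : (0 : ℝ) < 1 / 2)]
  linarith

lemma IsPeriodic.integrableOn_cell {f : Pt → ℝ} (hf : IsPeriodic f)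
    (hi : Integrable f refMeasure) (k : ℤ × ℤ) : IntegrableOn f (cell k) := by
  rw [IntegrableOn, ← (map_add_latticeVec k).integrable_comp_emb (measurableEmbedding_add _),
    ← refMeasure_eq_cell]
  refine hi.congr (Eventually.of_forall fun x => ?_)
  exact (hf.add_latticeVec k x).symm

lemma IsPeriodic.locallyIntegrable {f : Pt → ℝ} (hf : IsPeriodic f)
    (hi : Integrable f refMeasure) : LocallyIntegrable f := by
  rw [locallyIntegrable_iff]
  intro K hK
  obtain ⟨N, hN⟩ := exists_finset_cell hK
  refine IntegrableOn.mono_set ?_ hN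
  exact integrableOn_finset_iUnion.2 fun k _ => hf.integrableOn_cell hi k

/-- The finite set of lattice indices with entries between `-N` and `N`. -/
def indexBox (N : ℕ) : Finset (ℤ × ℤ) :=
  Finset.Icc (-(N : ℤ)) N ×ˢ Finset.Icc (-(N : ℤ)) N

/-- Only finitely many cells meet the support of `ψ`; translating each one back to the reference
cell moves the sum onto `ψ`. The threshold depends on `ψ` alone, so one `N` can serve several test
functions. -/
lemma exists_integral_periodic_mul_eq {ψ : Pt → ℝ} (hψ : Continuous ψ)
    (hc : HasCompactSupport ψ) :
    ∃ N₀ : ℕ, ∀ N ≥ N₀, ∀ f : Pt → ℝ, IsPeriodic f → Integrable f refMeasure →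
      ∫ x, f x * ψ x =
        ∫ x, f x * ∑ k ∈ indexBox N, ψ (x + latticeVec k) ∂refMeasure := by
  obtain ⟨N₀, hN₀⟩ := exists_finset_cell hc.isCompact
  refine ⟨N₀, fun N hN f hf hi => ?_⟩
  have hsub : tsupport ψ ⊆ ⋃ k ∈ indexBox N, cell k := by
    refine hN₀.trans (Set.biUnion_subset_biUnion_left fun k hk => ?_)
    simp only [Finset.coe_product, Set.mem_prod, Finset.coe_Icc, Set.mem_Icc,
      indexBox] at hk ⊢
    have : (N₀ : ℤ) ≤ N := by exact_mod_cast hN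
    omega
  obtain ⟨M, hM⟩ := hc.exists_bound_of_continuous hψ
  have hcell : ∀ k, IntegrableOn (fun x => f x * ψ x) (cell k) := fun k =>
    (hf.integrableOn_cell hi k).mul_bdd hψ.aestronglyMeasurable (Eventually.of_forall hM)
  have h1 : ∫ x, f x * ψ x = ∫ x in ⋃ k ∈ indexBox N, cell k, f x * ψ x := by
    rw [setIntegral_eq_integral_of_forall_compl_eq_zero]
    intro x hx
    rw [image_eq_zero_of_notMem_tsupport fun h => hx (hsub h), mul_zero]
  rw [h1, integral_biUnion_finset _ (fun k _ => measurableSet_cell k) ?_ (fun k _ => hcell k)]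
  · simp_rw [Finset.mul_sum]
    rw [integral_finsetSum]
    · refine Finset.sum_congr rfl fun k _ => ?_
      rw [← (map_add_latticeVec k).integral_comp (measurableEmbedding_add _),
        ← refMeasure_eq_cell]
      refine integral_congr_ae (Eventually.of_forall fun x => ?_)
      simp only [hf.add_latticeVec k x]
    · intro k _
      exact hi.mul_bdd (hψ.comp (continuous_add_const _)).aestronglyMeasurable
        (Eventually.of_forall fun x => hM _)
  · intro k _ l _ hkl
    exact Disjoint.preimage _ (by simpa using hkl)

/-- Integration of periodic functions against a test function is integration on the reference
domain against its periodization. -/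
lemma exists_periodization {ψ : Pt → ℝ} (hψ : Continuous ψ) (hc : HasCompactSupport ψ) :
    ∃ Ψ : Pt → ℝ, Continuous Ψ ∧ ∀ f : Pt → ℝ, IsPeriodic f → Integrable f refMeasure →
      ∫ x, f x * ψ x = ∫ x, f x * Ψ x ∂refMeasure := by
  obtain ⟨N, hN⟩ := exists_integral_periodic_mul_eq hψ hc
  exact ⟨fun x => ∑ k ∈ indexBox N, ψ (x + latticeVec k), by fun_prop,
    fun f hf hi => hN N le_rfl f hf hi⟩

/-- A function on the reference domain, extended periodically. -/
def perExt (f : Pt → ℝ) (x : Pt) : ℝ := f (x - latticeVec (cellIndex x))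

lemma isPeriodic_perExt (f : Pt → ℝ) : IsPeriodic (perExt f) := by
  rw [isPeriodic_iff]
  intro k x
  rw [perExt, perExt, cellIndex_add_latticeVec, latticeVec_add]
  congr 1
  abel

lemma perExt_ae_eq (f : Pt → ℝ) : perExt f =ᵐ[refMeasure] f := by
  rw [refMeasure_eq_cell]
  filter_upwards [ae_restrict_mem (measurableSet_cell 0)] with x hx
  have : cellIndex x = 0 := hx
  rw [perExt, this, latticeVec_zero, sub_zero]

/-- Every periodic function takes all its values on the reference domain. -/
lemma exists_mem_refDomain (x : Pt) : ∃ y ∈ refDomain, ∃ k, x = y + latticeVec k := by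
  refine ⟨x - latticeVec (cellIndex x), ?_, cellIndex x, by abel⟩
  have : x - latticeVec (cellIndex x) ∈ cell 0 := by
    have h := cellIndex_add_latticeVec x (-cellIndex x)
    rw [latticeVec_neg, ← sub_eq_add_neg, add_neg_cancel] at h
    exact h
  rw [cell_zero] at this
  exact ⟨Set.Ico_subset_Icc_self this.1, Set.Ico_subset_Icc_self this.2⟩

lemma IsPeriodic.add {f g : Pt → ℝ} (hf : IsPeriodic f) (hg : IsPeriodic g) :
    IsPeriodic (fun x => f x + g x) := fun x => by
  simp only [(hf x).1, (hf x).2, (hg x).1, (hg x).2, and_self]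

lemma IsPeriodic.sub {f g : Pt → ℝ} (hf : IsPeriodic f) (hg : IsPeriodic g) :
    IsPeriodic (fun x => f x - g x) := fun x => by
  simp only [(hf x).1, (hf x).2, (hg x).1, (hg x).2, and_self]

lemma IsPeriodic.mul {f g : Pt → ℝ} (hf : IsPeriodic f) (hg : IsPeriodic g) :
    IsPeriodic (fun x => f x * g x) := fun x => by
  simp only [(hf x).1, (hf x).2, (hg x).1, (hg x).2, and_self]

lemma isPeriodic_const (c : ℝ) : IsPeriodic (fun _ => c) := fun _ => ⟨rfl, rfl⟩

/-! ### Weak partial derivatives -/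

lemma dir_zero : dir 0 = (1, 0) := rfl

lemma dir_one : dir 1 = (0, 1) := rfl

lemma continuous_fderiv_dir {φ : Pt → ℝ} (hφ : ContDiff ℝ ∞ φ) (i : Fin 2) :
    Continuous fun x => fderiv ℝ φ x (dir i) :=
  (hφ.continuous_fderiv (by simp)).clm_apply continuous_const

lemma hasCompactSupport_fderiv_dir {φ : Pt → ℝ} (hc : HasCompactSupport φ) (i : Fin 2) :
    HasCompactSupport fun x => fderiv ℝ φ x (dir i) :=
  (hc.fderiv ℝ).comp_left (g := fun L : Pt →L[ℝ] ℝ => L (dir i)) (by simp)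

lemma LocallyIntegrable.integrable_mul_test {f φ : Pt → ℝ} (hf : LocallyIntegrable f volume)
    (hφ : Continuous φ) (hc : HasCompactSupport φ) : Integrable (fun x => f x * φ x) := by
  simpa only [smul_eq_mul, mul_comm] using
    hf.integrable_smul_left_of_hasCompactSupport hφ hc

lemma HasWeakPartial.ae_eq {i : Fin 2} {f g g' : Pt → ℝ} (h : HasWeakPartial i f g)
    (h' : HasWeakPartial i f g') : g =ᵐ[volume] g' := by
  refine ae_eq_of_integral_contDiff_smul_eq h.2.1 h'.2.1 fun φ hφ hc => ?_
  have := h.2.2 φ hφ hc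
  rw [h'.2.2 φ hφ hc] at this
  simp only [smul_eq_mul, mul_comm (φ _)]
  linarith

lemma HasWeakPartial.congr {i : Fin 2} {f f' g g' : Pt → ℝ} (h : HasWeakPartial i f g)
    (hf : f =ᵐ[volume] f') (hg : g =ᵐ[volume] g') : HasWeakPartial i f' g' := by
  refine ⟨h.1.congr hf, h.2.1.congr hg, fun φ hφ hc => ?_⟩
  have h1 : ∫ x, f' x * fderiv ℝ φ x (dir i) = ∫ x, f x * fderiv ℝ φ x (dir i) :=
    integral_congr_ae (hf.mono fun x hx => by simp only [hx])
  have h2 : ∫ x, g' x * φ x = ∫ x, g x * φ x :=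
    integral_congr_ae (hg.mono fun x hx => by simp only [hx])
  rw [h1, h2, h.2.2 φ hφ hc]

lemma HasWeakPartial.add {i : Fin 2} {f f' g g' : Pt → ℝ} (h : HasWeakPartial i f g)
    (h' : HasWeakPartial i f' g') :
    HasWeakPartial i (fun x => f x + f' x) (fun x => g x + g' x) := by
  refine ⟨h.1.add h'.1, h.2.1.add h'.2.1, fun φ hφ hc => ?_⟩
  have hd := continuous_fderiv_dir hφ i
  have hdc := hasCompactSupport_fderiv_dir hc i
  simp only [add_mul]
  rw [integral_add (LocallyIntegrable.integrable_mul_test h.1 hd hdc)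
      (LocallyIntegrable.integrable_mul_test h'.1 hd hdc),
    integral_add (LocallyIntegrable.integrable_mul_test h.2.1 hφ.continuous hc)
      (LocallyIntegrable.integrable_mul_test h'.2.1 hφ.continuous hc),
    h.2.2 φ hφ hc, h'.2.2 φ hφ hc]
  ring

lemma HasWeakPartial.neg {i : Fin 2} {f g : Pt → ℝ} (h : HasWeakPartial i f g) :
    HasWeakPartial i (fun x => -f x) (fun x => -g x) := by
  refine ⟨h.1.neg, h.2.1.neg, fun φ hφ hc => ?_⟩
  simp only [neg_mul, integral_neg, h.2.2 φ hφ hc]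

lemma HasWeakPartial.sub {i : Fin 2} {f f' g g' : Pt → ℝ} (h : HasWeakPartial i f g)
    (h' : HasWeakPartial i f' g') :
    HasWeakPartial i (fun x => f x - f' x) (fun x => g x - g' x) := by
  simpa only [sub_eq_add_neg] using h.add h'.neg

lemma hasWeakPartial_of_contDiff (i : Fin 2) {f : Pt → ℝ} (hf : ContDiff ℝ ∞ f) :
    HasWeakPartial i f (fun x => fderiv ℝ f x (dir i)) := by
  refine ⟨hf.continuous.locallyIntegrable, (continuous_fderiv_dir hf i).locallyIntegrable,
    fun φ hφ hc => ?_⟩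
  have hd := continuous_fderiv_dir hφ i
  have hdc := hasCompactSupport_fderiv_dir hc i
  exact integral_mul_fderiv_eq_neg_fderiv_mul_of_integrable
    (LocallyIntegrable.integrable_mul_test (continuous_fderiv_dir hf i).locallyIntegrable
      hφ.continuous hc)
    (LocallyIntegrable.integrable_mul_test hf.continuous.locallyIntegrable hd hdc)
    (LocallyIntegrable.integrable_mul_test hf.continuous.locallyIntegrable hφ.continuous hc)
    (fun x _ => (hf.differentiable (by simp)).differentiableAt)
    (fun x _ => (hφ.differentiable (by simp)).differentiableAt)

lemma hasWeakPartial_const (i : Fin 2) (c : ℝ) : HasWeakPartial i (fun _ => c) (fun _ => 0) := by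
  simpa using hasWeakPartial_of_contDiff i (contDiff_const (c := c))

lemma hasWeakPartial_fst (i : Fin 2) (c : ℝ) :
    HasWeakPartial i (fun x => c * x.1) (fun _ => if i = 0 then c else 0) := by
  have h := hasWeakPartial_of_contDiff i (f := fun x : Pt => c * x.1) (by fun_prop)
  have e : ∀ x : Pt, fderiv ℝ (fun x : Pt => c * x.1) x (dir i) = if i = 0 then c else 0 := by
    intro x
    have : HasFDerivAt (fun x : Pt => c * x.1) (c • ContinuousLinearMap.fst ℝ ℝ ℝ) x :=
      hasFDerivAt_fst.const_mul c
    rw [this.fderiv]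
    fin_cases i <;> simp [dir]
  simpa only [e] using h

lemma hasWeakPartial_snd (i : Fin 2) (c : ℝ) :
    HasWeakPartial i (fun x => c * x.2) (fun _ => if i = 1 then c else 0) := by
  have h := hasWeakPartial_of_contDiff i (f := fun x : Pt => c * x.2) (by fun_prop)
  have e : ∀ x : Pt, fderiv ℝ (fun x : Pt => c * x.2) x (dir i) = if i = 1 then c else 0 := by
    intro x
    have : HasFDerivAt (fun x : Pt => c * x.2) (c • ContinuousLinearMap.snd ℝ ℝ ℝ) x :=
      hasFDerivAt_snd.const_mul c
    rw [this.fderiv]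
    fin_cases i <;> simp [dir]
  simpa only [e] using h

lemma LocallyIntegrable.mul_continuous {f ψ : Pt → ℝ} (hf : LocallyIntegrable f volume)
    (hψ : Continuous ψ) : LocallyIntegrable (fun x => f x * ψ x) volume := by
  rw [locallyIntegrable_iff] at hf ⊢
  exact fun K hK => (hf K hK).mul_continuousOn hψ.continuousOn hK

lemma HasWeakPartial.mul_contDiff {i : Fin 2} {f g ψ : Pt → ℝ} (h : HasWeakPartial i f g)
    (hψ : ContDiff ℝ ∞ ψ) :
    HasWeakPartial i (fun x => f x * ψ x) (fun x => g x * ψ x + f x * fderiv ℝ ψ x (dir i)) := by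
  have hdψ := continuous_fderiv_dir hψ i
  refine ⟨LocallyIntegrable.mul_continuous h.1 hψ.continuous,
    (LocallyIntegrable.mul_continuous h.2.1 hψ.continuous).add
      (LocallyIntegrable.mul_continuous h.1 hdψ), fun φ hφ hc => ?_⟩
  have key := h.2.2 (fun x => ψ x * φ x) (hψ.mul hφ) hc.mul_left
  have e : ∀ x, fderiv ℝ (fun x => ψ x * φ x) x (dir i) =
      ψ x * fderiv ℝ φ x (dir i) + fderiv ℝ ψ x (dir i) * φ x := by
    intro x
    have h1 : HasFDerivAt ψ (fderiv ℝ ψ x) x :=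
      (hψ.differentiable (by simp)).differentiableAt.hasFDerivAt
    have h2 : HasFDerivAt φ (fderiv ℝ φ x) x :=
      (hφ.differentiable (by simp)).differentiableAt.hasFDerivAt
    have h3 : HasFDerivAt (fun x => ψ x * φ x) _ x := h1.mul h2
    rw [h3.fderiv]
    simp [mul_comm]
  have i1 : Integrable (fun x => f x * (ψ x * fderiv ℝ φ x (dir i))) :=
    LocallyIntegrable.integrable_mul_test h.1 (hψ.continuous.mul (continuous_fderiv_dir hφ i))
      (hasCompactSupport_fderiv_dir hc i).mul_left
  have i2 : Integrable (fun x => f x * (fderiv ℝ ψ x (dir i) * φ x)) :=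
    LocallyIntegrable.integrable_mul_test h.1 (hdψ.mul hφ.continuous) hc.mul_left
  have i3 : Integrable (fun x => g x * (ψ x * φ x)) :=
    LocallyIntegrable.integrable_mul_test h.2.1 (hψ.continuous.mul hφ.continuous) hc.mul_left
  simp only [e, mul_add] at key
  rw [integral_add i1 i2] at key
  simp only [add_mul, mul_assoc]
  rw [integral_add i3 i2]
  linarith

/-! ### A partition of unity and mean values of weak derivatives -/

lemma sum_Icc_int_telescope (F : ℤ → ℝ) (N : ℕ) :
    ∑ k ∈ Finset.Icc (-(N : ℤ)) N, (F (k + 1) - F k) = F (N + 1) - F (-N) := by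
  induction N with
  | zero => simp
  | succ n ih =>
    have e : Finset.Icc (-((n + 1 : ℕ) : ℤ)) ((n + 1 : ℕ) : ℤ) =
        insert (-((n : ℤ) + 1)) (insert ((n : ℤ) + 1) (Finset.Icc (-(n : ℤ)) n)) := by
      ext k
      simp only [Finset.mem_Icc, Finset.mem_insert]
      push_cast
      omega
    rw [e, Finset.sum_insert, Finset.sum_insert, ih]
    · push_cast
      rw [show (-((n : ℤ) + 1) + 1) = -(n : ℤ) by ring]
      ring
    · simp
    · simp only [Finset.mem_insert, Finset.mem_Icc]
      omega

/-- A smooth function on the line whose integer translates sum up to one. -/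
def unitBump (t : ℝ) : ℝ := Real.smoothTransition (t + 1) - Real.smoothTransition t

lemma contDiff_unitBump : ContDiff ℝ ∞ unitBump := by
  unfold unitBump
  exact (Real.smoothTransition.contDiff.comp (contDiff_id.add contDiff_const)).sub
    Real.smoothTransition.contDiff

lemma unitBump_eq_zero {t : ℝ} (ht : t ∉ Set.Icc (-1 : ℝ) 1) : unitBump t = 0 := by
  rw [Set.mem_Icc, not_and_or, not_le, not_le] at ht
  rcases ht with h | h
  · rw [unitBump, Real.smoothTransition.zero_of_nonpos (by linarith),
      Real.smoothTransition.zero_of_nonpos (by linarith), sub_zero]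
  · rw [unitBump, Real.smoothTransition.one_of_one_le (by linarith),
      Real.smoothTransition.one_of_one_le (by linarith), sub_self]

lemma deriv_smoothTransition_of_neg {t : ℝ} (ht : t < 0) : deriv Real.smoothTransition t = 0 := by
  have : Real.smoothTransition =ᶠ[𝓝 t] fun _ => 0 := by
    filter_upwards [Iio_mem_nhds ht] with s hs
    exact Real.smoothTransition.zero_of_nonpos (le_of_lt hs)
  rw [this.deriv_eq, deriv_const]

lemma deriv_smoothTransition_of_one_lt {t : ℝ} (ht : 1 < t) :
    deriv Real.smoothTransition t = 0 := by
  have : Real.smoothTransition =ᶠ[𝓝 t] fun _ => 1 := by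
    filter_upwards [Ioi_mem_nhds ht] with s hs
    exact Real.smoothTransition.one_of_one_le (le_of_lt hs)
  rw [this.deriv_eq, deriv_const]

lemma deriv_unitBump (t : ℝ) :
    deriv unitBump t = deriv Real.smoothTransition (t + 1) - deriv Real.smoothTransition t := by
  have hd : Differentiable ℝ Real.smoothTransition :=
    (Real.smoothTransition.contDiff (n := 1)).differentiable (by simp)
  have h1 : HasDerivAt (fun s => Real.smoothTransition (s + 1))
      (deriv Real.smoothTransition (t + 1)) t :=
    (hd (t + 1)).hasDerivAt.comp_add_const t 1
  exact (h1.sub (hd t).hasDerivAt).deriv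

lemma sum_unitBump {N : ℕ} (hN : 2 ≤ N) {t : ℝ} (ht : t ∈ Set.Icc (0 : ℝ) 1) :
    ∑ k ∈ Finset.Icc (-(N : ℤ)) N, unitBump (t + k) = 1 := by
  have hN' : (2 : ℝ) ≤ N := by exact_mod_cast hN
  have h := sum_Icc_int_telescope (fun k => Real.smoothTransition (t + k)) N
  have e : ∀ k : ℤ, unitBump (t + k) =
      Real.smoothTransition (t + (k + 1 : ℤ)) - Real.smoothTransition (t + k) := by
    intro k
    rw [unitBump]
    push_cast
    rw [add_assoc]
  simp only [e, h]
  push_cast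
  rw [Real.smoothTransition.one_of_one_le (by linarith [ht.1]),
    Real.smoothTransition.zero_of_nonpos (by linarith [ht.2]), sub_zero]

/-- The vanishing of the derivative is available only on the open half-lines. With `N ≥ 2` the end
point `t - N` is strictly negative even for `t = 1`. -/
lemma sum_deriv_unitBump {N : ℕ} (hN : 2 ≤ N) {t : ℝ} (ht : t ∈ Set.Icc (0 : ℝ) 1) :
    ∑ k ∈ Finset.Icc (-(N : ℤ)) N, deriv unitBump (t + k) = 0 := by
  have hN' : (2 : ℝ) ≤ N := by exact_mod_cast hN
  have h := sum_Icc_int_telescope (fun k => deriv Real.smoothTransition (t + k)) N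
  have e : ∀ k : ℤ, deriv unitBump (t + k) =
      deriv Real.smoothTransition (t + (k + 1 : ℤ)) - deriv Real.smoothTransition (t + k) := by
    intro k
    rw [deriv_unitBump]
    push_cast
    rw [add_assoc]
  simp only [e, h]
  push_cast
  rw [deriv_smoothTransition_of_one_lt (by linarith [ht.1]),
    deriv_smoothTransition_of_neg (by linarith [ht.2]), sub_zero]

/-- A test function on the plane whose lattice translates sum up to one. -/
def cellBump (x : Pt) : ℝ := unitBump (x.1 / (2 * Real.pi)) * unitBump (x.2 + 1 / 2)

lemma contDiff_cellBump : ContDiff ℝ ∞ cellBump := by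
  unfold cellBump
  exact (contDiff_unitBump.comp (by fun_prop)).mul (contDiff_unitBump.comp (by fun_prop))

lemma hasCompactSupport_cellBump : HasCompactSupport cellBump := by
  have hpi : 0 < 2 * Real.pi := by positivity
  refine HasCompactSupport.intro
    (K := Set.Icc (-(2 * Real.pi)) (2 * Real.pi) ×ˢ Set.Icc (-2) 2)
    (isCompact_Icc.prod isCompact_Icc) fun x hx => ?_
  rw [Set.mem_prod, not_and_or] at hx
  rcases hx with hx | hx
  · rw [cellBump, unitBump_eq_zero, zero_mul]
    contrapose! hx
    rw [Set.mem_Icc, le_div_iff₀ hpi, div_le_iff₀ hpi] at hx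
    exact ⟨by linarith [hx.1], by linarith [hx.2]⟩
  · rw [cellBump, unitBump_eq_zero (t := x.2 + 1 / 2), mul_zero]
    contrapose! hx
    exact ⟨by linarith [hx.1], by linarith [hx.2]⟩

lemma fderiv_cellBump (x : Pt) (i : Fin 2) : fderiv ℝ cellBump x (dir i) =
    if i = 0 then (2 * Real.pi)⁻¹ * (deriv unitBump (x.1 / (2 * Real.pi)) * unitBump (x.2 + 1 / 2))
    else unitBump (x.1 / (2 * Real.pi)) * deriv unitBump (x.2 + 1 / 2) := by
  have hd : Differentiable ℝ unitBump := contDiff_unitBump.differentiable (by simp)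
  have h1 : HasFDerivAt (fun x : Pt => x.1 / (2 * Real.pi))
      ((2 * Real.pi)⁻¹ • ContinuousLinearMap.fst ℝ ℝ ℝ) x := by
    simpa only [div_eq_mul_inv] using hasFDerivAt_fst.mul_const (2 * Real.pi)⁻¹
  have h2 : HasFDerivAt (fun x : Pt => x.2 + 1 / 2) (ContinuousLinearMap.snd ℝ ℝ ℝ) x :=
    hasFDerivAt_snd.add_const _
  have h3 := (hd (x.1 / (2 * Real.pi))).hasDerivAt.comp_hasFDerivAt x h1
  have h4 := (hd (x.2 + 1 / 2)).hasDerivAt.comp_hasFDerivAt x h2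
  have h5 : HasFDerivAt cellBump _ x := h3.mul h4
  rw [h5.fderiv]
  fin_cases i <;> simp [dir]
  ring

lemma sum_cellBump {N : ℕ} (hN : 2 ≤ N) {x : Pt} (hx : x ∈ refDomain) :
    ∑ k ∈ indexBox N, cellBump (x + latticeVec k) = 1 ∧
    ∀ i, ∑ k ∈ indexBox N, fderiv ℝ cellBump (x + latticeVec k) (dir i) = 0 := by
  have hpi : 0 < 2 * Real.pi := by positivity
  have ht1 : x.1 / (2 * Real.pi) ∈ Set.Icc (0 : ℝ) 1 :=
    ⟨div_nonneg hx.1.1 hpi.le, (div_le_one hpi).2 hx.1.2⟩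
  have ht2 : x.2 + 1 / 2 ∈ Set.Icc (0 : ℝ) 1 := ⟨by linarith [hx.2.1], by linarith [hx.2.2]⟩
  have e1 : ∀ k : ℤ × ℤ, (x + latticeVec k).1 / (2 * Real.pi) = x.1 / (2 * Real.pi) + k.1 := by
    intro k
    simp only [latticeVec, Prod.fst_add]
    field_simp
  have e2 : ∀ k : ℤ × ℤ, (x + latticeVec k).2 + 1 / 2 = x.2 + 1 / 2 + k.2 := by
    intro k
    simp only [latticeVec, Prod.snd_add]
    ring
  have prodsum : ∀ A B : ℝ → ℝ, ∑ k ∈ indexBox N,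
      A (x.1 / (2 * Real.pi) + k.1) * B (x.2 + 1 / 2 + k.2) =
      (∑ k ∈ Finset.Icc (-(N : ℤ)) N, A (x.1 / (2 * Real.pi) + k)) *
      ∑ k ∈ Finset.Icc (-(N : ℤ)) N, B (x.2 + 1 / 2 + k) := by
    intro A B
    rw [indexBox, Finset.sum_product, Finset.sum_mul_sum]
  refine ⟨?_, fun i => ?_⟩
  · simp only [cellBump, e1, e2, prodsum, sum_unitBump hN ht1, sum_unitBump hN ht2, mul_one]
  · simp only [fderiv_cellBump, e1, e2]
    split_ifs
    · rw [← Finset.mul_sum, prodsum, sum_deriv_unitBump hN ht1, zero_mul, mul_zero]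
    · rw [prodsum, sum_deriv_unitBump hN ht2, mul_zero]

/-- Test with `cellBump`: after folding onto the reference cell its translates sum to one and those
of its derivative to zero. This plays the role of the cancellation of boundary terms. -/
lemma HasWeakPartial.integral_eq_zero {i : Fin 2} {f g : Pt → ℝ} (h : HasWeakPartial i f g)
    (hf : IsPeriodic f) (hg : IsPeriodic g) (hfi : Integrable f refMeasure)
    (hgi : Integrable g refMeasure) : ∫ x, g x ∂refMeasure = 0 := by
  obtain ⟨N₁, hN₁⟩ := exists_integral_periodic_mul_eq contDiff_cellBump.continuous
    hasCompactSupport_cellBump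
  obtain ⟨N₂, hN₂⟩ := exists_integral_periodic_mul_eq (continuous_fderiv_dir contDiff_cellBump i)
    (hasCompactSupport_fderiv_dir hasCompactSupport_cellBump i)
  have hle1 : N₁ ≤ N₁ + N₂ + 2 := by omega
  have hle2 : N₂ ≤ N₁ + N₂ + 2 := by omega
  have h1 := hN₁ _ hle1 g hg hgi
  have h2 := hN₂ _ hle2 f hf hfi
  have key := h.2.2 _ contDiff_cellBump hasCompactSupport_cellBump
  have h3 : ∫ x, g x * ∑ k ∈ indexBox (N₁ + N₂ + 2), cellBump (x + latticeVec k) ∂refMeasure =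
      ∫ x, g x ∂refMeasure :=
    setIntegral_congr_fun measurableSet_refDomain fun x hx => by
      simp only [(sum_cellBump (by omega : 2 ≤ N₁ + N₂ + 2) hx).1, mul_one]
  have h4 : ∫ x, f x * ∑ k ∈ indexBox (N₁ + N₂ + 2),
      fderiv ℝ cellBump (x + latticeVec k) (dir i) ∂refMeasure = ∫ x, 0 ∂refMeasure :=
    setIntegral_congr_fun measurableSet_refDomain fun x hx => by
      simp only [(sum_cellBump (by omega : 2 ≤ N₁ + N₂ + 2) hx).2 i, mul_zero]
  rw [h1, h2, h3, h4, integral_zero] at key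
  linarith

/-! ### Mollification -/

/-- A sequence of bump functions shrinking to the origin. -/
def bumpSeq (n : ℕ) : ContDiffBump (0 : Pt) where
  rIn := 1 / ((n : ℝ) + 1)
  rOut := 2 * (1 / ((n : ℝ) + 1))
  rIn_pos := by positivity
  rIn_lt_rOut := by
    have : 0 < 1 / ((n : ℝ) + 1) := by positivity
    linarith

lemma tendsto_bumpSeq_rOut : Tendsto (fun n => (bumpSeq n).rOut) atTop (𝓝 0) := by
  simpa [bumpSeq] using (tendsto_one_div_add_atTop_nhds_zero_nat (𝕜 := ℝ)).const_mul 2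

open scoped Convolution in
open ContinuousLinearMap in
/-- The mollification of a function. -/
def mollify (n : ℕ) (f : Pt → ℝ) : Pt → ℝ :=
  (bumpSeq n).normed volume ⋆[lsmul ℝ ℝ, (volume : Measure Pt)] f

lemma mollify_apply (n : ℕ) (f : Pt → ℝ) (x : Pt) :
    mollify n f x = ∫ y, (bumpSeq n).normed volume y * f (x - y) := rfl

lemma mollify_apply_swap (n : ℕ) (f : Pt → ℝ) (x : Pt) :
    mollify n f x = ∫ y, f y * (bumpSeq n).normed volume (x - y) := by
  rw [mollify, convolution_eq_swap]
  simp only [ContinuousLinearMap.lsmul_apply, smul_eq_mul, mul_comm]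

lemma contDiff_mollify (n : ℕ) {f : Pt → ℝ} (hf : LocallyIntegrable f volume) :
    ContDiff ℝ ∞ (mollify n f) :=
  (bumpSeq n).hasCompactSupport_normed.contDiff_convolution_left _ (bumpSeq n).contDiff_normed hf

lemma IsPeriodic.mollify {f : Pt → ℝ} (hf : IsPeriodic f) (n : ℕ) : IsPeriodic (mollify n f) := by
  rw [isPeriodic_iff]
  intro k x
  rw [mollify_apply, mollify_apply]
  congr 1
  ext y
  rw [add_sub_right_comm, hf.add_latticeVec]

-- The derivative falls on the mollifier `φ`, and `y ↦ φ (x - y)` is itself an admissible test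
-- function.
open scoped Convolution in
open ContinuousLinearMap in
lemma HasWeakPartial.fderiv_mollify {i : Fin 2} {f g : Pt → ℝ} (h : HasWeakPartial i f g) (n : ℕ)
    (x : Pt) : fderiv ℝ (Cylinder.mollify n f) x (dir i) = Cylinder.mollify n g x := by
  set φ := (bumpSeq n).normed volume with hφ
  have hsm : ContDiff ℝ ∞ φ := (bumpSeq n).contDiff_normed
  have hcs : HasCompactSupport φ := (bumpSeq n).hasCompactSupport_normed
  have e : Cylinder.mollify n f = f ⋆[(lsmul ℝ ℝ).flip, (volume : Measure Pt)] φ := by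
    rw [Cylinder.mollify, ← convolution_flip]
  have hd := hcs.hasFDerivAt_convolution_right (lsmul ℝ ℝ : ℝ →L[ℝ] ℝ →L[ℝ] ℝ).flip h.1
    (hsm.of_le (by simp)) x
  rw [e, hd.fderiv, convolution_precompR_apply _ h.1 (hcs.fderiv ℝ)
    (hsm.continuous_fderiv (by simp)), mollify_apply_swap]
  have hsm' : ContDiff ℝ ∞ fun y => φ (x - y) := hsm.comp (contDiff_const.sub contDiff_id)
  have hcs' : HasCompactSupport fun y => φ (x - y) :=
    hcs.comp_homeomorph (Homeomorph.subLeft x)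
  have key := h.2.2 _ hsm' hcs'
  have e2 : ∀ y, fderiv ℝ (fun y => φ (x - y)) y (dir i) = -fderiv ℝ φ (x - y) (dir i) := by
    intro y
    have h1 : HasFDerivAt φ (fderiv ℝ φ (x - y)) (x - y) :=
      (hsm.differentiable (by simp)).differentiableAt.hasFDerivAt
    have h2 : HasFDerivAt (fun y => φ (x - y)) _ y :=
      h1.comp y ((hasFDerivAt_id y).const_sub x)
    rw [h2.fderiv]
    simp
  simp only [e2, mul_neg, integral_neg, neg_inj] at key
  rw [← key]
  simp [convolution, mul_comm]

lemma abs_mollify_le (n : ℕ) {f : Pt → ℝ} {M : ℝ} (hf : ∀ᵐ x, |f x| ≤ M) (x : Pt) :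
    |mollify n f x| ≤ M := by
  rw [mollify_apply_swap]
  have hc : Continuous fun y => (bumpSeq n).normed volume (x - y) :=
    (bumpSeq n).continuous_normed.comp (continuous_const.sub continuous_id)
  have hint : Integrable fun y => (bumpSeq n).normed volume (x - y) :=
    (bumpSeq n).integrable_normed.comp_sub_left x
  have h1 : ∫ y, (bumpSeq n).normed volume (x - y) = 1 := by
    rw [integral_sub_left_eq_self (fun y => (bumpSeq n).normed volume y) volume x]
    exact (bumpSeq n).integral_normed
  rw [← Real.norm_eq_abs]
  refine (norm_integral_le_of_norm_le (hint.const_mul M) ?_).trans_eq ?_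
  · filter_upwards [hf] with y hy
    rw [norm_mul, Real.norm_eq_abs, Real.norm_of_nonneg ((bumpSeq n).nonneg_normed _)]
    exact mul_le_mul_of_nonneg_right hy ((bumpSeq n).nonneg_normed _)
  · rw [integral_const_mul, h1, mul_one]

lemma tendsto_mollify_ae {f : Pt → ℝ} (hf : LocallyIntegrable f volume) :
    ∀ᵐ x, Tendsto (fun n => mollify n f x) atTop (𝓝 (f x)) :=
  ContDiffBump.ae_convolution_tendsto_right_of_locallyIntegrable (K := 2) tendsto_bumpSeq_rOut
    (Eventually.of_forall fun _ => le_rfl) hf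

lemma tendsto_mollify {f : Pt → ℝ} (hf : Continuous f) (x : Pt) :
    Tendsto (fun n => mollify n f x) atTop (𝓝 (f x)) :=
  ContDiffBump.convolution_tendsto_right_of_continuous tendsto_bumpSeq_rOut hf x

/-! ### Lipschitz representatives -/

/-- The plane carries the sup norm, so the two partial bounds add up. This is the source of the
factor 2 in all Lipschitz constants below. -/
lemma norm_fderiv_le_of_dir {f : Pt → ℝ} {x : Pt} {M : ℝ}
    (h : ∀ i, |fderiv ℝ f x (dir i)| ≤ M) : ‖fderiv ℝ f x‖ ≤ 2 * M := by
  have hM : 0 ≤ M := (abs_nonneg _).trans (h 0)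
  refine ContinuousLinearMap.opNorm_le_bound _ (by positivity) fun v => ?_
  have e : v = v.1 • dir 0 + v.2 • dir 1 := by
    ext <;> simp [dir_zero, dir_one]
  have h0 := h 0
  have h1 := h 1
  have hv1 : |v.1| ≤ ‖v‖ := norm_fst_le v
  have hv2 : |v.2| ≤ ‖v‖ := norm_snd_le v
  conv_lhs => rw [e]
  rw [map_add, map_smul, map_smul, smul_eq_mul, smul_eq_mul, Real.norm_eq_abs]
  refine (abs_add_le _ _).trans ?_
  rw [abs_mul, abs_mul]
  nlinarith [mul_le_mul hv1 h0 (abs_nonneg _) (norm_nonneg v),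
    mul_le_mul hv2 h1 (abs_nonneg _) (norm_nonneg v)]

/-- A function with bounded weak partial derivatives has a Lipschitz representative. -/
lemma exists_lipschitz_representative {f : Pt → ℝ} {g : Fin 2 → Pt → ℝ} {M : ℝ}
    (h : ∀ i, HasWeakPartial i f (g i)) (hg : ∀ i, ∀ᵐ x, |g i x| ≤ M) :
    ∃ v : Pt → ℝ, LipschitzWith (2 * M).toNNReal v ∧ f =ᵐ[volume] v := by
  have hf := (h 0).1
  have hlip : ∀ n, LipschitzWith (2 * M).toNNReal (mollify n f) := fun n => by
    refine lipschitzWith_of_nnnorm_fderiv_le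
      ((contDiff_mollify n hf).differentiable (by simp)) fun x => ?_
    rw [← NNReal.coe_le_coe, coe_nnnorm]
    refine (norm_fderiv_le_of_dir fun i => ?_).trans (Real.le_coe_toNNReal _)
    rw [(h i).fderiv_mollify]
    exact abs_mollify_le n (hg i) x
  have hlim := tendsto_mollify_ae hf
  -- The equi-Lipschitz bound passes to `f` on the set where the mollifications converge, which has
  -- full measure; from there `f` extends to a Lipschitz function on the plane.
  have hs : LipschitzOnWith (2 * M).toNNReal f
      {x | Tendsto (fun n => mollify n f x) atTop (𝓝 (f x))} := by
    refine LipschitzOnWith.of_dist_le_mul fun x hx y hy => ?_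
    exact le_of_tendsto (Tendsto.dist hx hy)
      (Eventually.of_forall fun n => (hlip n).dist_le_mul x y)
  obtain ⟨v, hv, hfv⟩ := hs.extend_real
  exact ⟨v, hv, hlim.mono fun x hx => hfv hx⟩

lemma IsPeriodic.of_ae_eq {f v : Pt → ℝ} (hf : IsPeriodic f) (hv : Continuous v)
    (h : f =ᵐ[volume] v) : IsPeriodic v := by
  rw [isPeriodic_iff]
  intro k
  have h1 : (fun x => v (x + latticeVec k)) =ᵐ[volume] v := by
    have := (measurePreserving_add_right (volume : Measure Pt)
      (latticeVec k)).quasiMeasurePreserving.ae_eq_comp h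
    filter_upwards [this, h] with x h1 h2
    simp only [Function.comp_apply, hf.add_latticeVec] at h1
    rw [← h1, h2]
  exact congrFun ((hv.comp (continuous_add_const _)).ae_eq_iff_eq volume hv |>.1 h1)

/-! ### Fundamental theorem of calculus on lines, and integration by parts -/

lemma hasDerivAt_along_dir {f : Pt → ℝ} (hf : ContDiff ℝ ∞ f) (i : Fin 2) (x : Pt) (t : ℝ) :
    HasDerivAt (fun t => f (x + t • dir i)) (fderiv ℝ f (x + t • dir i) (dir i)) t := by
  have h1 : HasFDerivAt f (fderiv ℝ f (x + t • dir i)) (x + t • dir i) :=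
    (hf.differentiable (by simp)).differentiableAt.hasFDerivAt
  have h2 : HasDerivAt (fun t : ℝ => x + t • dir i) (dir i) t := by
    simpa using ((hasDerivAt_id t).smul_const (dir i)).const_add x
  exact h1.comp_hasDerivAt t h2

/-- For each fixed `t` the translation by `t • v` preserves null sets; Fubini exchanges the two
quantifiers. -/
lemma ae_ae_line {P : Pt → Prop} (h : ∀ᵐ x, P x) (v : Pt) : ∀ᵐ x : Pt, ∀ᵐ t : ℝ, P (x + t • v) := by
  obtain ⟨s, hs, hsm, hs0⟩ := exists_measurable_superset_of_null h
  have hmeas : Measurable fun z : Pt × ℝ => z.1 + z.2 • v := by fun_prop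
  have key : ∀ᵐ t : ℝ, ∀ᵐ x : Pt, x + t • v ∉ s := by
    refine Eventually.of_forall fun t => ?_
    have h0 : ∀ᵐ x : Pt, x ∉ s := measure_eq_zero_iff_ae_notMem.1 hs0
    exact (measurePreserving_add_right (volume : Measure Pt) (t • v)).quasiMeasurePreserving.ae h0
  rw [← Measure.ae_ae_comm (hmeas hsm).compl] at key
  filter_upwards [key] with x hx
  filter_upwards [hx] with t ht
  by_contra hP
  exact ht (hs hP)

/-- The fundamental theorem of calculus along almost every line. -/
lemma HasWeakPartial.sub_eq_integral {i : Fin 2} {f g : Pt → ℝ} (h : HasWeakPartial i f g)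
    (hf : Continuous f) {M : ℝ} (hg : ∀ᵐ x, |g x| ≤ M) :
    ∀ᵐ x : Pt, ∀ s : ℝ, f (x + s • dir i) - f x = ∫ t in (0 : ℝ)..s, g (x + t • dir i) := by
  filter_upwards [ae_ae_line (tendsto_mollify_ae h.2.1) (dir i)] with x hx s
  have h1 : ∀ n, Cylinder.mollify n f (x + s • dir i) - Cylinder.mollify n f x =
      ∫ t in (0 : ℝ)..s, Cylinder.mollify n g (x + t • dir i) := by
    intro n
    have hsm := contDiff_mollify n h.1
    rw [intervalIntegral.integral_eq_sub_of_hasDerivAt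
      (f := fun t => Cylinder.mollify n f (x + t • dir i))]
    · simp
    · intro t _
      rw [← h.fderiv_mollify]
      exact hasDerivAt_along_dir hsm i x t
    · refine Continuous.intervalIntegrable ?_ _ _
      exact (contDiff_mollify n h.2.1).continuous.comp (by fun_prop)
  have h2 : Tendsto (fun n => ∫ t in (0 : ℝ)..s, Cylinder.mollify n g (x + t • dir i)) atTop
      (𝓝 (∫ t in (0 : ℝ)..s, g (x + t • dir i))) := by
    refine intervalIntegral.tendsto_integral_filter_of_dominated_convergence (fun _ => M)
      (Eventually.of_forall fun n => ?_) (Eventually.of_forall fun n => ?_)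
      intervalIntegrable_const (hx.mono fun t ht _ => ht)
    · refine Continuous.aestronglyMeasurable ?_
      exact (contDiff_mollify n h.2.1).continuous.comp (by fun_prop)
    · exact Eventually.of_forall fun t _ => abs_mollify_le n hg _
  simp only [← h1] at h2
  exact tendsto_nhds_unique ((tendsto_mollify hf _).sub (tendsto_mollify hf _)) h2

lemma exists_bound_of_isPeriodic {f : Pt → ℝ} (hf : Continuous f) (hp : IsPeriodic f) :
    ∃ M, ∀ x, |f x| ≤ M := by
  obtain ⟨M, hM⟩ := isCompact_refDomain.exists_bound_of_continuousOn hf.continuousOn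
  refine ⟨M, fun x => ?_⟩
  obtain ⟨y, hy, k, rfl⟩ := exists_mem_refDomain x
  rw [hp.add_latticeVec]
  exact hM y hy

/-- Integration by parts `∫ (∂_i w)² = -∫ w ∂_i² w` on the reference domain. -/
lemma integral_sq_weakPartial {i : Fin 2} {w p q : Pt → ℝ} (hw : HasWeakPartial i w p)
    (hp : HasWeakPartial i p q) (hc : Continuous w) (pw : IsPeriodic w) (pp : IsPeriodic p)
    (pq : IsPeriodic q) {M : ℝ} (hM : ∀ᵐ x, |p x| ≤ M) (hq : Integrable q refMeasure) :
    ∫ x, p x ^ 2 ∂refMeasure = -∫ x, w x * q x ∂refMeasure := by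
  obtain ⟨A, hA⟩ := exists_bound_of_isPeriodic hc pw
  have hpm : AEStronglyMeasurable p refMeasure :=
    hw.2.1.aestronglyMeasurable.restrict
  have hpi : Integrable p refMeasure :=
    Integrable.of_bound hpm M (ae_refMeasure_of_ae hM)
  have ismol : ∀ n, Continuous (Cylinder.mollify n w) := fun n => (contDiff_mollify n hw.1).continuous
  have ismolp : ∀ n, Continuous (Cylinder.mollify n p) :=
    fun n => (contDiff_mollify n hw.2.1).continuous
  have hAw : ∀ n x, |Cylinder.mollify n w x| ≤ A := fun n x =>
    abs_mollify_le n (Eventually.of_forall hA) x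
  have hMp : ∀ n x, |Cylinder.mollify n p x| ≤ M := fun n x => abs_mollify_le n hM x
  have i1 : ∀ n, Integrable (fun x => q x * Cylinder.mollify n w x) refMeasure := fun n =>
    hq.mul_bdd (ismol n).aestronglyMeasurable (Eventually.of_forall (hAw n))
  have i2 : ∀ n, Integrable (fun x => p x * Cylinder.mollify n p x) refMeasure := fun n =>
    hpi.mul_bdd (ismolp n).aestronglyMeasurable (Eventually.of_forall (hMp n))
  -- Mollifying `w` makes the product rule available: `∂_i (p w_n) = q w_n + p p_n` has zero mean.
  -- The mollification is removed afterwards by dominated convergence.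
  have h1 : ∀ n, (∫ x, q x * Cylinder.mollify n w x ∂refMeasure) +
      ∫ x, p x * Cylinder.mollify n p x ∂refMeasure = 0 := by
    intro n
    have h := hp.mul_contDiff (contDiff_mollify n hw.1)
    simp only [hw.fderiv_mollify] at h
    rw [← integral_add (i1 n) (i2 n)]
    exact h.integral_eq_zero (pp.mul (pw.mollify n))
      ((pq.mul (pw.mollify n)).add (pp.mul (pp.mollify n)))
      (hpi.mul_bdd (ismol n).aestronglyMeasurable (Eventually.of_forall (hAw n)))
      ((i1 n).add (i2 n))
  have l1 : Tendsto (fun n => ∫ x, q x * Cylinder.mollify n w x ∂refMeasure) atTop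
      (𝓝 (∫ x, q x * w x ∂refMeasure)) := by
    refine tendsto_integral_of_dominated_convergence (fun x => |q x| * A)
      (fun n => (i1 n).aestronglyMeasurable) (hq.abs.mul_const A) (fun n => ?_) ?_
    · refine Eventually.of_forall fun x => ?_
      rw [norm_mul]
      exact mul_le_mul_of_nonneg_left (hAw n x) (norm_nonneg _)
    · exact Eventually.of_forall fun x => (tendsto_mollify hc x).const_mul _
  have l2 : Tendsto (fun n => ∫ x, p x * Cylinder.mollify n p x ∂refMeasure) atTop
      (𝓝 (∫ x, p x * p x ∂refMeasure)) := by
    refine tendsto_integral_of_dominated_convergence (fun x => |p x| * M)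
      (fun n => (i2 n).aestronglyMeasurable) (hpi.abs.mul_const M) (fun n => ?_) ?_
    · refine Eventually.of_forall fun x => ?_
      rw [norm_mul]
      exact mul_le_mul_of_nonneg_left (hMp n x) (norm_nonneg _)
    · filter_upwards [ae_refMeasure_of_ae (tendsto_mollify_ae hw.2.1)] with x hx
      exact hx.const_mul _
  have l3 := l1.add l2
  simp only [h1] at l3
  have := tendsto_nhds_unique l3 tendsto_const_nhds
  simp only [sq, mul_comm (w _)]
  linarith

/-! ### Jets of admissible deformations -/

/-- The affine part of the components of an admissible deformation. -/
def affinePart (lam : ℝ) (j : Fin 3) (x : Pt) : ℝ := ![0, x.1, (1 - lam) * x.2] j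

/-- The partial derivatives of the affine part of an admissible deformation. -/
def slope (lam : ℝ) (i : Fin 2) (j : Fin 3) : ℝ := ![![0, 1, 0], ![0, 0, 1 - lam]] i j

lemma abs_slope_le {lam : ℝ} (h0 : 0 ≤ lam) (h1 : lam ≤ 1) (i : Fin 2) (j : Fin 3) :
    |slope lam i j| ≤ 1 := by
  fin_cases i <;> fin_cases j <;> simp [slope, abs_le]; constructor <;> linarith

lemma hasWeakPartial_affinePart (lam : ℝ) (i : Fin 2) (j : Fin 3) :
    HasWeakPartial i (affinePart lam j) (fun _ => slope lam i j) := by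
  have h0 := hasWeakPartial_const i 0
  have h1 := hasWeakPartial_fst i 1
  have h2 := hasWeakPartial_snd i (1 - lam)
  fin_cases j
  · fin_cases i <;> exact h0
  · fin_cases i <;> simpa [affinePart, slope] using! h1
  · fin_cases i <;> simpa [affinePart, slope] using! h2

/-- Entries of the metric tensor in terms of the radius and of the first derivatives. -/
def metricOf (r : ℝ) (P : Fin 2 → Fin 3 → ℝ) (i k : Fin 2) : ℝ :=
  P i 0 * P k 0 + (r * P i 1) * (r * P k 1) + P i 2 * P k 2

/-- Components of the second derivative of the deformed position. -/
def hessOf (r : ℝ) (P : Fin 2 → Fin 3 → ℝ) (Q : Fin 2 → Fin 2 → Fin 3 → ℝ) (i k : Fin 2) :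
    Fin 3 → ℝ :=
  ![Q i k 0 - r * P i 1 * P k 1, P i 0 * P k 1 + P k 0 * P i 1 + r * Q i k 1, Q i k 2]

/-- The energy density. -/
def density (h r : ℝ) (P : Fin 2 → Fin 3 → ℝ) (Q : Fin 2 → Fin 2 → Fin 3 → ℝ) : ℝ :=
  (∑ i, ∑ k, (metricOf r P i k - (1 : Matrix (Fin 2) (Fin 2) ℝ) i k) ^ 2) +
    h ^ 2 * ∑ i, ∑ k, ∑ j, hessOf r P Q i k j ^ 2

lemma energyNL_eq (h : ℝ) (Φ : Deformation) : energyNL h Φ =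
    ∫ x, density h (Φ x 0) (fun i j => Φ.d i j x) (fun i k j => Φ.dd i k j x) ∂refMeasure := by
  unfold energyNL
  congr 1
  ext x
  unfold density
  congr 1
  refine Finset.sum_congr rfl fun i _ => Finset.sum_congr rfl fun k _ => ?_
  rw [Matrix.sub_apply]
  congr 2
  simp [Deformation.metric, Deformation.grad, metricOf, Matrix.mul_apply, Fin.sum_univ_three]

/-- `w`, `p`, `q` are the periodic parts of an admissible deformation, with their weak
derivatives of the first and second order. -/
structure IsJet (lam m : ℝ) (w : Fin 3 → Pt → ℝ) (p : Fin 2 → Fin 3 → Pt → ℝ)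
    (q : Fin 2 → Fin 2 → Fin 3 → Pt → ℝ) : Prop where
  lipschitz : ∀ j, LipschitzWith (2 * (m + 1)).toNNReal (w j)
  per_w : ∀ j, IsPeriodic (w j)
  per_p : ∀ i j, IsPeriodic (p i j)
  per_q : ∀ i k j, IsPeriodic (q i k j)
  partial_w : ∀ i j, HasWeakPartial i (w j) (p i j)
  partial_p : ∀ i k j, HasWeakPartial i (p k j) (q i k j)
  memLp_q : ∀ i k j, MemLp (q i k j) 2 refMeasure
  one_le : ∀ x, 1 ≤ w 0 x
  slope_le : ∀ i j, ∀ᵐ x, |p i j x + slope lam i j| ≤ m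
  nonneg : ∀ᵐ x, 0 ≤ p 1 2 x + slope lam 1 2

/-- The energy of a deformation in terms of its jet. -/
def jetEnergy (h lam : ℝ) (w : Fin 3 → Pt → ℝ) (p : Fin 2 → Fin 3 → Pt → ℝ)
    (q : Fin 2 → Fin 2 → Fin 3 → Pt → ℝ) : ℝ :=
  ∫ x, density h (w 0 x) (fun i j => p i j x + slope lam i j) (fun i k j => q i k j x) ∂refMeasure

lemma HasWeakPartial.weakPartial {i : Fin 2} {f g : Pt → ℝ} (h : HasWeakPartial i f g) :
    HasWeakPartial i f (weakPartial i f) := by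
  have hex : ∃ g, HasWeakPartial i f g := ⟨g, h⟩
  rw [Cylinder.weakPartial, dif_pos hex]
  exact hex.choose_spec

lemma HasWeakPartial.weakPartial_ae_eq {i : Fin 2} {f g : Pt → ℝ} (h : HasWeakPartial i f g) :
    Cylinder.weakPartial i f =ᵐ[volume] g := h.weakPartial.ae_eq h

/-- If the derivatives of a deformation agree with a jet, then so do the energies. -/
lemma energyNL_eq_jetEnergy {Φ : Deformation} {lam : ℝ} {w : Fin 3 → Pt → ℝ}
    {p : Fin 2 → Fin 3 → Pt → ℝ} {q : Fin 2 → Fin 2 → Fin 3 → Pt → ℝ}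
    (hw : Φ.comp 0 =ᵐ[volume] w 0)
    (hp : ∀ i j, Φ.d i j =ᵐ[volume] fun x => p i j x + slope lam i j)
    (hq : ∀ i k j, Φ.dd i k j =ᵐ[volume] q i k j) (h : ℝ) :
    energyNL h Φ = jetEnergy h lam w p q := by
  rw [energyNL_eq, jetEnergy]
  refine integral_congr_ae (ae_refMeasure_of_ae ?_)
  have hp' : ∀ᵐ x, ∀ i j, Φ.d i j x = p i j x + slope lam i j :=
    ae_all_iff.2 fun i => ae_all_iff.2 fun j => hp i j
  have hq' : ∀ᵐ x, ∀ i k j, Φ.dd i k j x = q i k j x :=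
    ae_all_iff.2 fun i => ae_all_iff.2 fun k => ae_all_iff.2 fun j => hq i k j
  filter_upwards [hw, hp', hq'] with x h1 h2 h3
  have h1' : Φ x 0 = w 0 x := h1
  simp only [h1', h2, h3]

lemma forall_le_of_ae_le {f : Pt → ℝ} (hf : Continuous f) {c : ℝ} (h : ∀ᵐ x, c ≤ f x) (x : Pt) :
    c ≤ f x := by
  have h1 : (fun x => max c (f x)) =ᵐ[volume] f := h.mono fun x hx => max_eq_right hx
  have h2 := (continuous_const.max hf).ae_eq_iff_eq volume hf |>.1 h1
  have h3 := congrFun h2 x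
  exact max_eq_right_iff.1 h3

lemma slope_one_two (lam : ℝ) : slope lam 1 2 = 1 - lam := rfl

lemma ae_abs_le_iff_eLpNorm_le {f : Pt → ℝ} {m : ℝ} (hm : 0 ≤ m) :
    eLpNorm f ∞ refMeasure ≤ ENNReal.ofReal m ↔ ∀ᵐ x ∂refMeasure, |f x| ≤ m := by
  rw [eLpNorm_exponent_top]
  constructor
  · intro h
    filter_upwards [ae_le_eLpNormEssSup (f := f) (μ := refMeasure)] with x hx
    have := hx.trans h
    rwa [← ofReal_norm, ENNReal.ofReal_le_ofReal_iff hm] at this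
  · exact fun h => eLpNormEssSup_le_of_ae_bound h

/-- `weakPartial` selects an arbitrary representative, whereas a jet fixes derivatives that are
periodic everywhere. The slope bound makes the periodic parts Lipschitz, so that the mandrel
constraint holds at every point. -/
lemma exists_jet {lam m : ℝ} (hm : 1 ≤ m) (hl0 : 0 ≤ lam) (hl1 : lam ≤ 1) {Φ : Deformation}
    (hΦ : Φ ∈ admissibleNL lam 1 (ENNReal.ofReal m)) :
    ∃ w p q, IsJet lam m w p q ∧ ∀ h, energyNL h Φ = jetEnergy h lam w p q := by
  obtain ⟨h0, h1, h2, hr, hd, hn⟩ := hΦ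
  have H : ∀ j, MemHPer 2 fun x => Φ.comp j x - affinePart lam j x := by
    intro j
    fin_cases j
    · simpa [affinePart] using! h0
    · exact h1
    · exact h2
  have Hper : ∀ j, IsPeriodic fun x => Φ.comp j x - affinePart lam j x := fun j => (H j).1
  choose p hp hp1 using fun i j => (H j).2.2 i
  have pp : ∀ i j, IsPeriodic (p i j) := fun i j => (hp1 i j).1
  choose q hq hq0 using fun i k j => (hp1 k j).2.2 i
  have hwp : ∀ i j, HasWeakPartial i (Φ.comp j) fun x => p i j x + slope lam i j := fun i j => by
    simpa only [sub_add_cancel] using! (hp i j).add (hasWeakPartial_affinePart lam i j)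
  have hdp : ∀ i j, Φ.d i j =ᵐ[volume] fun x => p i j x + slope lam i j := fun i j =>
    (hwp i j).weakPartial_ae_eq
  have hwq : ∀ i k j, HasWeakPartial i (Φ.d k j) (q i k j) := fun i k j => by
    have := (hq i k j).add (hasWeakPartial_const i (slope lam k j))
    exact this.congr (hdp k j).symm (Eventually.of_forall fun x => add_zero _)
  have hle : ∀ i j, ∀ᵐ x, |p i j x + slope lam i j| ≤ m := fun i j => by
    refine ae_of_ae_refMeasure (fun k x => by rw [(pp i j).add_latticeVec]) ?_
    have h3 := (ae_abs_le_iff_eLpNorm_le (by linarith)).1 (hd i j)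
    filter_upwards [h3, ae_refMeasure_of_ae (hdp i j)] with x h4 h5
    rwa [← h5]
  -- The slopes of the affine part are at most one in modulus.
  have hle' : ∀ i j, ∀ᵐ x, |p i j x| ≤ m + 1 := fun i j => by
    filter_upwards [hle i j] with x hx
    have h5 := abs_slope_le hl0 hl1 i j
    rw [abs_le] at hx h5 ⊢
    constructor <;> linarith [hx.1, hx.2, h5.1, h5.2]
  choose w hwl hwe using fun j =>
    exists_lipschitz_representative (fun i => hp i j) (fun i => hle' i j)
  have hw0 : Φ.comp 0 =ᵐ[volume] w 0 := by
    filter_upwards [hwe 0] with x hx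
    simpa [affinePart] using hx
  refine ⟨w, p, q, ⟨hwl, fun j => (Hper j).of_ae_eq (hwl j).continuous (hwe j), pp,
    fun i k j => (hq0 i k j).1,
    fun i j => (hp i j).congr (hwe j) (Eventually.of_forall fun _ => rfl), hq,
    fun i k j => (hq0 i k j).2, ?_, hle, ?_⟩,
    energyNL_eq_jetEnergy hw0 hdp fun i k j => (hwq i k j).weakPartial_ae_eq⟩
  · refine forall_le_of_ae_le (hwl 0).continuous ?_
    have := (Hper 0).of_ae_eq (hwl 0).continuous (hwe 0)
    refine ae_of_ae_refMeasure (fun k x => by rw [this.add_latticeVec]) ?_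
    filter_upwards [hr, ae_refMeasure_of_ae hw0] with x h3 h4
    exact h4 ▸ h3
  · refine ae_of_ae_refMeasure (fun k x => by rw [(pp 1 2).add_latticeVec]) ?_
    filter_upwards [hn, ae_refMeasure_of_ae (hdp 1 2)] with x h3 h4
    rwa [← h4]

lemma IsJet.continuous {lam m : ℝ} {w p q} (H : IsJet lam m w p q) (j : Fin 3) :
    Continuous (w j) := (H.lipschitz j).continuous

lemma IsJet.abs_p_le {lam m : ℝ} {w p q} (H : IsJet lam m w p q) (hl0 : 0 ≤ lam) (hl1 : lam ≤ 1)
    (i : Fin 2) (j : Fin 3) : ∀ᵐ x, |p i j x| ≤ m + 1 := by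
  filter_upwards [H.slope_le i j] with x hx
  have h5 := abs_slope_le hl0 hl1 i j
  rw [abs_le] at hx h5 ⊢
  constructor <;> linarith [hx.1, hx.2, h5.1, h5.2]

lemma IsJet.aestronglyMeasurable_p {lam m : ℝ} {w p q} (H : IsJet lam m w p q) (i : Fin 2)
    (j : Fin 3) : AEStronglyMeasurable (p i j) refMeasure :=
  (H.partial_w i j).2.1.aestronglyMeasurable.restrict

lemma memLp_two_of_continuous {f : Pt → ℝ} (hf : Continuous f) : MemLp f 2 refMeasure := by
  obtain ⟨M, hM⟩ := isCompact_refDomain.exists_bound_of_continuousOn hf.continuousOn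
  refine MemLp.of_bound hf.aestronglyMeasurable M ?_
  filter_upwards [ae_restrict_mem measurableSet_refDomain] with x hx
  exact hM x hx

lemma IsJet.memLp_p {lam m : ℝ} {w p q} (H : IsJet lam m w p q) (i : Fin 2) (j : Fin 3) :
    MemLp (p i j) 2 refMeasure := by
  refine MemLp.of_bound (H.aestronglyMeasurable_p i j) (m + |slope lam i j|) ?_
  filter_upwards [ae_refMeasure_of_ae (H.slope_le i j)] with x hx
  have := abs_sub (p i j x + slope lam i j) (slope lam i j)
  rw [add_sub_cancel_right] at this
  exact this.trans (by linarith)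

/-- Converse of `exists_jet`: the two together allow the minimization to be carried out over jets.
-/
lemma IsJet.exists_admissible {lam m : ℝ} {w p q} (H : IsJet lam m w p q) (hm : 0 ≤ m) :
    ∃ Φ ∈ admissibleNL lam 1 (ENNReal.ofReal m), ∀ h, energyNL h Φ = jetEnergy h lam w p q := by
  set Φ : Deformation := fun x j => w j x + affinePart lam j x with hΦ
  have hcomp : ∀ j, Φ.comp j = fun x => w j x + affinePart lam j x := fun j => rfl
  have hmem : ∀ j, MemHPer 2 (w j) := fun j =>
    ⟨H.per_w j, memLp_two_of_continuous (H.continuous j), fun k =>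
      ⟨p k j, H.partial_w k j, H.per_p k j, H.memLp_p k j, fun i =>
        ⟨q i k j, H.partial_p i k j, H.per_q i k j, H.memLp_q i k j⟩⟩⟩
  have hwp : ∀ i j, HasWeakPartial i (Φ.comp j) fun x => p i j x + slope lam i j := fun i j =>
    (H.partial_w i j).add (hasWeakPartial_affinePart lam i j)
  have hdp : ∀ i j, Φ.d i j =ᵐ[volume] fun x => p i j x + slope lam i j := fun i j =>
    (hwp i j).weakPartial_ae_eq
  have hwq : ∀ i k j, HasWeakPartial i (Φ.d k j) (q i k j) := fun i k j => by
    have := (H.partial_p i k j).add (hasWeakPartial_const i (slope lam k j))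
    exact this.congr (hdp k j).symm (Eventually.of_forall fun x => add_zero _)
  have e0 : Φ.comp 0 = w 0 := by ext x; simp [hcomp, affinePart]
  refine ⟨Φ, ⟨?_, ?_, ?_, ?_, ?_, ?_⟩,
    energyNL_eq_jetEnergy (Eventually.of_forall fun x => congrFun e0 x) hdp
      fun i k j => (hwq i k j).weakPartial_ae_eq⟩
  · rw [e0]; exact hmem 0
  · convert hmem 1 using 2
    simp [hcomp, affinePart]
  · convert hmem 2 using 2
    simp [hcomp, affinePart]
  · refine Eventually.of_forall fun x => ?_
    have := congrFun e0 x
    exact (H.one_le x).trans_eq this.symm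
  · intro i j
    rw [ae_abs_le_iff_eLpNorm_le hm]
    filter_upwards [ae_refMeasure_of_ae (H.slope_le i j), ae_refMeasure_of_ae (hdp i j)]
      with x h1 h2
    rwa [h2]
  · filter_upwards [ae_refMeasure_of_ae H.nonneg, ae_refMeasure_of_ae (hdp 1 2)] with x h1 h2
    rwa [h2]

/-! ### The unbuckled deformation -/

lemma isJet_unbuckled {lam m : ℝ} (hm : 1 ≤ m) (hl0 : 0 ≤ lam) (hl1 : lam ≤ 1) :
    IsJet lam m (fun j _ => if j = 0 then 1 else 0) (fun _ _ _ => 0) (fun _ _ _ _ => 0) where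
  lipschitz j := LipschitzWith.const' _
  per_w j := isPeriodic_const _
  per_p i j := isPeriodic_const _
  per_q i k j := isPeriodic_const _
  partial_w i j := hasWeakPartial_const i _
  partial_p i k j := hasWeakPartial_const i _
  memLp_q i k j := memLp_const _
  one_le x := by simp
  slope_le i j := Eventually.of_forall fun x => by
    simpa using (abs_slope_le hl0 hl1 i j).trans hm
  nonneg := Eventually.of_forall fun x => by simpa [slope_one_two] using hl1

/-- Circles keep their length, so the strain is purely axial; the only bending is the unit curvature
of the circles, which yields the bulk term. -/
lemma jetEnergy_unbuckled (h lam : ℝ) :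
    jetEnergy h lam (fun j _ => if j = 0 then 1 else 0) (fun _ _ _ => 0) (fun _ _ _ _ => 0) =
      2 * Real.pi * (((1 - lam) ^ 2 - 1) ^ 2 + h ^ 2) := by
  have e : ∀ x : Pt, density h ((fun (j : Fin 3) (_ : Pt) => if j = 0 then (1 : ℝ) else 0) 0 x)
      (fun i j => 0 + slope lam i j) (fun _ _ _ => 0) = ((1 - lam) ^ 2 - 1) ^ 2 + h ^ 2 := by
    intro x
    simp [density, metricOf, hessOf, slope, Fin.sum_univ_two, Fin.sum_univ_three]
    ring
  rw [jetEnergy, integral_congr_ae (Eventually.of_forall e), integral_const,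
    refMeasure_real_univ, smul_eq_mul]

/-! ### One-dimensional slices -/

/-- An interpolation inequality for nonnegative periodic functions on the line. -/
lemma integral_sq_le_of_periodic {T δ M : ℝ} (hδ : 0 < δ) (hδT : δ ≤ T) {F a : ℝ → ℝ}
    (hF : Continuous F) (hF0 : ∀ t, 0 ≤ F t) (pF : Function.Periodic F T)
    (pa : Function.Periodic a T) (ha : AEStronglyMeasurable a volume) (haM : ∀ᵐ t, |a t| ≤ M)
    (hFa : ∀ s t, F t - F s = ∫ u in s..t, a u) :
    ∫ t in (0 : ℝ)..T, F t ^ 2 ≤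
      3 / (2 * δ) * (∫ t in (0 : ℝ)..T, F t) ^ 2 + δ ^ 2 / 2 * ∫ t in (0 : ℝ)..T, a t ^ 2 := by
  have hT : 0 < T := hδ.trans_le hδT
  set Φ := ∫ t in (0 : ℝ)..T, F t with hΦ
  set G := ∫ t in (0 : ℝ)..T, a t ^ 2 with hG
  have ia : ∀ s t, IntervalIntegrable a volume s t := fun s t =>
    (intervalIntegrable_const (c := M)).mono_fun ha.restrict
      ((ae_restrict_of_ae haM).mono fun u hu => hu.trans (le_abs_self M))
  have ia2 : ∀ s t, IntervalIntegrable (fun u => a u ^ 2) volume s t := fun s t =>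
    (intervalIntegrable_const (c := M ^ 2)).mono_fun (ha.pow 2).restrict
      ((ae_restrict_of_ae haM).mono fun u hu => by
        simp only [Real.norm_eq_abs, abs_pow]
        exact pow_le_pow_left₀ (abs_nonneg _) (hu.trans (le_abs_self M)) 2)
  have hΦ0 : 0 ≤ Φ := intervalIntegral.integral_nonneg hT.le fun t _ => hF0 t
  have hwin : ∀ g : ℝ → ℝ, Function.Periodic g T → (∀ s t, IntervalIntegrable g volume s t) →
      (∀ t, 0 ≤ g t) → ∀ θ, ∫ t in θ..(θ + δ), g t ≤ ∫ t in (0 : ℝ)..T, g t := by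
    intro g pg ig g0 θ
    have h1 := pg.intervalIntegral_add_eq θ 0
    rw [zero_add] at h1
    rw [← h1]
    exact intervalIntegral.integral_mono_interval le_rfl (by linarith) (by linarith)
      (Eventually.of_forall g0) (ig _ _)
  -- By `|a| ≤ κ/2 + a²/(2κ)` the function `F` drops by at most `D` on a window of length `δ`.
  -- Averaging over the window bounds `F` by `Φ/δ + D` everywhere, and this replaces one of the two
  -- factors in `F²`.
  have key : ∀ κ > 0, δ * ∫ t in (0 : ℝ)..T, F t ^ 2 ≤
      Φ ^ 2 + δ * Φ * (κ * δ / 2 + G / (2 * κ)) := by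
    intro κ hκ
    set D := κ * δ / 2 + G / (2 * κ) with hD
    have h1 : ∀ θ, ∀ t ∈ Set.Icc θ (θ + δ), F θ - D ≤ F t := by
      intro θ t ht
      have i1 : ∀ s t, IntervalIntegrable (fun u => κ / 2 + (2 * κ)⁻¹ * a u ^ 2) volume s t :=
        fun s t => intervalIntegrable_const.add ((ia2 s t).const_mul _)
      have h2 : -(∫ u in θ..t, a u) ≤ ∫ u in θ..t, (κ / 2 + (2 * κ)⁻¹ * a u ^ 2) := by
        rw [← intervalIntegral.integral_neg]
        refine intervalIntegral.integral_mono_on ht.1 (ia _ _).neg (i1 _ _) fun u _ => ?_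
        have : κ / 2 + (2 * κ)⁻¹ * a u ^ 2 + a u = (2 * κ)⁻¹ * (a u + κ) ^ 2 := by
          field_simp
          ring
        have h3 : 0 ≤ (2 * κ)⁻¹ * (a u + κ) ^ 2 := by positivity
        linarith
      have h3 : ∫ u in θ..t, (κ / 2 + (2 * κ)⁻¹ * a u ^ 2) ≤
          ∫ u in θ..(θ + δ), (κ / 2 + (2 * κ)⁻¹ * a u ^ 2) :=
        intervalIntegral.integral_mono_interval le_rfl ht.1 ht.2
          (Eventually.of_forall fun u => by positivity) (i1 _ _)
      have h4 : ∫ u in θ..(θ + δ), (κ / 2 + (2 * κ)⁻¹ * a u ^ 2) =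
          κ * δ / 2 + (2 * κ)⁻¹ * ∫ u in θ..(θ + δ), a u ^ 2 := by
        rw [intervalIntegral.integral_add intervalIntegrable_const ((ia2 _ _).const_mul _),
          intervalIntegral.integral_const, intervalIntegral.integral_const_mul, smul_eq_mul]
        ring
      have h5 := hwin (fun u => a u ^ 2) (fun u => by simp only [pa u]) ia2
        (fun u => sq_nonneg _) θ
      have h6 : (2 * κ)⁻¹ * ∫ u in θ..(θ + δ), a u ^ 2 ≤ G / (2 * κ) := by
        rw [div_eq_inv_mul]
        exact mul_le_mul_of_nonneg_left h5 (by positivity)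
      have h7 := hFa θ t
      linarith
    have h2 : ∀ θ, δ * F θ ≤ Φ + δ * D := by
      intro θ
      have h3 : ∫ _ in θ..(θ + δ), (F θ - D) ≤ ∫ t in θ..(θ + δ), F t :=
        intervalIntegral.integral_mono_on (by linarith) intervalIntegrable_const
          (hF.intervalIntegrable _ _) (h1 θ)
      rw [intervalIntegral.integral_const, smul_eq_mul] at h3
      have h4 := hwin F pF (fun s t => hF.intervalIntegrable s t) hF0 θ
      linarith
    have h5 : ∫ t in (0 : ℝ)..T, δ * F t ^ 2 ≤ ∫ t in (0 : ℝ)..T, (Φ + δ * D) * F t := by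
      refine intervalIntegral.integral_mono_on hT.le
        (Continuous.intervalIntegrable (by fun_prop) _ _)
        (Continuous.intervalIntegrable (by fun_prop) _ _) fun t _ => ?_
      nlinarith [h2 t, hF0 t]
    rw [intervalIntegral.integral_const_mul, intervalIntegral.integral_const_mul] at h5
    nlinarith
  have hG0 : 0 ≤ G := intervalIntegral.integral_nonneg hT.le fun t _ => sq_nonneg _
  -- The weight `κ = Φ/δ²` turns the bound into the asserted one; it degenerates for `Φ = 0`, where
  -- any `κ` forces `∫ F² ≤ 0`.
  rcases hΦ0.eq_or_lt with h0 | h0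
  · have h1 := key 1 one_pos
    rw [← h0] at h1 ⊢
    have h2 : ∫ t in (0 : ℝ)..T, F t ^ 2 ≤ 0 := by
      by_contra hcon
      push Not at hcon
      have := mul_pos hδ hcon
      nlinarith
    have : 0 ≤ δ ^ 2 / 2 * G := by positivity
    linarith
  · have h1 := key (Φ / δ ^ 2) (by positivity)
    have e : Φ ^ 2 + δ * Φ * (Φ / δ ^ 2 * δ / 2 + G / (2 * (Φ / δ ^ 2))) =
        δ * (3 / (2 * δ) * Φ ^ 2 + δ ^ 2 / 2 * G) := by
      field_simp
      ring
    rw [e] at h1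
    exact le_of_mul_le_mul_left h1 hδ

lemma ae_ae_slice {P : Pt → Prop} (h : ∀ᵐ x, P x) : ∀ᵐ z : ℝ, ∀ᵐ θ : ℝ, P (θ, z) := by
  rw [Measure.volume_eq_prod] at h
  have h2 := (Measure.measurePreserving_swap (μ := (volume : Measure ℝ))
    (ν := (volume : Measure ℝ))).quasiMeasurePreserving.ae h
  exact Measure.ae_ae_of_ae_prod h2

lemma aestronglyMeasurable_slice {f : Pt → ℝ} (hf : AEStronglyMeasurable f volume) :
    ∀ᵐ z : ℝ, AEStronglyMeasurable (fun θ : ℝ => f (θ, z)) volume := by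
  rw [Measure.volume_eq_prod] at hf
  exact hf.prod_swap.prodMk_left

lemma IsPeriodic.slice {f : Pt → ℝ} (hf : IsPeriodic f) (z : ℝ) :
    Function.Periodic (fun θ => f (θ, z)) (2 * Real.pi) := fun θ => by
  have := (hf (θ, z)).1
  simpa using this

lemma intervalIntegrable_slice {f : ℝ → ℝ} (hf : AEStronglyMeasurable f volume) {M : ℝ}
    (hM : ∀ᵐ t, |f t| ≤ M) (s t : ℝ) : IntervalIntegrable f volume s t :=
  (intervalIntegrable_const (c := M)).mono_fun hf.restrict
    ((ae_restrict_of_ae hM).mono fun _ hu => hu.trans (le_abs_self M))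

/-- `sub_eq_integral` holds from almost every starting point, so almost every line in direction `θ`
contains a good one; the increments from it are subtracted. -/
lemma HasWeakPartial.slice_sub_eq {f g : Pt → ℝ} (h : HasWeakPartial 0 f g) (hf : Continuous f)
    {M : ℝ} (hM : ∀ᵐ x, |g x| ≤ M) :
    ∀ᵐ z : ℝ, ∀ s t, f (t, z) - f (s, z) = ∫ u in s..t, g (u, z) := by
  have h1 := ae_ae_slice (h.sub_eq_integral hf hM)
  filter_upwards [h1, ae_ae_slice hM, aestronglyMeasurable_slice h.2.1.aestronglyMeasurable]
    with z hz hzM hzm s t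
  obtain ⟨θ, hθ⟩ := hz.exists
  have key : ∀ s, f (s, z) - f (θ, z) = ∫ u in θ..s, g (u, z) := by
    intro s
    have := hθ (s - θ)
    simp only [dir_zero, Prod.smul_mk, smul_eq_mul, mul_one, mul_zero, Prod.mk_add_mk,
      add_zero, add_sub_cancel] at this
    rw [this, intervalIntegral.integral_comp_add_left (fun u => g (u, z)) θ]
    simp
  have hi := fun s t => intervalIntegrable_slice hzm hzM s t
  rw [← intervalIntegral.integral_interval_sub_left (hi θ t) (hi θ s), ← key, ← key]
  ring

lemma integral_refMeasure_eq {f : Pt → ℝ} (hf : Integrable f refMeasure) :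
    ∫ x, f x ∂refMeasure = ∫ z in Set.Icc (-(1 / 2) : ℝ) (1 / 2),
      ∫ θ in (0 : ℝ)..(2 * Real.pi), f (θ, z) := by
  have hpi : 0 ≤ 2 * Real.pi := by positivity
  rw [refMeasure_eq_prod] at hf ⊢
  rw [integral_prod_symm _ hf]
  congr 1
  ext z
  rw [intervalIntegral.integral_of_le hpi, integral_Icc_eq_integral_Ioc]

lemma integrable_slice_integral {f : Pt → ℝ} (hf : Integrable f refMeasure) :
    IntegrableOn (fun z => ∫ θ in (0 : ℝ)..(2 * Real.pi), f (θ, z))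
      (Set.Icc (-(1 / 2) : ℝ) (1 / 2)) := by
  have hpi : 0 ≤ 2 * Real.pi := by positivity
  rw [refMeasure_eq_prod] at hf
  have := hf.integral_prod_right
  refine this.congr (Eventually.of_forall fun z => ?_)
  simp only [intervalIntegral.integral_of_le hpi, integral_Icc_eq_integral_Ioc]

/-! ### Strain and bending of a jet -/

/-- The first derivatives of a deformation in terms of its jet. -/
def jetSlope (lam : ℝ) (p : Fin 2 → Fin 3 → Pt → ℝ) (x : Pt) (i : Fin 2) (j : Fin 3) : ℝ :=
  p i j x + slope lam i j

/-- The entries of `DΦᵀ DΦ - id` in terms of the jet. -/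
def strain (lam : ℝ) (w : Fin 3 → Pt → ℝ) (p : Fin 2 → Fin 3 → Pt → ℝ) (i k : Fin 2) (x : Pt) :
    ℝ :=
  metricOf (w 0 x) (jetSlope lam p x) i k - (1 : Matrix (Fin 2) (Fin 2) ℝ) i k

/-- The entries of `D²Φ` in terms of the jet. -/
def bend (lam : ℝ) (w : Fin 3 → Pt → ℝ) (p : Fin 2 → Fin 3 → Pt → ℝ)
    (q : Fin 2 → Fin 2 → Fin 3 → Pt → ℝ) (i k : Fin 2) (j : Fin 3) (x : Pt) : ℝ :=
  hessOf (w 0 x) (jetSlope lam p x) (fun i k j => q i k j x) i k j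

lemma memLp_mul_top {r : ℝ≥0∞} {f g : Pt → ℝ} (hf : MemLp f ∞ refMeasure)
    (hg : MemLp g r refMeasure) : MemLp (fun x => f x * g x) r refMeasure := by
  have : ENNReal.HolderTriple ∞ r r := inferInstance
  exact hg.mul hf

lemma memLp_top_of_continuous {f : Pt → ℝ} (hf : Continuous f) : MemLp f ∞ refMeasure := by
  obtain ⟨M, hM⟩ := isCompact_refDomain.exists_bound_of_continuousOn hf.continuousOn
  refine memLp_top_of_bound hf.aestronglyMeasurable M ?_
  filter_upwards [ae_restrict_mem measurableSet_refDomain] with x hx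
  exact hM x hx

namespace IsJet

variable {lam m : ℝ} {w : Fin 3 → Pt → ℝ} {p : Fin 2 → Fin 3 → Pt → ℝ}
  {q : Fin 2 → Fin 2 → Fin 3 → Pt → ℝ}

lemma memLp_top_w (H : IsJet lam m w p q) (j : Fin 3) : MemLp (w j) ∞ refMeasure :=
  memLp_top_of_continuous (H.continuous j)

lemma memLp_top_slope (H : IsJet lam m w p q) (i : Fin 2) (j : Fin 3) :
    MemLp (fun x => jetSlope lam p x i j) ∞ refMeasure :=
  memLp_top_of_bound ((H.aestronglyMeasurable_p i j).add aestronglyMeasurable_const) m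
    (ae_refMeasure_of_ae (H.slope_le i j))

lemma memLp_top_p (H : IsJet lam m w p q) (i : Fin 2) (j : Fin 3) : MemLp (p i j) ∞ refMeasure := by
  have := (H.memLp_top_slope i j).sub (memLp_const (slope lam i j))
  refine this.ae_eq (Eventually.of_forall fun x => ?_)
  simp [jetSlope]

lemma memLp_top_strain (H : IsJet lam m w p q) (i k : Fin 2) :
    MemLp (strain lam w p i k) ∞ refMeasure := by
  have hr := H.memLp_top_w 0
  have hs := H.memLp_top_slope
  exact (((memLp_mul_top (hs i 0) (hs k 0)).add
    (memLp_mul_top (memLp_mul_top hr (hs i 1)) (memLp_mul_top hr (hs k 1)))).add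
    (memLp_mul_top (hs i 2) (hs k 2))).sub (memLp_const _)

lemma memLp_bend (H : IsJet lam m w p q) (i k : Fin 2) (j : Fin 3) :
    MemLp (bend lam w p q i k j) 2 refMeasure := by
  have hr := H.memLp_top_w 0
  have hs := H.memLp_top_slope
  fin_cases j
  · exact (H.memLp_q i k 0).sub
      ((memLp_mul_top (memLp_mul_top hr (hs i 1)) (hs k 1)).mono_exponent le_top)
  · exact (((memLp_mul_top (hs i 0) (hs k 1)).add
      (memLp_mul_top (hs k 0) (hs i 1))).mono_exponent le_top).add
      (memLp_mul_top hr (H.memLp_q i k 1))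
  · exact H.memLp_q i k 2

lemma integrable_strain_sq (H : IsJet lam m w p q) (i k : Fin 2) :
    Integrable (fun x => strain lam w p i k x ^ 2) refMeasure :=
  ((H.memLp_top_strain i k).mono_exponent le_top).integrable_sq

lemma integrable_bend_sq (H : IsJet lam m w p q) (i k : Fin 2) (j : Fin 3) :
    Integrable (fun x => bend lam w p q i k j x ^ 2) refMeasure :=
  (H.memLp_bend i k j).integrable_sq

lemma jetEnergy_eq (H : IsJet lam m w p q) (h : ℝ) : jetEnergy h lam w p q =
    (∑ i, ∑ k, ∫ x, strain lam w p i k x ^ 2 ∂refMeasure) +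
      h ^ 2 * ∑ i, ∑ k, ∑ j, ∫ x, bend lam w p q i k j x ^ 2 ∂refMeasure := by
  have e : jetEnergy h lam w p q = ∫ x, ((∑ i, ∑ k, strain lam w p i k x ^ 2) +
      h ^ 2 * ∑ i, ∑ k, ∑ j, bend lam w p q i k j x ^ 2) ∂refMeasure := rfl
  have h1 := fun i k => H.integrable_strain_sq i k
  have h2 := fun i k j => H.integrable_bend_sq i k j
  rw [e, integral_add, integral_const_mul]
  · congr 1
    · rw [integral_finsetSum _ fun i _ => integrable_finsetSum _ fun k _ => h1 i k]
      exact Finset.sum_congr rfl fun i _ => integral_finsetSum _ fun k _ => h1 i k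
    · congr 1
      rw [integral_finsetSum _ fun i _ => integrable_finsetSum _ fun k _ =>
        integrable_finsetSum _ fun j _ => h2 i k j]
      refine Finset.sum_congr rfl fun i _ => ?_
      rw [integral_finsetSum _ fun k _ => integrable_finsetSum _ fun j _ => h2 i k j]
      exact Finset.sum_congr rfl fun k _ => integral_finsetSum _ fun j _ => h2 i k j
  · exact integrable_finsetSum _ fun i _ => integrable_finsetSum _ fun k _ => h1 i k
  · exact (integrable_finsetSum _ fun i _ => integrable_finsetSum _ fun k _ =>
      integrable_finsetSum _ fun j _ => h2 i k j).const_mul _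

lemma integrable_p (H : IsJet lam m w p q) (i : Fin 2) (j : Fin 3) :
    Integrable (p i j) refMeasure := (H.memLp_top_p i j).integrable le_top

lemma integrable_q (H : IsJet lam m w p q) (i k : Fin 2) (j : Fin 3) :
    Integrable (q i k j) refMeasure := (H.memLp_q i k j).integrable (by norm_num)

lemma integral_p (H : IsJet lam m w p q) (i : Fin 2) (j : Fin 3) :
    ∫ x, p i j x ∂refMeasure = 0 :=
  (H.partial_w i j).integral_eq_zero (H.per_w j) (H.per_p i j)
    ((H.memLp_top_w j).integrable le_top) (H.integrable_p i j)

lemma integral_q (H : IsJet lam m w p q) (i k : Fin 2) (j : Fin 3) :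
    ∫ x, q i k j x ∂refMeasure = 0 :=
  (H.partial_p i k j).integral_eq_zero (H.per_p k j) (H.per_q i k j)
    (H.integrable_p k j) (H.integrable_q i k j)

lemma integral_slope (H : IsJet lam m w p q) (i : Fin 2) (j : Fin 3) :
    ∫ x, jetSlope lam p x i j ∂refMeasure = 2 * Real.pi * slope lam i j := by
  simp only [jetSlope]
  rw [integral_add (H.integrable_p i j) (integrable_const _), H.integral_p, integral_const,
    refMeasure_real_univ, zero_add, smul_eq_mul]

/-- With `b = ∂_θΦ_θ`, `c = ∂_θ²Φ_ρ` and `r = Φ_ρ ≥ 1`, tangent lines give `(c - r b²)² ≥ 2 r b² - 2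
c - 1 ≥ 4 b - 2 c - 3`. The right side is affine in derivatives of known mean (1 and 0), hence
integrates to `|Ω|`. -/
lemma bending_lower_bound (H : IsJet lam m w p q) :
    2 * Real.pi ≤ ∫ x, bend lam w p q 0 0 0 x ^ 2 ∂refMeasure := by
  have h1 : ∫ x, (4 * jetSlope lam p x 0 1 - 2 * q 0 0 0 x - 3) ∂refMeasure = 2 * Real.pi := by
    have i1 : Integrable (fun x => 4 * jetSlope lam p x 0 1) refMeasure :=
      ((H.memLp_top_slope 0 1).integrable le_top).const_mul 4
    have i2 : Integrable (fun x => 2 * q 0 0 0 x) refMeasure := (H.integrable_q 0 0 0).const_mul 2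
    rw [integral_sub (f := fun x => 4 * jetSlope lam p x 0 1 - 2 * q 0 0 0 x) (i1.sub i2)
      (integrable_const _), integral_sub i1 i2, integral_const_mul,
      integral_const_mul, H.integral_slope, H.integral_q, integral_const, refMeasure_real_univ]
    simp [slope]
    ring
  rw [← h1]
  refine integral_mono_ae ?_ (H.integrable_bend_sq 0 0 0) (Eventually.of_forall fun x => ?_)
  · exact ((((H.memLp_top_slope 0 1).integrable le_top).const_mul 4).sub
      ((H.integrable_q 0 0 0).const_mul 2)).sub (integrable_const _)
  · have hr := H.one_le x
    have e : bend lam w p q 0 0 0 x =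
        q 0 0 0 x - w 0 x * jetSlope lam p x 0 1 * jetSlope lam p x 0 1 := rfl
    simp only [e]
    generalize jetSlope lam p x 0 1 = b
    generalize q 0 0 0 x = c
    nlinarith [sq_nonneg (c - w 0 x * b * b + 1), sq_nonneg (b - 1),
      mul_nonneg (sub_nonneg.2 hr) (sq_nonneg b)]

/-- The hoop bending pays for the bulk energy; of the remaining nonnegative terms only those needed
for the lower bound are kept. -/
lemma excess_bound (H : IsJet lam m w p q) (h : ℝ) :
    (∫ x, strain lam w p 0 0 x ^ 2 ∂refMeasure) + (∫ x, strain lam w p 0 1 x ^ 2 ∂refMeasure) +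
      (∫ x, strain lam w p 1 1 x ^ 2 ∂refMeasure) +
      h ^ 2 * ∫ x, bend lam w p q 1 1 0 x ^ 2 ∂refMeasure ≤
    jetEnergy h lam w p q - 2 * Real.pi * h ^ 2 := by
  have h1 : ∀ i k j, 0 ≤ ∫ x, bend lam w p q i k j x ^ 2 ∂refMeasure := fun i k j =>
    integral_nonneg fun x => sq_nonneg _
  have h2 : 0 ≤ ∫ x, strain lam w p 1 0 x ^ 2 ∂refMeasure := integral_nonneg fun x => sq_nonneg _
  have h3 : 2 * Real.pi + ∫ x, bend lam w p q 1 1 0 x ^ 2 ∂refMeasure ≤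
      ∑ i, ∑ k, ∑ j, ∫ x, bend lam w p q i k j x ^ 2 ∂refMeasure := by
    simp only [Fin.sum_univ_two, Fin.sum_univ_three]
    linarith [H.bending_lower_bound, h1 0 0 1, h1 0 0 2, h1 0 1 0, h1 0 1 1, h1 0 1 2,
      h1 1 0 0, h1 1 0 1, h1 1 0 2, h1 1 1 1, h1 1 1 2]
  rw [H.jetEnergy_eq]
  have h4 := mul_le_mul_of_nonneg_left h3 (sq_nonneg h)
  have h5 : ∑ i, ∑ k, ∫ x, strain lam w p i k x ^ 2 ∂refMeasure =
      (∫ x, strain lam w p 0 0 x ^ 2 ∂refMeasure) + (∫ x, strain lam w p 0 1 x ^ 2 ∂refMeasure) +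
      ((∫ x, strain lam w p 1 0 x ^ 2 ∂refMeasure) +
        ∫ x, strain lam w p 1 1 x ^ 2 ∂refMeasure) := by
    simp only [Fin.sum_univ_two]
  linarith

lemma strain_zero_zero (x : Pt) : strain lam w p 0 0 x =
    jetSlope lam p x 0 0 ^ 2 + w 0 x ^ 2 * jetSlope lam p x 0 1 ^ 2 +
      jetSlope lam p x 0 2 ^ 2 - 1 := by
  simp only [strain, metricOf, Matrix.one_apply_eq]
  ring

lemma strain_one_one (x : Pt) : strain lam w p 1 1 x =
    jetSlope lam p x 1 0 ^ 2 + w 0 x ^ 2 * jetSlope lam p x 1 1 ^ 2 +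
      jetSlope lam p x 1 2 ^ 2 - 1 := by
  simp only [strain, metricOf, Matrix.one_apply_eq]
  ring

lemma strain_zero_one (x : Pt) : strain lam w p 0 1 x =
    jetSlope lam p x 0 0 * jetSlope lam p x 1 0 +
      w 0 x ^ 2 * jetSlope lam p x 0 1 * jetSlope lam p x 1 1 +
      jetSlope lam p x 0 2 * jetSlope lam p x 1 2 := by
  simp only [strain, metricOf, ne_eq, zero_ne_one, not_false_eq_true, Matrix.one_apply_ne]
  ring

/-- A bound for the radius of deformations with bounded energy. -/
lemma radius_le (H : IsJet lam m w p q) (hm : 0 ≤ m) {h : ℝ} (hE : jetEnergy h lam w p q ≤ 9)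
    (x : Pt) : w 0 x ≤ 2 + 14 * (m + 1) := by
  -- Were the radius above 2 on all of `Ω`, the hoop strain `s` would satisfy `s ≥ 4b² - 1` with `b
  -- = ∂_θΦ_θ`. From `s² ≥ 6s - 9` and `b² ≥ 2b - 1` follows `s² ≥ 48b - 39`, whose integral `18π`
  -- exceeds the energy.
  have h0 : ∃ y ∈ refDomain, w 0 y ≤ 2 := by
    by_contra hcon
    push Not at hcon
    have h1 : ∫ x, (48 * jetSlope lam p x 0 1 - 39) ∂refMeasure ≤
        ∫ x, strain lam w p 0 0 x ^ 2 ∂refMeasure := by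
      refine integral_mono_ae ((((H.memLp_top_slope 0 1).integrable le_top).const_mul 48).sub
        (integrable_const _)) (H.integrable_strain_sq 0 0) ?_
      filter_upwards [ae_restrict_mem measurableSet_refDomain] with x hx
      have h2 := hcon x hx
      have h3 : 4 * jetSlope lam p x 0 1 ^ 2 ≤ w 0 x ^ 2 * jetSlope lam p x 0 1 ^ 2 :=
        mul_le_mul_of_nonneg_right (by nlinarith) (sq_nonneg _)
      have h4 := strain_zero_zero (lam := lam) (w := w) (p := p) x
      nlinarith [sq_nonneg (strain lam w p 0 0 x - 3), sq_nonneg (jetSlope lam p x 0 1 - 1),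
        sq_nonneg (jetSlope lam p x 0 0), sq_nonneg (jetSlope lam p x 0 2)]
    rw [integral_sub (((H.memLp_top_slope 0 1).integrable le_top).const_mul 48)
      (integrable_const _), integral_const_mul, H.integral_slope, integral_const,
      refMeasure_real_univ] at h1
    have e : slope lam 0 1 = 1 := rfl
    rw [e, smul_eq_mul] at h1
    have h2 := H.excess_bound h
    have h3 : 0 ≤ ∫ x, strain lam w p 0 1 x ^ 2 ∂refMeasure := integral_nonneg fun x => sq_nonneg _
    have h4 : 0 ≤ ∫ x, strain lam w p 1 1 x ^ 2 ∂refMeasure := integral_nonneg fun x => sq_nonneg _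
    have h5 : 0 ≤ h ^ 2 * ∫ x, bend lam w p q 1 1 0 x ^ 2 ∂refMeasure :=
      mul_nonneg (sq_nonneg h) (integral_nonneg fun x => sq_nonneg _)
    have h6 : 0 ≤ 2 * Real.pi * h ^ 2 := by positivity
    linarith [Real.pi_gt_three]
  obtain ⟨y, hy, hy2⟩ := h0
  obtain ⟨x', hx', k, rfl⟩ := exists_mem_refDomain x
  rw [(H.per_w 0).add_latticeVec]
  have h1 := (H.lipschitz 0).dist_le_mul x' y
  rw [Real.coe_toNNReal _ (by linarith)] at h1
  -- The sup-norm diameter of `Ω` is `2π < 7`; with the Lipschitz constant `2 (m + 1)` this produces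
  -- the `14 (m + 1)`.
  have h2 : dist x' y ≤ 7 := by
    rw [Prod.dist_eq, Real.dist_eq, Real.dist_eq]
    have := Real.pi_lt_d2
    refine max_le (abs_le.2 ⟨?_, ?_⟩) (abs_le.2 ⟨?_, ?_⟩) <;>
    linarith [hx'.1.1, hx'.1.2, hx'.2.1, hx'.2.2, hy.1.1, hy.1.2, hy.2.1, hy.2.2]
  have h3 : w 0 x' - w 0 y ≤ dist (w 0 x') (w 0 y) := le_abs_self _
  have h4 : 2 * (m + 1) * dist x' y ≤ 2 * (m + 1) * 7 :=
    mul_le_mul_of_nonneg_left h2 (by linarith)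
  linarith

end IsJet

namespace IsJet

/-! ### The lower bound -/

variable {lam m : ℝ} {w : Fin 3 → Pt → ℝ} {p : Fin 2 → Fin 3 → Pt → ℝ}
  {q : Fin 2 → Fin 2 → Fin 3 → Pt → ℝ}

/-- Young's inequality at scale `e` on a domain of area `2π`; the resulting factor `1/2 + π` is
below 4. -/
lemma integral_abs_strain_le (H : IsJet lam m w p q) {e : ℝ} (he : 0 < e) (i k : Fin 2)
    (h : ∫ x, strain lam w p i k x ^ 2 ∂refMeasure ≤ e ^ 2) :
    ∫ x, |strain lam w p i k x| ∂refMeasure ≤ 4 * e := by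
  have h1 : ∫ x, |strain lam w p i k x| ∂refMeasure ≤
      ∫ x, ((2 * e)⁻¹ * strain lam w p i k x ^ 2 + e / 2) ∂refMeasure := by
    refine integral_mono_ae ((H.memLp_top_strain i k).integrable le_top).abs
      (((H.integrable_strain_sq i k).const_mul _).add (integrable_const _))
      (Eventually.of_forall fun x => ?_)
    have h2 : (2 * e)⁻¹ * strain lam w p i k x ^ 2 + e / 2 - |strain lam w p i k x| =
        (2 * e)⁻¹ * (|strain lam w p i k x| - e) ^ 2 := by
      rw [← sq_abs (strain lam w p i k x)]
      field_simp
      ring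
    have h3 : 0 ≤ (2 * e)⁻¹ * (|strain lam w p i k x| - e) ^ 2 := by positivity
    show |strain lam w p i k x| ≤ (2 * e)⁻¹ * strain lam w p i k x ^ 2 + e / 2
    linarith
  rw [integral_add ((H.integrable_strain_sq i k).const_mul _) (integrable_const _),
    integral_const_mul, integral_const, refMeasure_real_univ, smul_eq_mul] at h1
  have h4 : (2 * e)⁻¹ * ∫ x, strain lam w p i k x ^ 2 ∂refMeasure ≤ (2 * e)⁻¹ * e ^ 2 :=
    mul_le_mul_of_nonneg_left h (by positivity)
  have h5 : (2 * e)⁻¹ * e ^ 2 = e / 2 := by field_simp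
  have := Real.pi_lt_d2
  nlinarith

/-- The part of the hoop energy which is controlled by the mean hoop strain. -/
def hoop (R lam : ℝ) (w : Fin 3 → Pt → ℝ) (p : Fin 2 → Fin 3 → Pt → ℝ) (x : Pt) : ℝ :=
  jetSlope lam p x 0 0 ^ 2 + jetSlope lam p x 0 2 ^ 2 + 1 / 2 * p 0 1 x ^ 2 +
    (2 * R)⁻¹ * (w 0 x - 1)

/-- With `r = Φ_ρ` and `b = ∂_θΦ_θ - 1`, what remains is to bound `(r² - 1)(b + 1)² + b²` from
below. Minimizing over `b` leaves `1 - r⁻²`, which for `r ≥ 1` is at least `(r - 1)/r`; averaging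
this bound with the trivial bound `b²` keeps a share of each. -/
lemma hoop_le (H : IsJet lam m w p q) {R : ℝ} (hR : ∀ x, w 0 x ≤ R) (x : Pt) :
    hoop R lam w p x ≤ strain lam w p 0 0 x - 2 * p 0 1 x := by
  have hr := H.one_le x
  have hrR := hR x
  have e : jetSlope lam p x 0 1 = p 0 1 x + 1 := rfl
  rw [strain_zero_zero, hoop, e]
  generalize w 0 x = r at *
  generalize p 0 1 x = b
  have h1 : (2 * R)⁻¹ * (r - 1) ≤ (2 * r)⁻¹ * (r - 1) :=
    mul_le_mul_of_nonneg_right (inv_anti₀ (by linarith) (by linarith)) (by linarith)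
  -- Completed square: one copy of the expression equals `r⁻² (r² (b + 1) - 1)² + 1 - r⁻²`, the
  -- other is used as it stands.
  have h2 : 2 * ((r ^ 2 - 1) * (b + 1) ^ 2 + b ^ 2) - b ^ 2 - r⁻¹ * (r - 1) =
      (r ^ 2)⁻¹ * ((r ^ 2 * (b + 1) - 1) ^ 2 + (r - 1)) + (r ^ 2 - 1) * (b + 1) ^ 2 := by
    field_simp
    ring
  have h3 : 0 ≤ (r ^ 2)⁻¹ * ((r ^ 2 * (b + 1) - 1) ^ 2 + (r - 1)) + (r ^ 2 - 1) * (b + 1) ^ 2 := by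
    have h4 : 0 ≤ r - 1 := by linarith
    have h5 : 0 ≤ r ^ 2 - 1 := by nlinarith
    positivity
  have h6 : (2 * r)⁻¹ * (r - 1) = 1 / 2 * (r⁻¹ * (r - 1)) := by
    rw [mul_inv]
    ring
  nlinarith

lemma integrable_hoop (H : IsJet lam m w p q) (R : ℝ) : Integrable (hoop R lam w p) refMeasure := by
  have h1 : ∀ j, Integrable (fun x => jetSlope lam p x 0 j ^ 2) refMeasure := fun j =>
    ((H.memLp_top_slope 0 j).mono_exponent le_top).integrable_sq
  have h2 : Integrable (fun x => p 0 1 x ^ 2) refMeasure :=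
    ((H.memLp_top_p 0 1).mono_exponent le_top).integrable_sq
  exact (((h1 0).add (h1 2)).add (h2.const_mul _)).add
    ((((H.memLp_top_w 0).integrable le_top).sub (integrable_const _)).const_mul _)

/-- The linear term disappears because `Φ_θ - θ` is periodic. -/
lemma integral_hoop_le (H : IsJet lam m w p q) {R : ℝ} (hR : ∀ x, w 0 x ≤ R) :
    ∫ x, hoop R lam w p x ∂refMeasure ≤ ∫ x, |strain lam w p 0 0 x| ∂refMeasure := by
  have i1 := (H.memLp_top_strain 0 0).integrable le_top
  have i2 := (H.integrable_p 0 1).const_mul 2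
  have h1 : ∫ x, hoop R lam w p x ∂refMeasure ≤
      ∫ x, (|strain lam w p 0 0 x| - 2 * p 0 1 x) ∂refMeasure :=
    integral_mono_ae (H.integrable_hoop R) (i1.abs.sub i2) (Eventually.of_forall fun x =>
      (H.hoop_le hR x).trans (sub_le_sub_right (le_abs_self _) _))
  rw [integral_sub i1.abs i2, integral_const_mul, H.integral_p, mul_zero, sub_zero] at h1
  exact h1

/-- The shear strain is `∂_zΦ_θ` plus products, each containing a factor controlled by `hoop` and
others bounded by powers of `m` and `R`. The term with `Φ_ρ² - 1` uses that its square is at most a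
multiple of `Φ_ρ - 1` when `1 ≤ Φ_ρ ≤ R`. -/
lemma integral_twist_sq_le (H : IsJet lam m w p q) (hm : 1 ≤ m) {R : ℝ} (hR : ∀ x, w 0 x ≤ R) :
    ∫ x, jetSlope lam p x 1 1 ^ 2 ∂refMeasure ≤
      5 * (∫ x, strain lam w p 0 1 x ^ 2 ∂refMeasure) +
      (10 * m ^ 2 + 10 * m ^ 4 * R ^ 2 * (R + 1) ^ 2) * ∫ x, hoop R lam w p x ∂refMeasure := by
  have i1 := (H.integrable_strain_sq 0 1).const_mul 5
  have i2 := (H.integrable_hoop R).const_mul (10 * m ^ 2 + 10 * m ^ 4 * R ^ 2 * (R + 1) ^ 2)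
  rw [← integral_const_mul, ← integral_const_mul, ← integral_add i1 i2]
  refine integral_mono_ae ((H.memLp_top_slope 1 1).mono_exponent le_top).integrable_sq
    (i1.add i2) ?_
  have hs : ∀ᵐ x ∂refMeasure, ∀ i j, |jetSlope lam p x i j| ≤ m :=
    ae_refMeasure_of_ae (ae_all_iff.2 fun i => ae_all_iff.2 fun j => H.slope_le i j)
  filter_upwards [hs] with x hx
  have hr := H.one_le x
  have hrR := hR x
  have hsq : ∀ i j, jetSlope lam p x i j ^ 2 ≤ m ^ 2 := fun i j =>
    sq_le_sq.2 ((hx i j).trans (le_abs_self m))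
  have e : jetSlope lam p x 0 1 = p 0 1 x + 1 := rfl
  have e1 : jetSlope lam p x 1 1 = strain lam w p 0 1 x -
      jetSlope lam p x 0 0 * jetSlope lam p x 1 0 -
      jetSlope lam p x 0 2 * jetSlope lam p x 1 2 - p 0 1 x * jetSlope lam p x 1 1 -
      (w 0 x ^ 2 - 1) * (jetSlope lam p x 0 1 * jetSlope lam p x 1 1) := by
    rw [strain_zero_one, e]
    ring
  have five : ∀ a b c d f : ℝ, (a - b - c - d - f) ^ 2 ≤
      5 * (a ^ 2 + b ^ 2 + c ^ 2 + d ^ 2 + f ^ 2) := by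
    intro a b c d f
    nlinarith [sq_nonneg (a + b), sq_nonneg (a + c), sq_nonneg (a + d), sq_nonneg (a + f),
      sq_nonneg (b - c), sq_nonneg (b - d), sq_nonneg (b - f), sq_nonneg (c - d),
      sq_nonneg (c - f), sq_nonneg (d - f)]
  have h1 := five (strain lam w p 0 1 x) (jetSlope lam p x 0 0 * jetSlope lam p x 1 0)
    (jetSlope lam p x 0 2 * jetSlope lam p x 1 2) (p 0 1 x * jetSlope lam p x 1 1)
    ((w 0 x ^ 2 - 1) * (jetSlope lam p x 0 1 * jetSlope lam p x 1 1))
  rw [← e1] at h1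
  simp only [mul_pow] at h1
  have b1 : jetSlope lam p x 0 0 ^ 2 * jetSlope lam p x 1 0 ^ 2 ≤
      m ^ 2 * jetSlope lam p x 0 0 ^ 2 := by
    rw [mul_comm]
    exact mul_le_mul_of_nonneg_right (hsq 1 0) (sq_nonneg _)
  have b2 : jetSlope lam p x 0 2 ^ 2 * jetSlope lam p x 1 2 ^ 2 ≤
      m ^ 2 * jetSlope lam p x 0 2 ^ 2 := by
    rw [mul_comm]
    exact mul_le_mul_of_nonneg_right (hsq 1 2) (sq_nonneg _)
  have b3 : p 0 1 x ^ 2 * jetSlope lam p x 1 1 ^ 2 ≤ m ^ 2 * p 0 1 x ^ 2 := by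
    rw [mul_comm]
    exact mul_le_mul_of_nonneg_right (hsq 1 1) (sq_nonneg _)
  have b4 : jetSlope lam p x 0 1 ^ 2 * jetSlope lam p x 1 1 ^ 2 ≤ m ^ 4 := by
    have := mul_le_mul (hsq 0 1) (hsq 1 1) (sq_nonneg _) (sq_nonneg m)
    linarith [show m ^ 2 * m ^ 2 = m ^ 4 by ring]
  have b5 : (w 0 x ^ 2 - 1) ^ 2 ≤ 2 * R ^ 2 * (R + 1) ^ 2 * ((2 * R)⁻¹ * (w 0 x - 1)) := by
    have h2 : 2 * R ^ 2 * (R + 1) ^ 2 * ((2 * R)⁻¹ * (w 0 x - 1)) =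
        (w 0 x - 1) * (R * (R + 1) ^ 2) := by
      have : R ≠ 0 := by linarith
      field_simp
    rw [h2, show (w 0 x ^ 2 - 1) ^ 2 = (w 0 x - 1) * ((w 0 x - 1) * (w 0 x + 1) ^ 2) by ring]
    refine mul_le_mul_of_nonneg_left ?_ (by linarith)
    exact mul_le_mul (by linarith) (pow_le_pow_left₀ (by linarith) (by linarith) 2)
      (sq_nonneg _) (by linarith)
  have b6 : (w 0 x ^ 2 - 1) ^ 2 * (jetSlope lam p x 0 1 ^ 2 * jetSlope lam p x 1 1 ^ 2) ≤
      2 * R ^ 2 * (R + 1) ^ 2 * ((2 * R)⁻¹ * (w 0 x - 1)) * m ^ 4 :=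
    mul_le_mul b5 b4 (by positivity) ((sq_nonneg _).trans b5)
  show jetSlope lam p x 1 1 ^ 2 ≤ 5 * strain lam w p 0 1 x ^ 2 +
    (10 * m ^ 2 + 10 * m ^ 4 * R ^ 2 * (R + 1) ^ 2) * hoop R lam w p x
  have hf : 0 ≤ (2 * R)⁻¹ * (w 0 x - 1) :=
    mul_nonneg (inv_nonneg.2 (by linarith)) (by linarith)
  rw [hoop]
  generalize (2 * R)⁻¹ * (w 0 x - 1) = F at *
  have c1 : 0 ≤ m ^ 4 * R ^ 2 * (R + 1) ^ 2 * jetSlope lam p x 0 0 ^ 2 := by positivity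
  have c2 : 0 ≤ m ^ 4 * R ^ 2 * (R + 1) ^ 2 * jetSlope lam p x 0 2 ^ 2 := by positivity
  have c3 : 0 ≤ m ^ 4 * R ^ 2 * (R + 1) ^ 2 * p 0 1 x ^ 2 := by positivity
  have c4 : 0 ≤ m ^ 2 * jetSlope lam p x 0 0 ^ 2 := by positivity
  have c5 : 0 ≤ m ^ 2 * jetSlope lam p x 0 2 ^ 2 := by positivity
  have c6 : 0 ≤ m ^ 2 * F := by positivity
  linarith

/-- The mean of `1 - ∂_zΦ_z` is `λ`. Where `0 ≤ ∂_zΦ_z ≤ 1` it is at most `1 - (∂_zΦ_z)²`, which the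
axial strain expresses through the other two slopes; where `∂_zΦ_z ≥ 1` it is nonpositive. The sign
constraint excludes a reversal of the axis. -/
lemma compression_le (H : IsJet lam m w p q) {R : ℝ} (hR : ∀ x, w 0 x ≤ R) :
    2 * Real.pi * lam ≤ (∫ x, |strain lam w p 1 1 x| ∂refMeasure) +
      (∫ x, jetSlope lam p x 1 0 ^ 2 ∂refMeasure) +
      R ^ 2 * ∫ x, jetSlope lam p x 1 1 ^ 2 ∂refMeasure := by
  have i1 := ((H.memLp_top_strain 1 1).integrable le_top).abs
  have i2 := ((H.memLp_top_slope 1 0).mono_exponent (p := 2) le_top).integrable_sq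
  have i3 := (((H.memLp_top_slope 1 1).mono_exponent (p := 2) le_top).integrable_sq).const_mul
    (R ^ 2)
  have i4 := (H.memLp_top_slope 1 2).integrable le_top
  have h1 : ∫ x, (1 - jetSlope lam p x 1 2) ∂refMeasure = 2 * Real.pi * lam := by
    rw [integral_sub (integrable_const _) i4, H.integral_slope, integral_const,
      refMeasure_real_univ, slope_one_two, smul_eq_mul]
    ring
  rw [← h1, ← integral_const_mul, ← integral_add i1 i2,
    ← integral_add (f := fun x => |strain lam w p 1 1 x| + jetSlope lam p x 1 0 ^ 2)
      (i1.add i2) i3]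
  refine integral_mono_ae ((integrable_const _).sub i4) ((i1.add i2).add i3) ?_
  filter_upwards [ae_refMeasure_of_ae H.nonneg] with x hx
  have hz : 0 ≤ jetSlope lam p x 1 2 := hx
  have hr := H.one_le x
  have hrR := hR x
  have h2 := strain_one_one (lam := lam) (w := w) (p := p) x
  have h3 : w 0 x ^ 2 * jetSlope lam p x 1 1 ^ 2 ≤ R ^ 2 * jetSlope lam p x 1 1 ^ 2 :=
    mul_le_mul_of_nonneg_right (pow_le_pow_left₀ (by linarith) hrR 2) (sq_nonneg _)
  show 1 - jetSlope lam p x 1 2 ≤ |strain lam w p 1 1 x| + jetSlope lam p x 1 0 ^ 2 +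
    R ^ 2 * jetSlope lam p x 1 1 ^ 2
  have h4 := neg_abs_le (strain lam w p 1 1 x)
  rcases le_total (jetSlope lam p x 1 2) 1 with h5 | h5
  · nlinarith
  · have h6 : 0 ≤ R ^ 2 * jetSlope lam p x 1 1 ^ 2 := by positivity
    have h7 := abs_nonneg (strain lam w p 1 1 x)
    linarith [sq_nonneg (jetSlope lam p x 1 0)]

/-- Interpolation in `z` by parts: `∫ (∂_zΦ_ρ)² = -∫ (Φ_ρ - 1) ∂_z²Φ_ρ`. The curvature correction in
the radial bending may be inserted because `Φ_ρ - 1` and `Φ_ρ (∂_zΦ_θ)²` are both nonnegative, so it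
only increases the right side. -/
lemma integral_axial_sq_le (H : IsJet lam m w p q) (hl0 : 0 ≤ lam) (hl1 : lam ≤ 1) {t : ℝ}
    (ht : 0 < t) :
    ∫ x, jetSlope lam p x 1 0 ^ 2 ∂refMeasure ≤
      t / 2 * (∫ x, (w 0 x - 1) ^ 2 ∂refMeasure) +
      (2 * t)⁻¹ * ∫ x, bend lam w p q 1 1 0 x ^ 2 ∂refMeasure := by
  have e0 : ∀ x, jetSlope lam p x 1 0 = p 1 0 x := fun x => add_zero _
  have h1 := integral_sq_weakPartial (H.partial_w 1 0) (H.partial_p 1 1 0) (H.continuous 0)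
    (H.per_w 0) (H.per_p 1 0) (H.per_q 1 1 0) (H.abs_p_le hl0 hl1 1 0) (H.integrable_q 1 1 0)
  simp only [e0]
  have i0 : Integrable (fun x => w 0 x * q 1 1 0 x) refMeasure :=
    (memLp_mul_top (H.memLp_top_w 0) (H.memLp_q 1 1 0)).integrable (by norm_num)
  have h2 : ∫ x, p 1 0 x ^ 2 ∂refMeasure = ∫ x, -((w 0 x - 1) * q 1 1 0 x) ∂refMeasure := by
    rw [h1, integral_neg]
    simp only [sub_mul, one_mul]
    rw [integral_sub i0 (H.integrable_q 1 1 0), H.integral_q, sub_zero]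
  have i1 : MemLp (fun x => w 0 x - 1) 2 refMeasure :=
    ((H.memLp_top_w 0).sub (memLp_const 1)).mono_exponent le_top
  have i2 := i1.integrable_sq.const_mul (t / 2)
  have i3 := (H.integrable_bend_sq 1 1 0).const_mul (2 * t)⁻¹
  rw [h2, ← integral_const_mul, ← integral_const_mul, ← integral_add i2 i3]
  have i4 : Integrable (fun x => -((w 0 x - 1) * q 1 1 0 x)) refMeasure := by
    refine (i0.sub (H.integrable_q 1 1 0)).neg.congr (Eventually.of_forall fun x => ?_)
    simp only [Pi.neg_apply, Pi.sub_apply]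
    ring
  refine integral_mono_ae i4 (i2.add i3) (Eventually.of_forall fun x => ?_)
  have e : bend lam w p q 1 1 0 x =
      q 1 1 0 x - w 0 x * jetSlope lam p x 1 1 * jetSlope lam p x 1 1 := rfl
  show -((w 0 x - 1) * q 1 1 0 x) ≤
    t / 2 * (w 0 x - 1) ^ 2 + (2 * t)⁻¹ * bend lam w p q 1 1 0 x ^ 2
  have hr := H.one_le x
  have h3 : t / 2 * (w 0 x - 1) ^ 2 + (2 * t)⁻¹ * bend lam w p q 1 1 0 x ^ 2 +
      (w 0 x - 1) * bend lam w p q 1 1 0 x =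
      (2 * t)⁻¹ * (t * (w 0 x - 1) + bend lam w p q 1 1 0 x) ^ 2 := by
    field_simp
    ring
  have h4 : 0 ≤ (2 * t)⁻¹ * (t * (w 0 x - 1) + bend lam w p q 1 1 0 x) ^ 2 := by positivity
  have h5 : (w 0 x - 1) * bend lam w p q 1 1 0 x ≤ (w 0 x - 1) * q 1 1 0 x := by
    refine mul_le_mul_of_nonneg_left ?_ (by linarith)
    rw [e]
    nlinarith [sq_nonneg (jetSlope lam p x 1 1)]
  linarith

/-- On almost every circle `z = const`, the hoop estimate controls the integral of `Φ_ρ - 1` by that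
of the strain. The one-dimensional interpolation at length `δ` turns this into an `L²` bound.
Working circle by circle makes the first term quadratic in the strain. -/
lemma integral_radius_sq_le (H : IsJet lam m w p q) (hl0 : 0 ≤ lam) (hl1 : lam ≤ 1) {R δ : ℝ}
    (hR : ∀ x, w 0 x ≤ R) (hδ : 0 < δ) (hδ1 : δ ≤ 1) :
    ∫ x, (w 0 x - 1) ^ 2 ∂refMeasure ≤
      3 / (2 * δ) * (8 * Real.pi * R ^ 2 * ∫ x, strain lam w p 0 0 x ^ 2 ∂refMeasure) +
      δ ^ 2 / 2 * ∫ x, jetSlope lam p x 0 0 ^ 2 ∂refMeasure := by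
  have hpi : 0 < 2 * Real.pi := by positivity
  have hR1 : 1 ≤ R := (H.one_le 0).trans (hR 0)
  have e0 : ∀ x, jetSlope lam p x 0 0 = p 0 0 x := fun x => add_zero _
  have i1 : Integrable (fun x => (w 0 x - 1) ^ 2) refMeasure :=
    (((H.memLp_top_w 0).sub (memLp_const 1)).mono_exponent (p := 2) le_top).integrable_sq
  have i2 : Integrable (fun x => p 0 0 x ^ 2) refMeasure :=
    ((H.memLp_top_p 0 0).mono_exponent (p := 2) le_top).integrable_sq
  have i3 := H.integrable_strain_sq 0 0
  simp only [e0]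
  rw [integral_refMeasure_eq i1, integral_refMeasure_eq i2, integral_refMeasure_eq i3,
    ← integral_const_mul, ← integral_const_mul, ← integral_const_mul,
    ← integral_add (((integrable_slice_integral i3).const_mul _).const_mul _)
      ((integrable_slice_integral i2).const_mul _)]
  refine integral_mono_ae (integrable_slice_integral i1)
    ((((integrable_slice_integral i3).const_mul _).const_mul _).add
      ((integrable_slice_integral i2).const_mul _)) (ae_restrict_of_ae ?_)
  have hbd : ∀ᵐ x, ∀ i j, |jetSlope lam p x i j| ≤ m :=
    ae_all_iff.2 fun i => ae_all_iff.2 fun j => H.slope_le i j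
  filter_upwards [(H.partial_w 0 0).slice_sub_eq (H.continuous 0) (H.abs_p_le hl0 hl1 0 0),
    (H.partial_w 0 1).slice_sub_eq (H.continuous 1) (H.abs_p_le hl0 hl1 0 1),
    aestronglyMeasurable_slice (H.partial_w 0 0).2.1.aestronglyMeasurable,
    aestronglyMeasurable_slice (H.partial_w 0 1).2.1.aestronglyMeasurable,
    aestronglyMeasurable_slice (H.partial_w 0 2).2.1.aestronglyMeasurable,
    ae_ae_slice (H.abs_p_le hl0 hl1 0 0), ae_ae_slice (H.abs_p_le hl0 hl1 0 1),
    ae_ae_slice hbd] with z hz0 hz1 m0 m1 m2 b0 b1 b2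
  set F : ℝ → ℝ := fun θ => w 0 (θ, z) - 1 with hF
  have hFc : Continuous F := by
    have := H.continuous 0
    fun_prop
  have hF0 : ∀ θ, 0 ≤ F θ := fun θ => sub_nonneg.2 (H.one_le _)
  have key := integral_sq_le_of_periodic (T := 2 * Real.pi) hδ
    (by linarith [Real.pi_gt_three]) hFc hF0
    (fun θ => by simp only [hF, (H.per_w 0).slice z θ]) ((H.per_p 0 0).slice z) m0 b0
    (fun s t => by rw [← hz0 s t]; simp [hF])
  -- The mean vanishes on each circle separately, not only over `Ω`.
  have hp0 : ∫ θ in (0 : ℝ)..(2 * Real.pi), p 0 1 (θ, z) = 0 := by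
    rw [← hz1 0 (2 * Real.pi)]
    have := (H.per_w 1).slice z 0
    simp only [zero_add] at this
    rw [this, sub_self]
  have hm : AEStronglyMeasurable (fun θ => strain lam w p 0 0 (θ, z)) volume := by
    simp only [strain_zero_zero]
    have hw : Continuous fun θ : ℝ => w 0 (θ, z) := by
      have := H.continuous 0
      fun_prop
    exact ((((m0.add_const _).pow 2).add ((hw.aestronglyMeasurable.pow 2).mul
      ((m1.add_const _).pow 2))).add ((m2.add_const _).pow 2)).sub
      aestronglyMeasurable_const
  have hM : ∀ᵐ θ, |strain lam w p 0 0 (θ, z)| ≤ m ^ 2 + R ^ 2 * m ^ 2 + m ^ 2 + 1 := by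
    filter_upwards [b2] with θ hθ
    have hsq : ∀ j, jetSlope lam p (θ, z) 0 j ^ 2 ≤ m ^ 2 := fun j =>
      sq_le_sq.2 ((hθ 0 j).trans (le_abs_self m))
    have h1 : w 0 (θ, z) ^ 2 * jetSlope lam p (θ, z) 0 1 ^ 2 ≤ R ^ 2 * m ^ 2 :=
      mul_le_mul (pow_le_pow_left₀ (by linarith [H.one_le (θ, z)]) (hR _) 2) (hsq 1)
        (sq_nonneg _) (sq_nonneg _)
    have h2 : 0 ≤ w 0 (θ, z) ^ 2 * jetSlope lam p (θ, z) 0 1 ^ 2 := by positivity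
    rw [strain_zero_zero, abs_le]
    constructor <;> nlinarith [hsq 0, hsq 2, sq_nonneg (jetSlope lam p (θ, z) 0 0),
      sq_nonneg (jetSlope lam p (θ, z) 0 2), sq_nonneg m]
  have hs := fun s t => intervalIntegrable_slice hm hM s t
  have hs2 : IntervalIntegrable (fun θ => strain lam w p 0 0 (θ, z) ^ 2) volume
      0 (2 * Real.pi) := by
    refine intervalIntegrable_slice (hm.pow 2)
      (M := (m ^ 2 + R ^ 2 * m ^ 2 + m ^ 2 + 1) ^ 2) ?_ _ _
    filter_upwards [hM] with θ hθ
    rw [Pi.pow_apply, abs_pow]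
    exact pow_le_pow_left₀ (abs_nonneg _) hθ 2
  have ip : IntervalIntegrable (fun θ => p 0 1 (θ, z)) volume 0 (2 * Real.pi) :=
    intervalIntegrable_slice m1 b1 _ _
  set S := ∫ θ in (0 : ℝ)..(2 * Real.pi), strain lam w p 0 0 (θ, z) with hS
  set Φ := ∫ θ in (0 : ℝ)..(2 * Real.pi), F θ with hΦ
  have hΦ0 : 0 ≤ Φ := intervalIntegral.integral_nonneg hpi.le fun t _ => hF0 t
  have h1 : (2 * R)⁻¹ * Φ ≤ S := by
    have h2 : ∫ θ in (0 : ℝ)..(2 * Real.pi), (2 * R)⁻¹ * F θ ≤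
        ∫ θ in (0 : ℝ)..(2 * Real.pi), (strain lam w p 0 0 (θ, z) - 2 * p 0 1 (θ, z)) := by
      refine intervalIntegral.integral_mono_on hpi.le
        ((hFc.intervalIntegrable _ _).const_mul _) ((hs _ _).sub (ip.const_mul _)) fun θ _ => ?_
      have h3 := H.hoop_le hR (θ, z)
      rw [hoop] at h3
      have h4 : 0 ≤ jetSlope lam p (θ, z) 0 0 ^ 2 + jetSlope lam p (θ, z) 0 2 ^ 2 +
        1 / 2 * p 0 1 (θ, z) ^ 2 := by positivity
      simp only [hF]
      linarith
    rwa [intervalIntegral.integral_const_mul,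
      intervalIntegral.integral_sub (hs _ _) (ip.const_mul _),
      intervalIntegral.integral_const_mul, hp0, mul_zero, sub_zero] at h2
  -- Cauchy–Schwarz on the circle, obtained from the nonnegativity of the variance.
  have h2 : S ^ 2 ≤ 2 * Real.pi * ∫ θ in (0 : ℝ)..(2 * Real.pi), strain lam w p 0 0 (θ, z) ^ 2 := by
    have h3 : ∫ θ in (0 : ℝ)..(2 * Real.pi),
        (2 * (S / (2 * Real.pi)) * strain lam w p 0 0 (θ, z) - (S / (2 * Real.pi)) ^ 2) ≤
        ∫ θ in (0 : ℝ)..(2 * Real.pi), strain lam w p 0 0 (θ, z) ^ 2 := by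
      refine intervalIntegral.integral_mono_on hpi.le
        (((hs _ _).const_mul _).sub intervalIntegrable_const) hs2 fun θ _ => ?_
      nlinarith [sq_nonneg (strain lam w p 0 0 (θ, z) - S / (2 * Real.pi))]
    rw [intervalIntegral.integral_sub ((hs _ _).const_mul _) intervalIntegrable_const,
      intervalIntegral.integral_const_mul, intervalIntegral.integral_const, ← hS,
      smul_eq_mul, sub_zero] at h3
    have h4 := mul_le_mul_of_nonneg_left h3 hpi.le
    have h5 : 2 * Real.pi * (2 * (S / (2 * Real.pi)) * S -
        2 * Real.pi * (S / (2 * Real.pi)) ^ 2) = S ^ 2 := by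
      field_simp
      ring
    linarith
  have h3 : Φ ^ 2 ≤ 8 * Real.pi * R ^ 2 *
      ∫ θ in (0 : ℝ)..(2 * Real.pi), strain lam w p 0 0 (θ, z) ^ 2 := by
    have h4 : Φ ≤ 2 * R * S := by
      have := mul_le_mul_of_nonneg_left h1 (by linarith : 0 ≤ 2 * R)
      rwa [← mul_assoc, mul_inv_cancel₀ (by linarith : 2 * R ≠ 0), one_mul] at this
    have h5 : Φ ^ 2 ≤ (2 * R * S) ^ 2 := pow_le_pow_left₀ hΦ0 h4 2
    nlinarith [mul_le_mul_of_nonneg_left h2 (by positivity : 0 ≤ 4 * R ^ 2)]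
  have h4 := mul_le_mul_of_nonneg_left h3 (by positivity : 0 ≤ 3 / (2 * δ))
  exact key.trans (add_le_add_left h4 _)

/-- The constant in the lower bound. -/
def lowerConst (m : ℝ) : ℝ :=
  6 + 21 * (2 + 14 * (m + 1)) ^ 2 + (2 + 14 * (m + 1)) ^ 2 *
    (5 + 4 * (10 * m ^ 2 + 10 * m ^ 4 * (2 + 14 * (m + 1)) ^ 2 * (2 + 14 * (m + 1) + 1) ^ 2))

/-- By contradiction with the excess below `e²`, `e = ελ`. Every term on the right of
`compression_le` is then a multiple of `e`; `lowerConst` exceeds the sum of these multiples and `ε`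
is its inverse, so that `2πλ ≤ λ` would follow. -/
lemma lower_bound (H : IsJet lam m w p q) (hm : 1 ≤ m) {h : ℝ} (hh0 : 0 < h) (hh : h ≤ 1 / 2)
    (hl0 : 0 < lam) (hl : lam ≤ 1 / 2) (hlh : lam ^ (5 / 6 : ℝ) ≤ h) :
    ((lowerConst m)⁻¹ * lam) ^ 2 ≤ jetEnergy h lam w p q - 2 * Real.pi * h ^ 2 := by
  by_contra hcon
  push Not at hcon
  obtain ⟨R, hRdef⟩ : ∃ R, R = 2 + 14 * (m + 1) := ⟨_, rfl⟩
  obtain ⟨K, hK⟩ : ∃ K, K = 10 * m ^ 2 + 10 * m ^ 4 * R ^ 2 * (R + 1) ^ 2 := ⟨_, rfl⟩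
  have hC : lowerConst m = 6 + 21 * R ^ 2 + R ^ 2 * (5 + 4 * K) := by
    rw [lowerConst, hK, hRdef]
  have hK0 : 0 ≤ K := by rw [hK]; positivity
  have hC1 : 6 ≤ lowerConst m := by
    have : 0 ≤ 21 * R ^ 2 + R ^ 2 * (5 + 4 * K) := by positivity
    linarith
  have hCinv : (lowerConst m)⁻¹ ≤ 1 := inv_le_one_of_one_le₀ (by linarith)
  have hCinv0 : 0 < (lowerConst m)⁻¹ := inv_pos.2 (by linarith)
  generalize hε : (lowerConst m)⁻¹ = ε at *
  obtain ⟨e, he⟩ : ∃ e, e = ε * lam := ⟨_, rfl⟩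
  rw [← he] at hcon
  have he0 : 0 < e := he ▸ mul_pos hCinv0 hl0
  have he1 : e ≤ 1 / 2 := by
    rw [he]
    linarith [mul_le_mul_of_nonneg_right hCinv hl0.le]
  have hpi := Real.pi_lt_d2
  have hpi3 := Real.pi_gt_three
  have hE : jetEnergy h lam w p q ≤ 9 := by
    have h1 : h ^ 2 ≤ (1 / 2) ^ 2 := pow_le_pow_left₀ hh0.le hh 2
    have h2 : e ^ 2 ≤ (1 / 2) ^ 2 := pow_le_pow_left₀ he0.le he1 2
    have h3 : Real.pi * h ^ 2 ≤ 3.15 * (1 / 2) ^ 2 :=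
      mul_le_mul hpi.le h1 (sq_nonneg h) (by norm_num)
    linarith
  have hR : ∀ x, w 0 x ≤ R := fun x => hRdef ▸ H.radius_le (by linarith) hE x
  have hR1 : 1 ≤ R := by linarith
  have hex := H.excess_bound h
  have s00 : 0 ≤ ∫ x, strain lam w p 0 0 x ^ 2 ∂refMeasure := integral_nonneg fun x => sq_nonneg _
  have s01 : 0 ≤ ∫ x, strain lam w p 0 1 x ^ 2 ∂refMeasure := integral_nonneg fun x => sq_nonneg _
  have s11 : 0 ≤ ∫ x, strain lam w p 1 1 x ^ 2 ∂refMeasure := integral_nonneg fun x => sq_nonneg _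
  have sb : 0 ≤ ∫ x, bend lam w p q 1 1 0 x ^ 2 ∂refMeasure := integral_nonneg fun x => sq_nonneg _
  have sb' := mul_nonneg (sq_nonneg h) sb
  have t00 := H.integral_abs_strain_le he0 0 0 (by linarith)
  have t11 := H.integral_abs_strain_le he0 1 1 (by linarith)
  have t01 : ∫ x, strain lam w p 0 1 x ^ 2 ∂refMeasure ≤ e := by
    have : e ^ 2 ≤ e := by
      rw [sq]
      exact mul_le_of_le_one_left he0.le (by linarith)
    linarith
  have hhoop : ∫ x, hoop R lam w p x ∂refMeasure ≤ 4 * e := (H.integral_hoop_le hR).trans t00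
  have htw : ∫ x, jetSlope lam p x 1 1 ^ 2 ∂refMeasure ≤ (5 + 4 * K) * e := by
    have := H.integral_twist_sq_le hm hR
    rw [← hK] at this
    have h1 := mul_le_mul_of_nonneg_left hhoop hK0
    linarith
  have ha0 : ∫ x, jetSlope lam p x 0 0 ^ 2 ∂refMeasure ≤ 4 * e := by
    refine (integral_mono_ae ?_ (H.integrable_hoop R) (Eventually.of_forall fun x => ?_)).trans
      hhoop
    · exact ((H.memLp_top_slope 0 0).mono_exponent (p := 2) le_top).integrable_sq
    · have h1 : 0 ≤ (2 * R)⁻¹ * (w 0 x - 1) :=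
        mul_nonneg (by positivity) (sub_nonneg.2 (H.one_le x))
      simp only [hoop]
      linarith [sq_nonneg (jetSlope lam p x 0 2), sq_nonneg (p 0 1 x)]
  -- This length balances the terms `e²/δ` and `δ² e` of the radius estimate, both of order `δ⁵`
  -- since `λ = δ³`.
  obtain ⟨δ, hδ⟩ : ∃ δ, δ = lam ^ (1 / 3 : ℝ) := ⟨_, rfl⟩
  have hδ0 : 0 < δ := hδ ▸ Real.rpow_pos_of_pos hl0 _
  have hδ1 : δ ≤ 1 := hδ ▸ Real.rpow_le_one hl0.le (by linarith) (by norm_num)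
  have hδ3 : δ ^ 3 = lam := by
    rw [hδ, ← Real.rpow_natCast, ← Real.rpow_mul hl0.le]
    norm_num
  -- The regime `h ≥ λ^{5/6}` enters here: it is what keeps the axial bending below `ε δ`.
  have hδ5 : δ ^ 5 ≤ h ^ 2 := by
    have h1 : δ ^ 5 = (lam ^ (5 / 6 : ℝ)) ^ 2 := by
      rw [hδ, ← Real.rpow_natCast, ← Real.rpow_natCast, ← Real.rpow_mul hl0.le,
        ← Real.rpow_mul hl0.le]
      norm_num
    rw [h1]
    exact pow_le_pow_left₀ (by positivity) hlh 2
  have hε1 : ε ^ 2 ≤ ε := by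
    rw [sq]
    exact mul_le_of_le_one_left hCinv0.le hCinv
  have he2 : e ^ 2 ≤ ε * δ ^ 6 := by
    have : e ^ 2 = ε ^ 2 * δ ^ 6 := by
      rw [he, ← hδ3]
      ring
    rw [this]
    exact mul_le_mul_of_nonneg_right hε1 (by positivity)
  have hb : ∫ x, bend lam w p q 1 1 0 x ^ 2 ∂refMeasure ≤ ε * δ := by
    have h1 : δ ^ 5 * ∫ x, bend lam w p q 1 1 0 x ^ 2 ∂refMeasure ≤ δ ^ 5 * (ε * δ) := by
      have := mul_le_mul_of_nonneg_right hδ5 sb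
      calc _ ≤ _ := this
        _ ≤ e ^ 2 := by linarith
        _ ≤ ε * δ ^ 6 := he2
        _ = _ := by ring
    exact le_of_mul_le_mul_left h1 (by positivity)
  have hf : ∫ x, (w 0 x - 1) ^ 2 ∂refMeasure ≤ (38 * R ^ 2 + 2) * ε * δ ^ 5 := by
    have h1 := H.integral_radius_sq_le hl0.le (by linarith) hR hδ0 hδ1
    have h2 : ∫ x, strain lam w p 0 0 x ^ 2 ∂refMeasure ≤ ε * δ ^ 6 := by linarith
    have h3 : 3 / (2 * δ) * (8 * Real.pi * R ^ 2 * ∫ x, strain lam w p 0 0 x ^ 2 ∂refMeasure) ≤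
        3 / (2 * δ) * (8 * 3.15 * R ^ 2 * (ε * δ ^ 6)) := by
      refine mul_le_mul_of_nonneg_left ?_ (by positivity)
      refine mul_le_mul ?_ h2 s00 (by positivity)
      exact mul_le_mul_of_nonneg_right (by linarith) (sq_nonneg R)
    have h4 : 3 / (2 * δ) * (8 * 3.15 * R ^ 2 * (ε * δ ^ 6)) = 37.8 * R ^ 2 * ε * δ ^ 5 := by
      field_simp
      ring
    have h5 : δ ^ 2 / 2 * ∫ x, jetSlope lam p x 0 0 ^ 2 ∂refMeasure ≤ δ ^ 2 / 2 * (4 * e) :=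
      mul_le_mul_of_nonneg_left ha0 (by positivity)
    have h6 : δ ^ 2 / 2 * (4 * e) = 2 * ε * δ ^ 5 := by
      rw [he, ← hδ3]
      ring
    have h7 : 0 ≤ R ^ 2 * ε * δ ^ 5 := by positivity
    linarith
  have hax : ∫ x, jetSlope lam p x 1 0 ^ 2 ∂refMeasure ≤ (19 * R ^ 2 + 3 / 2) * e := by
    -- The weight `δ⁻²` balances `∫ (Φ_ρ - 1)² ≲ ε δ⁵` against the squared bending `ε δ`; both
    -- contributions become multiples of `ε δ³ = e`.
    have h1 := H.integral_axial_sq_le hl0.le (by linarith) (t := (δ ^ 2)⁻¹) (by positivity)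
    have h2 := mul_le_mul_of_nonneg_left hf (by positivity : 0 ≤ (δ ^ 2)⁻¹ / 2)
    have h3 := mul_le_mul_of_nonneg_left hb (by positivity : 0 ≤ (2 * (δ ^ 2)⁻¹)⁻¹)
    have h4 : (δ ^ 2)⁻¹ / 2 * ((38 * R ^ 2 + 2) * ε * δ ^ 5) + (2 * (δ ^ 2)⁻¹)⁻¹ * (ε * δ) =
        (19 * R ^ 2 + 3 / 2) * e := by
      rw [he, ← hδ3]
      field_simp
      ring
    linarith
  have hcomp := H.compression_le hR
  have htw' := mul_le_mul_of_nonneg_left htw (sq_nonneg R)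
  have h1 : 2 * Real.pi * lam ≤ lowerConst m * e := by
    rw [hC]
    have : 0 ≤ R ^ 2 * e := by positivity
    linarith
  have h2 : lowerConst m * e = lam := by
    rw [he, ← hε, ← mul_assoc, mul_inv_cancel₀ (by linarith), one_mul]
  rw [h2] at h1
  have h3 := mul_lt_mul_of_pos_right hpi3 hl0
  linarith

end IsJet

/-! ### Limits along ultrafilters -/

lemma integral_mul_sq_le {f g : Pt → ℝ} (hf : MemLp f 2 refMeasure) (hg : MemLp g 2 refMeasure) :
    (∫ x, f x * g x ∂refMeasure) ^ 2 ≤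
      (∫ x, f x ^ 2 ∂refMeasure) * ∫ x, g x ^ 2 ∂refMeasure := by
  have i1 := hf.integrable_sq
  have i2 := hg.integrable_sq
  have i3 : Integrable (fun x => f x * g x) refMeasure := hf.integrable_mul hg
  have key : ∀ s : ℝ, 0 ≤ (∫ x, g x ^ 2 ∂refMeasure) * (s * s) +
      (-2 * ∫ x, f x * g x ∂refMeasure) * s + ∫ x, f x ^ 2 ∂refMeasure := by
    intro s
    have h1 : ∫ x, (f x - s * g x) ^ 2 ∂refMeasure = (∫ x, g x ^ 2 ∂refMeasure) * (s * s) +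
        (-2 * ∫ x, f x * g x ∂refMeasure) * s + ∫ x, f x ^ 2 ∂refMeasure := by
      have e : ∀ x, (f x - s * g x) ^ 2 = (s * s) * g x ^ 2 + (-2 * s) * (f x * g x) + f x ^ 2 :=
        fun x => by ring
      simp only [e]
      rw [integral_add (f := fun x => (s * s) * g x ^ 2 + (-2 * s) * (f x * g x))
        ((i2.const_mul _).add (i3.const_mul _)) i1,
        integral_add (i2.const_mul _) (i3.const_mul _), integral_const_mul, integral_const_mul]
      ring
    rw [← h1]
    exact integral_nonneg fun x => sq_nonneg _
  have h2 := discrim_le_zero key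
  rw [discrim] at h2
  linarith

/-- Weak convergence in `L²` of the reference domain. -/
def WeakLim (l : Filter ℕ) (f : ℕ → Pt → ℝ) (g : Pt → ℝ) : Prop :=
  ∀ ψ : Pt → ℝ, MemLp ψ 2 refMeasure →
    Tendsto (fun n => ∫ x, f n x * ψ x ∂refMeasure) l (𝓝 (∫ x, g x * ψ x ∂refMeasure))

lemma inner_toLp_eq {f g : Pt → ℝ} (hf : MemLp f 2 refMeasure) (hg : MemLp g 2 refMeasure) :
    inner ℝ hf.toLp hg.toLp = ∫ x, f x * g x ∂refMeasure := by
  rw [L2.inner_def]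
  refine integral_congr_ae ?_
  filter_upwards [hf.coeFn_toLp, hg.coeFn_toLp] with x h1 h2
  rw [h1, h2]
  simp [mul_comm]

/-- Bounded sequences in `L²` have weak limits along ultrafilters. -/
lemma exists_weakLim (U : Ultrafilter ℕ) {f : ℕ → Pt → ℝ} (hf : ∀ n, MemLp (f n) 2 refMeasure)
    {C : ℝ} (hC : ∀ n, ∫ x, f n x ^ 2 ∂refMeasure ≤ C) :
    ∃ g, IsPeriodic g ∧ MemLp g 2 refMeasure ∧ WeakLim U f g := by
  set F : ℕ → Lp ℝ 2 refMeasure := fun n => (hf n).toLp with hF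
  have hnorm : ∀ n, ‖F n‖ ≤ √C := fun n => by
    refine Real.le_sqrt_of_sq_le ?_
    rw [← real_inner_self_eq_norm_sq, hF, inner_toLp_eq (hf n) (hf n)]
    simpa only [sq] using hC n
  -- By Riesz and Banach–Alaoglu the sequence lies in a weak-* compact ball, where every ultrafilter
  -- converges.
  set D : ℕ → WeakDual ℝ (Lp ℝ 2 refMeasure) := fun n =>
    StrongDual.toWeakDual (InnerProductSpace.toDual ℝ _ (F n)) with hD
  have hcomp := WeakDual.isCompact_closedBall (𝕜 := ℝ) (E := Lp ℝ 2 refMeasure) 0 √C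
  obtain ⟨L, -, hL⟩ := hcomp.ultrafilter_le_nhds (U.map D) (by
    rw [Filter.le_principal_iff]
    refine Filter.Eventually.of_forall (f := (U : Filter ℕ)) fun n => ?_
    show D n ∈ _
    simp only [hD, Set.mem_preimage, Metric.mem_closedBall, dist_zero_right]
    simpa using hnorm n)
  have hT : Tendsto D U (𝓝 L) := hL
  set G := (InnerProductSpace.toDual ℝ (Lp ℝ 2 refMeasure)).symm (WeakDual.toStrongDual L) with hG
  have hGm : MemLp (perExt G) 2 refMeasure := (Lp.memLp G).ae_eq (perExt_ae_eq _).symm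
  refine ⟨perExt G, isPeriodic_perExt _, hGm, fun ψ hψ => ?_⟩
  have h1 : Tendsto (fun n => D n hψ.toLp) U (𝓝 (L hψ.toLp)) :=
    ((WeakDual.eval_continuous _).tendsto L).comp hT
  have h2 : ∀ n, D n hψ.toLp = ∫ x, f n x * ψ x ∂refMeasure := fun n => by
    rw [← inner_toLp_eq (hf n) hψ]
    rfl
  have h3 : L hψ.toLp = ∫ x, perExt G x * ψ x ∂refMeasure := by
    rw [← inner_toLp_eq hGm hψ]
    have e : hGm.toLp = G := by
      refine Lp.ext ?_
      exact hGm.coeFn_toLp.trans (perExt_ae_eq _)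
    rw [e, hG, InnerProductSpace.toDual_symm_apply]
    rfl
  simpa only [h2, h3] using h1

/-- Periodizing the test function and its derivative reduces the weak formulation on the plane to
pairings over `Ω`, which pass to the limit. -/
lemma HasWeakPartial.of_weakLim {l : Filter ℕ} [l.NeBot] {i : Fin 2} {f g : ℕ → Pt → ℝ}
    {f' g' : Pt → ℝ} (h : ∀ n, HasWeakPartial i (f n) (g n))
    (pf : ∀ n, IsPeriodic (f n)) (pg : ∀ n, IsPeriodic (g n)) (pf' : IsPeriodic f')
    (pg' : IsPeriodic g') (mf : ∀ n, MemLp (f n) 2 refMeasure)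
    (mg : ∀ n, MemLp (g n) 2 refMeasure) (mf' : MemLp f' 2 refMeasure)
    (mg' : MemLp g' 2 refMeasure) (hf : WeakLim l f f') (hg : WeakLim l g g') :
    HasWeakPartial i f' g' := by
  have h21 : (1 : ℝ≥0∞) ≤ 2 := by norm_num
  refine ⟨pf'.locallyIntegrable (mf'.integrable h21), pg'.locallyIntegrable (mg'.integrable h21),
    fun φ hφ hc => ?_⟩
  obtain ⟨Ψ, cΨ, hΨ⟩ := exists_periodization (continuous_fderiv_dir hφ i)
    (hasCompactSupport_fderiv_dir hc i)
  obtain ⟨Θ, cΘ, hΘ⟩ := exists_periodization hφ.continuous hc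
  have h1 := hf Ψ (memLp_two_of_continuous cΨ)
  have h2 := (hg Θ (memLp_two_of_continuous cΘ)).neg
  have e : ∀ n, ∫ x, f n x * Ψ x ∂refMeasure = -∫ x, g n x * Θ x ∂refMeasure := fun n => by
    rw [← hΨ _ (pf n) ((mf n).integrable h21), ← hΘ _ (pg n) ((mg n).integrable h21)]
    exact (h n).2.2 φ hφ hc
  simp only [e] at h1
  rw [hΨ _ pf' (mf'.integrable h21), hΘ _ pg' (mg'.integrable h21)]
  exact tendsto_nhds_unique h1 h2

/-- Equi-Lipschitz bounded periodic functions have uniform limits along ultrafilters. -/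
lemma exists_uniform_limit (U : Ultrafilter ℕ) {w : ℕ → Pt → ℝ} {K : NNReal} {A : ℝ}
    (hw : ∀ n, LipschitzWith K (w n)) (pw : ∀ n, IsPeriodic (w n)) (hA : ∀ n x, |w n x| ≤ A) :
    ∃ v, LipschitzWith K v ∧ IsPeriodic v ∧ (∀ x, Tendsto (fun n => w n x) U (𝓝 (v x))) ∧
      ∀ ε > 0, ∀ᶠ n in U, ∀ x, |w n x - v x| ≤ ε := by
  have hlim : ∀ x, ∃ y, Tendsto (fun n => w n x) U (𝓝 y) := fun x => by
    obtain ⟨y, -, hy⟩ := (isCompact_Icc (a := -A) (b := A)).ultrafilter_le_nhds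
      (U.map fun n => w n x) (by
        rw [Filter.le_principal_iff]
        exact Filter.Eventually.of_forall (f := (U : Filter ℕ)) fun n => abs_le.1 (hA n x))
    exact ⟨y, hy⟩
  choose v hv using hlim
  have vl : LipschitzWith K v := LipschitzWith.of_dist_le_mul fun x y =>
    le_of_tendsto ((hv x).dist (hv y)) (Eventually.of_forall fun n => (hw n).dist_le_mul x y)
  have vp : IsPeriodic v := by
    rw [isPeriodic_iff]
    intro k x
    refine tendsto_nhds_unique (hv _) ?_
    simpa only [fun n => (pw n).add_latticeVec k x] using hv x
  refine ⟨v, vl, vp, hv, fun ε hε => ?_⟩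
  -- Mesh of a finite net on which pointwise convergence suffices; two Lipschitz errors and one net
  -- error make up `ε`. The `+ 1` covers `K = 0`.
  set r := ε / (3 * (K + 1)) with hr
  have hr0 : 0 < r := by positivity
  obtain ⟨t, -, ht⟩ := isCompact_refDomain.elim_nhds_subcover (fun x => Metric.ball x r)
    fun x _ => Metric.ball_mem_nhds x hr0
  have hKr : K * r ≤ ε / 3 := by
    rw [hr, mul_div_assoc', div_le_div_iff₀ (by positivity) (by norm_num)]
    nlinarith [K.coe_nonneg]
  have h1 : ∀ᶠ n in U, ∀ y ∈ t, |w n y - v y| < ε / 3 :=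
    (Filter.eventually_all_finset t).2 fun y _ => by
      have := (Metric.tendsto_nhds.1 (hv y)) (ε / 3) (by positivity)
      simpa only [Real.dist_eq] using this
  filter_upwards [h1] with n hn x
  obtain ⟨x', hx', k, rfl⟩ := exists_mem_refDomain x
  rw [(pw n).add_latticeVec, vp.add_latticeVec]
  obtain ⟨y, hyt, hy⟩ := Set.mem_iUnion₂.1 (ht hx')
  have h2 := (hw n).dist_le_mul x' y
  have h3 := vl.dist_le_mul x' y
  have h4 : K * dist x' y ≤ ε / 3 :=
    (mul_le_mul_of_nonneg_left (le_of_lt hy) K.coe_nonneg).trans hKr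
  rw [Real.dist_eq] at h2 h3
  have h5 := hn y hyt
  rw [abs_lt] at h5
  have h6 := abs_le.1 (h2.trans h4)
  have h7 := abs_le.1 (h3.trans h4)
  rw [abs_le]
  constructor <;> linarith [h5.1, h5.2, h6.1, h6.2, h7.1, h7.2]

/-- Convergence in `L²` of the reference domain of uniformly bounded functions. -/
structure BddConv (l : Filter ℕ) (f : ℕ → Pt → ℝ) (g : Pt → ℝ) : Prop where
  memLp : ∀ n, MemLp (f n) ∞ refMeasure
  memLp_lim : MemLp g ∞ refMeasure
  bound : ∃ M, 0 ≤ M ∧ (∀ n, ∀ᵐ x ∂refMeasure, |f n x| ≤ M) ∧ ∀ᵐ x ∂refMeasure, |g x| ≤ M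
  tendsto : Tendsto (fun n => ∫ x, (f n x - g x) ^ 2 ∂refMeasure) l (𝓝 0)

lemma integrable_sq_of_top {f : Pt → ℝ} (hf : MemLp f ∞ refMeasure) :
    Integrable (fun x => f x ^ 2) refMeasure :=
  (hf.mono_exponent (p := 2) le_top).integrable_sq

/-! ### Sums and products of boundedly convergent sequences -/

namespace BddConv

variable {l : Filter ℕ} {f f' : ℕ → Pt → ℝ} {g g' : Pt → ℝ}

lemma const (l : Filter ℕ) (c : ℝ) : BddConv l (fun _ _ => c) (fun _ => c) where
  memLp _ := memLp_const c
  memLp_lim := memLp_const c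
  bound := ⟨|c|, abs_nonneg c, fun _ => Eventually.of_forall fun _ => le_rfl,
    Eventually.of_forall fun _ => le_rfl⟩
  tendsto := by simpa using tendsto_const_nhds

lemma of_uniform (hf : ∀ n, Continuous (f n)) (hg : Continuous g) {A : ℝ} (hA : 0 ≤ A)
    (h1 : ∀ n x, |f n x| ≤ A) (h2 : ∀ x, |g x| ≤ A)
    (h : ∀ ε > 0, ∀ᶠ n in l, ∀ x, |f n x - g x| ≤ ε) : BddConv l f g where
  memLp n := memLp_top_of_continuous (hf n)
  memLp_lim := memLp_top_of_continuous hg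
  bound := ⟨A, hA, fun n => Eventually.of_forall (h1 n), Eventually.of_forall h2⟩
  tendsto := by
    rw [Metric.tendsto_nhds]
    intro ε hε
    -- The area `2π` of `Ω` is below 7.
    have hε' : 0 < √(ε / 7) := Real.sqrt_pos.2 (by positivity)
    filter_upwards [h _ hε'] with n hn
    have h3 : ∫ x, (f n x - g x) ^ 2 ∂refMeasure ≤ ∫ _, ε / 7 ∂refMeasure := by
      refine integral_mono_ae (integrable_sq_of_top
        ((memLp_top_of_continuous (hf n)).sub (memLp_top_of_continuous hg)))
        (integrable_const _) (Eventually.of_forall fun x => ?_)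
      have := pow_le_pow_left₀ (abs_nonneg _) (hn x) 2
      rwa [sq_abs, Real.sq_sqrt (by positivity)] at this
    rw [integral_const, refMeasure_real_univ, smul_eq_mul] at h3
    rw [dist_zero_right, Real.norm_of_nonneg (integral_nonneg fun x => sq_nonneg _)]
    have := Real.pi_lt_d2
    nlinarith

lemma squeeze {b : ℕ → ℝ} {a : ℕ → Pt → ℝ} (ha : ∀ n, ∫ x, a n x ^ 2 ∂refMeasure ≤ b n)
    (hb : Tendsto b l (𝓝 0)) : Tendsto (fun n => ∫ x, a n x ^ 2 ∂refMeasure) l (𝓝 0) :=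
  squeeze_zero (fun _ => integral_nonneg fun _ => sq_nonneg _) ha hb

lemma add (h : BddConv l f g) (h' : BddConv l f' g') :
    BddConv l (fun n x => f n x + f' n x) (fun x => g x + g' x) where
  memLp n := (h.memLp n).add (h'.memLp n)
  memLp_lim := h.memLp_lim.add h'.memLp_lim
  bound := by
    obtain ⟨M, hM, h1, h2⟩ := h.bound
    obtain ⟨M', hM', h1', h2'⟩ := h'.bound
    refine ⟨M + M', by positivity, fun n => ?_, ?_⟩
    · filter_upwards [h1 n, h1' n] with x hx hx'
      exact (abs_add_le _ _).trans (add_le_add hx hx')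
    · filter_upwards [h2, h2'] with x hx hx'
      exact (abs_add_le _ _).trans (add_le_add hx hx')
  tendsto := by
    refine squeeze (b := fun n => 2 * (∫ x, (f n x - g x) ^ 2 ∂refMeasure) +
      2 * ∫ x, (f' n x - g' x) ^ 2 ∂refMeasure) (fun n => ?_) ?_
    · have i1 := (integrable_sq_of_top ((h.memLp n).sub h.memLp_lim)).const_mul 2
      have i2 := (integrable_sq_of_top ((h'.memLp n).sub h'.memLp_lim)).const_mul 2
      rw [← integral_const_mul, ← integral_const_mul]
      refine (integral_mono_ae ?_ (i1.add i2) (Eventually.of_forall fun x => ?_)).trans_eq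
        (integral_add i1 i2)
      · exact integrable_sq_of_top (((h.memLp n).add (h'.memLp n)).sub
          (h.memLp_lim.add h'.memLp_lim))
      · simp only [Pi.add_apply, Pi.sub_apply]
        nlinarith [sq_nonneg ((f n x - g x) - (f' n x - g' x))]
    · simpa using (h.tendsto.const_mul 2).add (h'.tendsto.const_mul 2)

/-- Strong `L²` convergence alone is not stable under products; the uniform bounds in `BddConv` are
carried along for this step. -/
lemma mul (h : BddConv l f g) (h' : BddConv l f' g') :
    BddConv l (fun n x => f n x * f' n x) (fun x => g x * g' x) where
  memLp n := memLp_mul_top (h.memLp n) (h'.memLp n)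
  memLp_lim := memLp_mul_top h.memLp_lim h'.memLp_lim
  bound := by
    obtain ⟨M, hM, h1, h2⟩ := h.bound
    obtain ⟨M', hM', h1', h2'⟩ := h'.bound
    refine ⟨M * M', by positivity, fun n => ?_, ?_⟩
    · filter_upwards [h1 n, h1' n] with x hx hx'
      rw [abs_mul]
      exact mul_le_mul hx hx' (abs_nonneg _) hM
    · filter_upwards [h2, h2'] with x hx hx'
      rw [abs_mul]
      exact mul_le_mul hx hx' (abs_nonneg _) hM
  tendsto := by
    obtain ⟨M, hM, h1, h2⟩ := h.bound
    obtain ⟨M', hM', h1', h2'⟩ := h'.bound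
    refine squeeze (b := fun n => 2 * M' ^ 2 * (∫ x, (f n x - g x) ^ 2 ∂refMeasure) +
      2 * M ^ 2 * ∫ x, (f' n x - g' x) ^ 2 ∂refMeasure) (fun n => ?_) ?_
    · have i1 := (integrable_sq_of_top ((h.memLp n).sub h.memLp_lim)).const_mul (2 * M' ^ 2)
      have i2 := (integrable_sq_of_top ((h'.memLp n).sub h'.memLp_lim)).const_mul (2 * M ^ 2)
      rw [← integral_const_mul, ← integral_const_mul]
      refine (integral_mono_ae ?_ (i1.add i2) ?_).trans_eq (integral_add i1 i2)
      · exact integrable_sq_of_top ((memLp_mul_top (h.memLp n) (h'.memLp n)).sub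
          (memLp_mul_top h.memLp_lim h'.memLp_lim))
      · filter_upwards [h1' n, h2] with x hx hx'
        simp only [Pi.add_apply, Pi.sub_apply]
        have e : f n x * f' n x - g x * g' x =
          f' n x * (f n x - g x) + g x * (f' n x - g' x) := by ring
        have s1 : f' n x ^ 2 ≤ M' ^ 2 := sq_le_sq.2 (hx.trans (le_abs_self _))
        have s2 : g x ^ 2 ≤ M ^ 2 := sq_le_sq.2 (hx'.trans (le_abs_self _))
        have s3 := mul_le_mul_of_nonneg_right s1 (sq_nonneg (f n x - g x))
        have s4 := mul_le_mul_of_nonneg_right s2 (sq_nonneg (f' n x - g' x))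
        have s5 := sq_nonneg (f' n x * (f n x - g x) - g x * (f' n x - g' x))
        rw [e]
        linarith
    · simpa using (h.tendsto.const_mul (2 * M' ^ 2)).add (h'.tendsto.const_mul (2 * M ^ 2))

lemma sub (h : BddConv l f g) (h' : BddConv l f' g') :
    BddConv l (fun n x => f n x - f' n x) (fun x => g x - g' x) := by
  convert h.add ((const l (-1)).mul h') using 3 <;> ring

lemma weakLim (h : BddConv l f g) : WeakLim l f g := by
  intro ψ hψ
  have hd : ∀ n, MemLp (fun x => f n x - g x) 2 refMeasure := fun n =>
    ((h.memLp n).sub h.memLp_lim).mono_exponent le_top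
  have e : ∀ n, ∫ x, f n x * ψ x ∂refMeasure =
      (∫ x, (f n x - g x) * ψ x ∂refMeasure) + ∫ x, g x * ψ x ∂refMeasure := fun n => by
    rw [← integral_add (f := fun x => (f n x - g x) * ψ x) (g := fun x => g x * ψ x)
      ((hd n).integrable_mul hψ)
      ((h.memLp_lim.mono_exponent (p := 2) le_top).integrable_mul hψ)]
    congr 1
    ext x
    ring
  have h1 : Tendsto (fun n => ∫ x, (f n x - g x) * ψ x ∂refMeasure) l (𝓝 0) := by
    have h2 : Tendsto (fun n => √((∫ x, (f n x - g x) ^ 2 ∂refMeasure) *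
        ∫ x, ψ x ^ 2 ∂refMeasure)) l (𝓝 0) := by
      simpa using (h.tendsto.mul_const (∫ x, ψ x ^ 2 ∂refMeasure)).sqrt
    refine squeeze_zero_norm (fun n => ?_) h2
    exact Real.abs_le_sqrt (integral_mul_sq_le (hd n) hψ)
  simpa only [e, zero_add] using h1.add_const _

lemma tendsto_integral_sq (h : BddConv l f g) :
    Tendsto (fun n => ∫ x, f n x ^ 2 ∂refMeasure) l (𝓝 (∫ x, g x ^ 2 ∂refMeasure)) := by
  simpa [sq] using (h.mul h).weakLim (fun _ => 1) (memLp_const 1)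

end BddConv

/-! ### Existence of minimizers -/

lemma WeakLim.add {l : Filter ℕ} {f f' : ℕ → Pt → ℝ} {g g' : Pt → ℝ} (h : WeakLim l f g)
    (h' : WeakLim l f' g') (mf : ∀ n, MemLp (f n) 2 refMeasure)
    (mf' : ∀ n, MemLp (f' n) 2 refMeasure) (mg : MemLp g 2 refMeasure)
    (mg' : MemLp g' 2 refMeasure) :
    WeakLim l (fun n x => f n x + f' n x) (fun x => g x + g' x) := by
  intro ψ hψ
  have e : ∀ {a b : Pt → ℝ}, MemLp a 2 refMeasure → MemLp b 2 refMeasure →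
      ∫ x, (a x + b x) * ψ x ∂refMeasure =
        (∫ x, a x * ψ x ∂refMeasure) + ∫ x, b x * ψ x ∂refMeasure := by
    intro a b ha hb
    rw [← integral_add (f := fun x => a x * ψ x) (g := fun x => b x * ψ x)
      (ha.integrable_mul hψ) (hb.integrable_mul hψ)]
    simp only [add_mul]
  simp only [fun n => e (mf n) (mf' n), e mg mg']
  exact (h ψ hψ).add (h' ψ hψ)

lemma WeakLim.neg {l : Filter ℕ} {f : ℕ → Pt → ℝ} {g : Pt → ℝ} (h : WeakLim l f g) :
    WeakLim l (fun n x => -f n x) (fun x => -g x) := by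
  intro ψ hψ
  simpa only [neg_mul, integral_neg] using (h ψ hψ).neg

/-- Serves the bending term `Φ_ρ ∂_i∂_kΦ_θ`, whose second factor converges only weakly: uniform
convergence of the first factor is moved onto the test function. -/
lemma WeakLim.uniform_mul {l : Filter ℕ} {f q : ℕ → Pt → ℝ} {g r : Pt → ℝ} {C : ℝ}
    (h : WeakLim l q r) (mq : ∀ n, MemLp (q n) 2 refMeasure)
    (hC : ∀ n, ∫ x, q n x ^ 2 ∂refMeasure ≤ C) (cf : ∀ n, Continuous (f n)) (cg : Continuous g)
    (hf : ∀ ε > 0, ∀ᶠ n in l, ∀ x, |f n x - g x| ≤ ε) :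
    WeakLim l (fun n x => f n x * q n x) (fun x => g x * r x) := by
  intro ψ hψ
  have hg : MemLp (fun x => g x * ψ x) 2 refMeasure :=
    memLp_mul_top (memLp_top_of_continuous cg) hψ
  have hd : ∀ n, MemLp (fun x => (f n x - g x) * ψ x) 2 refMeasure := fun n =>
    memLp_mul_top (memLp_top_of_continuous ((cf n).sub cg)) hψ
  have e : ∀ n, ∫ x, f n x * q n x * ψ x ∂refMeasure =
      (∫ x, q n x * (g x * ψ x) ∂refMeasure) +
        ∫ x, q n x * ((f n x - g x) * ψ x) ∂refMeasure := fun n => by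
    rw [← integral_add (f := fun x => q n x * (g x * ψ x))
      (g := fun x => q n x * ((f n x - g x) * ψ x))
      ((mq n).integrable_mul hg) ((mq n).integrable_mul (hd n))]
    congr 1
    ext x
    ring
  have e' : ∫ x, g x * r x * ψ x ∂refMeasure = ∫ x, r x * (g x * ψ x) ∂refMeasure := by
    congr 1
    ext x
    ring
  set B := ∫ x, ψ x ^ 2 ∂refMeasure with hB
  have hB0 : 0 ≤ B := integral_nonneg fun x => sq_nonneg _
  have hC0 : 0 ≤ C := (integral_nonneg fun x => sq_nonneg _).trans (hC 0)
  have h1 : Tendsto (fun n => ∫ x, q n x * ((f n x - g x) * ψ x) ∂refMeasure) l (𝓝 0) := by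
    rw [Metric.tendsto_nhds]
    intro ε hε
    have hη : 0 < ε / (2 * (√(C * B) + 1)) := by positivity
    filter_upwards [hf _ hη] with n hn
    set η := ε / (2 * (√(C * B) + 1)) with hηdef
    have h2 : ∫ x, ((f n x - g x) * ψ x) ^ 2 ∂refMeasure ≤ η ^ 2 * B := by
      rw [hB, ← integral_const_mul]
      refine integral_mono_ae (hd n).integrable_sq (hψ.integrable_sq.const_mul _)
        (Eventually.of_forall fun x => ?_)
      simp only [mul_pow]
      refine mul_le_mul_of_nonneg_right ?_ (sq_nonneg _)
      exact sq_le_sq.2 ((hn x).trans (le_abs_self η))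
    have h3 := integral_mul_sq_le (mq n) (hd n)
    have h4 : (∫ x, q n x * ((f n x - g x) * ψ x) ∂refMeasure) ^ 2 ≤ (√(C * B) * η) ^ 2 := by
      refine h3.trans ((mul_le_mul (hC n) h2 (integral_nonneg fun x => sq_nonneg _) hC0).trans_eq ?_)
      rw [mul_pow, Real.sq_sqrt (by positivity)]
      ring
    have h5 := abs_le_of_sq_le_sq h4 (by positivity)
    rw [dist_zero_right, Real.norm_eq_abs]
    refine h5.trans_lt ?_
    rw [hηdef, mul_div_assoc', div_lt_iff₀ (by positivity)]
    nlinarith [Real.sqrt_nonneg (C * B)]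
  simp only [e, e']
  simpa using (h _ hg).add h1

/-- A pointwise lower bound is equivalent to lower bounds for integrals over measurable sets, and
weak convergence may be tested with their indicators. -/
lemma ae_le_of_weakLim {l : Filter ℕ} [l.NeBot] {f : ℕ → Pt → ℝ} {g : Pt → ℝ} {c : ℝ}
    (h : WeakLim l f g) (mf : ∀ n, MemLp (f n) 2 refMeasure) (mg : MemLp g 2 refMeasure)
    (hf : ∀ n, ∀ᵐ x ∂refMeasure, c ≤ f n x) : ∀ᵐ x ∂refMeasure, c ≤ g x := by
  refine ae_le_of_forall_setIntegral_le (integrable_const c) (mg.integrable (by norm_num))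
    fun s hs _ => ?_
  have hψ : MemLp (s.indicator fun _ => (1 : ℝ)) 2 refMeasure :=
    (memLp_const 1).indicator hs
  have e : ∀ a : Pt → ℝ, ∫ x, a x * s.indicator (fun _ => (1 : ℝ)) x ∂refMeasure =
      ∫ x in s, a x ∂refMeasure := fun a => by
    rw [← integral_indicator hs]
    congr 1
    ext x
    by_cases hx : x ∈ s <;> simp [hx]
  have h1 := h _ hψ
  simp only [e] at h1
  refine ge_of_tendsto h1 (Eventually.of_forall fun n => ?_)
  exact integral_mono_ae (integrable_const c) ((mf n).integrable (by norm_num)).integrableOn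
    (ae_restrict_of_ae (hf n))

/-! ### A priori bounds for jets of bounded energy -/

namespace IsJet

variable {lam m : ℝ} {w : Fin 3 → Pt → ℝ} {p : Fin 2 → Fin 3 → Pt → ℝ}
  {q : Fin 2 → Fin 2 → Fin 3 → Pt → ℝ}

lemma abs_slope_ae (H : IsJet lam m w p q) :
    ∀ᵐ x ∂refMeasure, ∀ i j, |jetSlope lam p x i j| ≤ m :=
  ae_refMeasure_of_ae (ae_all_iff.2 fun i => ae_all_iff.2 fun j => H.slope_le i j)

/-- Bending differs from the second derivatives by products of bounded first-order quantities. The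
angular component carries the factor `Φ_ρ`, which can be divided out because `Φ_ρ ≥ 1`. -/
lemma integral_hess_sq_le (H : IsJet lam m w p q) {R : ℝ} (hR : ∀ x, w 0 x ≤ R) (i k : Fin 2)
    (j : Fin 3) : ∫ x, q i k j x ^ 2 ∂refMeasure ≤
      2 * (∫ x, bend lam w p q i k j x ^ 2 ∂refMeasure) +
        2 * Real.pi * (2 * ((R + 2) * m ^ 2) ^ 2) := by
  have i1 := (H.integrable_bend_sq i k j).const_mul 2
  have i2 : Integrable (fun _ : Pt => 2 * ((R + 2) * m ^ 2) ^ 2) refMeasure := integrable_const _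
  have e : 2 * Real.pi * (2 * ((R + 2) * m ^ 2) ^ 2) =
      ∫ _, 2 * ((R + 2) * m ^ 2) ^ 2 ∂refMeasure := by
    rw [integral_const, refMeasure_real_univ, smul_eq_mul]
  rw [e, ← integral_const_mul, ← integral_add i1 i2]
  refine integral_mono_ae (H.memLp_q i k j).integrable_sq (i1.add i2) ?_
  filter_upwards [H.abs_slope_ae] with x hx
  show q i k j x ^ 2 ≤ 2 * bend lam w p q i k j x ^ 2 + 2 * ((R + 2) * m ^ 2) ^ 2
  have hr := H.one_le x
  have hrR := hR x
  have hm : 0 ≤ m := (abs_nonneg _).trans (hx 0 0)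
  have hmul : ∀ a b c d, |jetSlope lam p x a b * jetSlope lam p x c d| ≤ m ^ 2 := by
    intro a b c d
    rw [abs_mul, sq]
    exact mul_le_mul (hx a b) (hx c d) (abs_nonneg _) hm
  have main : |q i k j x| ≤ |bend lam w p q i k j x| + (R + 2) * m ^ 2 := by
    have hR2 : 0 ≤ (R + 2) * m ^ 2 := by
      have : 0 ≤ R + 2 := by linarith
      positivity
    fin_cases j
    · have e : q i k 0 x = bend lam w p q i k 0 x +
          w 0 x * (jetSlope lam p x i 1 * jetSlope lam p x k 1) := by
        simp only [bend, hessOf, Matrix.cons_val_zero]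
        ring
      have h1 : |w 0 x * (jetSlope lam p x i 1 * jetSlope lam p x k 1)| ≤ R * m ^ 2 := by
        rw [abs_mul, abs_of_nonneg (by linarith : 0 ≤ w 0 x)]
        exact mul_le_mul hrR (hmul _ _ _ _) (abs_nonneg _) (by linarith)
      have h2 := abs_add_le (bend lam w p q i k 0 x)
        (w 0 x * (jetSlope lam p x i 1 * jetSlope lam p x k 1))
      rw [← e] at h2
      show |q i k 0 x| ≤ |bend lam w p q i k 0 x| + (R + 2) * m ^ 2
      linarith [sq_nonneg m]
    · have e : w 0 x * q i k 1 x = bend lam w p q i k 1 x -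
          (jetSlope lam p x i 0 * jetSlope lam p x k 1 +
            jetSlope lam p x k 0 * jetSlope lam p x i 1) := by
        simp only [bend, hessOf, Matrix.cons_val_one, Matrix.cons_val_zero]
        ring
      have h1 : |q i k 1 x| ≤ |w 0 x * q i k 1 x| := by
        rw [abs_mul, abs_of_nonneg (by linarith : 0 ≤ w 0 x)]
        exact le_mul_of_one_le_left (abs_nonneg _) hr
      have h2 := abs_sub (bend lam w p q i k 1 x)
        (jetSlope lam p x i 0 * jetSlope lam p x k 1 +
            jetSlope lam p x k 0 * jetSlope lam p x i 1)
      have h3 := abs_add_le (jetSlope lam p x i 0 * jetSlope lam p x k 1)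
        (jetSlope lam p x k 0 * jetSlope lam p x i 1)
      rw [← e] at h2
      show |q i k 1 x| ≤ |bend lam w p q i k 1 x| + (R + 2) * m ^ 2
      have h4 : 0 ≤ R * m ^ 2 := mul_nonneg (by linarith) (sq_nonneg m)
      linarith [hmul i 0 k 1, hmul k 0 i 1]
    · have e : q i k 2 x = bend lam w p q i k 2 x := rfl
      show |q i k 2 x| ≤ |bend lam w p q i k 2 x| + (R + 2) * m ^ 2
      rw [e]
      linarith
  have h1 := pow_le_pow_left₀ (abs_nonneg _) main 2
  rw [sq_abs] at h1
  have h2 := sq_abs (bend lam w p q i k j x)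
  nlinarith [sq_nonneg (|bend lam w p q i k j x| - (R + 2) * m ^ 2)]

lemma integral_bend_sq_le (H : IsJet lam m w p q) {h : ℝ} (hh : 0 < h)
    (hE : jetEnergy h lam w p q ≤ 9) (i k : Fin 2) (j : Fin 3) :
    ∫ x, bend lam w p q i k j x ^ 2 ∂refMeasure ≤ 9 / h ^ 2 := by
  have h1 : ∀ i k j, 0 ≤ ∫ x, bend lam w p q i k j x ^ 2 ∂refMeasure := fun i k j =>
    integral_nonneg fun x => sq_nonneg _
  have h2 : 0 ≤ ∑ i, ∑ k, ∫ x, strain lam w p i k x ^ 2 ∂refMeasure :=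
    Finset.sum_nonneg fun i _ => Finset.sum_nonneg fun k _ => integral_nonneg fun x => sq_nonneg _
  have h3 : ∫ x, bend lam w p q i k j x ^ 2 ∂refMeasure ≤
      ∑ i, ∑ k, ∑ j, ∫ x, bend lam w p q i k j x ^ 2 ∂refMeasure := by
    refine (Finset.single_le_sum (f := fun j => ∫ x, bend lam w p q i k j x ^ 2 ∂refMeasure)
      (fun j _ => h1 i k j) (Finset.mem_univ j)).trans ?_
    refine (Finset.single_le_sum
      (f := fun k => ∑ j, ∫ x, bend lam w p q i k j x ^ 2 ∂refMeasure)
      (fun k _ => Finset.sum_nonneg fun j _ => h1 i k j) (Finset.mem_univ k)).trans ?_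
    exact Finset.single_le_sum
      (f := fun i => ∑ k, ∑ j, ∫ x, bend lam w p q i k j x ^ 2 ∂refMeasure)
      (fun i _ => Finset.sum_nonneg fun k _ => Finset.sum_nonneg fun j _ => h1 i k j)
      (Finset.mem_univ i)
  rw [H.jetEnergy_eq] at hE
  rw [le_div_iff₀ (by positivity)]
  have h4 := mul_le_mul_of_nonneg_left h3 (sq_nonneg h)
  linarith

/-- Jets can be normalized by a rigid motion. -/
lemma exists_normalized (H : IsJet lam m w p q) (hm : 0 ≤ m) {h : ℝ}
    (hE : jetEnergy h lam w p q ≤ 9) :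
    ∃ w', IsJet lam m w' p q ∧ jetEnergy h lam w' p q = jetEnergy h lam w p q ∧
      ∀ j x, |w' j x| ≤ 2 + 14 * (m + 1) := by
  -- The energy does not see constants added to `Φ_θ` and `Φ_z`. The radius enters it
  -- undifferentiated and must not be shifted, but it is already bounded.
  have hc : ∀ j : Fin 3, ∃ c : ℝ, (j = 0 → c = 0) ∧ ∀ x, |w j x - c| ≤ 2 + 14 * (m + 1) := by
    intro j
    by_cases hj : j = 0
    · subst hj
      refine ⟨0, fun _ => rfl, fun x => ?_⟩
      rw [sub_zero, abs_of_nonneg (zero_le_one.trans (H.one_le x))]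
      exact H.radius_le hm hE x
    · refine ⟨w j 0, fun h => absurd h hj, fun x => ?_⟩
      obtain ⟨x', hx', k, rfl⟩ := exists_mem_refDomain x
      rw [(H.per_w j).add_latticeVec]
      have h1 := (H.lipschitz j).dist_le_mul x' 0
      rw [Real.coe_toNNReal _ (by linarith), Real.dist_eq] at h1
      have h2 : dist x' 0 ≤ 7 := by
        rw [Prod.dist_eq, Real.dist_eq, Real.dist_eq]
        have := Real.pi_lt_d2
        have := Real.pi_pos
        simp only [Prod.fst_zero, Prod.snd_zero, sub_zero]
        refine max_le (abs_le.2 ⟨?_, ?_⟩) (abs_le.2 ⟨?_, ?_⟩) <;>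
        linarith [hx'.1.1, hx'.1.2, hx'.2.1, hx'.2.2]
      have h4 : 2 * (m + 1) * dist x' 0 ≤ 2 * (m + 1) * 7 :=
        mul_le_mul_of_nonneg_left h2 (by linarith)
      linarith
  choose c hc0 hcb using hc
  have e0 : ∀ x, w 0 x - c 0 = w 0 x := fun x => by rw [hc0 0 rfl, sub_zero]
  refine ⟨fun j x => w j x - c j, ⟨fun j => ?_, fun j => (H.per_w j).sub (isPeriodic_const _),
    H.per_p, H.per_q, fun i j => ?_, H.partial_p, H.memLp_q, fun x => ?_, H.slope_le,
    H.nonneg⟩, ?_, hcb⟩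
  · refine LipschitzWith.of_dist_le_mul fun x y => ?_
    rw [dist_sub_right]
    exact (H.lipschitz j).dist_le_mul x y
  · simpa using (H.partial_w i j).sub (hasWeakPartial_const i (c j))
  · rw [e0]
    exact H.one_le x
  · simp only [jetEnergy, e0]

end IsJet

/-- Compactness of jets with bounded energy, and lower semicontinuity of the energy. -/
lemma exists_jet_limit {lam m h I : ℝ} (hm : 1 ≤ m) (hl0 : 0 ≤ lam) (hl1 : lam ≤ 1) (hh : 0 < h)
    {w : ℕ → Fin 3 → Pt → ℝ} {p : ℕ → Fin 2 → Fin 3 → Pt → ℝ}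
    {q : ℕ → Fin 2 → Fin 2 → Fin 3 → Pt → ℝ} (H : ∀ n, IsJet lam m (w n) (p n) (q n))
    (hE : ∀ n, jetEnergy h lam (w n) (p n) (q n) ≤ 9)
    (hI : Tendsto (fun n => jetEnergy h lam (w n) (p n) (q n)) atTop (𝓝 I)) :
    ∃ w' p' q', IsJet lam m w' p' q' ∧ jetEnergy h lam w' p' q' ≤ I := by
  have hm0 : 0 ≤ m := by linarith
  wlog hbd : ∀ n j x, |w n j x| ≤ 2 + 14 * (m + 1) generalizing w
  · choose v hv hvE hvb using fun n => (H n).exists_normalized hm0 (hE n)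
    exact this hv (fun n => (hvE n).trans_le (hE n)) (by simpa only [hvE] using hI) hvb
  -- One free ultrafilter replaces the successive extraction of subsequences for all components.
  set U := hyperfilter ℕ with hU
  have hI' : Tendsto (fun n => jetEnergy h lam (w n) (p n) (q n)) U (𝓝 I) :=
    hI.mono_left (Nat.hyperfilter_le_atTop)
  have hR : ∀ n x, w n 0 x ≤ 2 + 14 * (m + 1) := fun n x => (le_abs_self _).trans (hbd n 0 x)
  choose v vl vp vt vu using fun j =>
    exists_uniform_limit U (fun n => (H n).lipschitz j) (fun n => (H n).per_w j)
      (fun n x => hbd n j x)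
  have hpb : ∀ i j n, ∫ x, p n i j x ^ 2 ∂refMeasure ≤ 2 * Real.pi * (m + 1) ^ 2 := by
    intro i j n
    have e : 2 * Real.pi * (m + 1) ^ 2 = ∫ _, (m + 1) ^ 2 ∂refMeasure := by
      rw [integral_const, refMeasure_real_univ, smul_eq_mul]
    rw [e]
    refine integral_mono_ae ((H n).memLp_p i j).integrable_sq (integrable_const _) ?_
    filter_upwards [ae_refMeasure_of_ae ((H n).abs_p_le hl0 hl1 i j)] with x hx
    exact sq_le_sq.2 (hx.trans (le_abs_self _))
  obtain ⟨C, hqb⟩ : ∃ C, ∀ i k j n, ∫ x, q n i k j x ^ 2 ∂refMeasure ≤ C := by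
    refine ⟨2 * (9 / h ^ 2) + 2 * Real.pi * (2 * ((2 + 14 * (m + 1) + 2) * m ^ 2) ^ 2),
      fun i k j n => ((H n).integral_hess_sq_le (hR n) i k j).trans ?_⟩
    have := (H n).integral_bend_sq_le hh (hE n) i k j
    linarith
  choose p' pp' mp' hp' using fun i j =>
    exists_weakLim U (fun n => (H n).memLp_p i j) (hpb i j)
  choose q' pq' mq' hq' using fun i k j =>
    exists_weakLim U (fun n => (H n).memLp_q i k j) (hqb i k j)
  have hvb : ∀ j x, |v j x| ≤ 2 + 14 * (m + 1) := fun j x =>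
    le_of_tendsto (vt j x).abs (Eventually.of_forall fun n => hbd n j x)
  have hvconv : ∀ j, BddConv U (fun n => w n j) (v j) := fun j =>
    BddConv.of_uniform (fun n => (H n).continuous j) (vl j).continuous (by positivity)
      (fun n => hbd n j) (hvb j) (vu j)
  have mv : ∀ j, MemLp (v j) 2 refMeasure := fun j => memLp_two_of_continuous (vl j).continuous
  have hvp : ∀ i j, HasWeakPartial i (v j) (p' i j) := fun i j =>
    HasWeakPartial.of_weakLim (l := U) (fun n => (H n).partial_w i j) (fun n => (H n).per_w j)
      (fun n => (H n).per_p i j) (vp j) (pp' i j)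
      (fun n => memLp_two_of_continuous ((H n).continuous j)) (fun n => (H n).memLp_p i j) (mv j)
      (mp' i j) (hvconv j).weakLim (hp' i j)
  have hpq : ∀ i k j, HasWeakPartial i (p' k j) (q' i k j) := fun i k j =>
    HasWeakPartial.of_weakLim (l := U) (fun n => (H n).partial_p i k j) (fun n => (H n).per_p k j)
      (fun n => (H n).per_q i k j) (pp' k j) (pq' i k j) (fun n => (H n).memLp_p k j)
      (fun n => (H n).memLp_q i k j) (mp' k j) (mq' i k j) (hp' k j) (hq' i k j)
  have hJ1 : ∀ i j, ∀ᵐ x, |p' i j x + slope lam i j| ≤ m := fun i j => by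
    refine ae_of_ae_refMeasure (fun k x => by rw [(pp' i j).add_latticeVec]) ?_
    have h1 := ae_le_of_weakLim (c := -m - slope lam i j) (hp' i j)
      (fun n => (H n).memLp_p i j) (mp' i j) fun n => by
        filter_upwards [ae_refMeasure_of_ae ((H n).slope_le i j)] with x hx
        linarith [(abs_le.1 hx).1]
    have h2 := ae_le_of_weakLim (c := slope lam i j - m) (hp' i j).neg
      (fun n => ((H n).memLp_p i j).neg) (mp' i j).neg fun n => by
        filter_upwards [ae_refMeasure_of_ae ((H n).slope_le i j)] with x hx
        linarith [(abs_le.1 hx).2]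
    filter_upwards [h1, h2] with x h3 h4
    exact abs_le.2 ⟨by linarith, by linarith⟩
  have hJ2 : ∀ᵐ x, 0 ≤ p' 1 2 x + slope lam 1 2 := by
    refine ae_of_ae_refMeasure (fun k x => by rw [(pp' 1 2).add_latticeVec]) ?_
    have h1 := ae_le_of_weakLim (c := -slope lam 1 2) (hp' 1 2)
      (fun n => (H n).memLp_p 1 2) (mp' 1 2) fun n => by
        filter_upwards [ae_refMeasure_of_ae (H n).nonneg] with x hx
        linarith
    filter_upwards [h1] with x h3
    linarith
  have J : IsJet lam m v p' q' := ⟨vl, vp, pp', pq', hvp, hpq, mq',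
    fun x => ge_of_tendsto (vt 0 x) (Eventually.of_forall fun n => (H n).one_le x), hJ1, hJ2⟩
  -- Upgrade from weak to strong convergence: by parts, `‖∂_i(w_n - v)‖² ≤ ‖w_n - v‖ ‖∂_i²(w_n -
  -- v)‖`, where the first factor tends to zero and the second stays bounded.
  have hpconv : ∀ i j, BddConv U (fun n => p n i j) (p' i j) := fun i j => by
    refine ⟨fun n => (H n).memLp_top_p i j, J.memLp_top_p i j, ⟨m + 1, by linarith,
      fun n => ae_refMeasure_of_ae ((H n).abs_p_le hl0 hl1 i j),
      ae_refMeasure_of_ae (J.abs_p_le hl0 hl1 i j)⟩, ?_⟩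
    have hdq : ∀ n, MemLp (fun x => q n i i j x - q' i i j x) 2 refMeasure := fun n =>
      ((H n).memLp_q i i j).sub (mq' i i j)
    have hdw : ∀ n, MemLp (fun x => w n j x - v j x) 2 refMeasure := fun n =>
      memLp_two_of_continuous (((H n).continuous j).sub (vl j).continuous)
    have ibp : ∀ n, ∫ x, (p n i j x - p' i j x) ^ 2 ∂refMeasure =
        -∫ x, (w n j x - v j x) * (q n i i j x - q' i i j x) ∂refMeasure := fun n => by
      refine integral_sq_weakPartial (M := 2 * (m + 1)) (((H n).partial_w i j).sub (hvp i j))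
        (((H n).partial_p i i j).sub (hpq i i j)) (((H n).continuous j).sub (vl j).continuous)
        (((H n).per_w j).sub (vp j)) (((H n).per_p i j).sub (pp' i j))
        (((H n).per_q i i j).sub (pq' i i j)) ?_ ((hdq n).integrable (by norm_num))
      filter_upwards [(H n).abs_p_le hl0 hl1 i j, J.abs_p_le hl0 hl1 i j] with x h1 h2
      exact (abs_sub _ _).trans (by linarith)
    have hD : ∀ n, ∫ x, (q n i i j x - q' i i j x) ^ 2 ∂refMeasure ≤
        2 * C + 2 * ∫ x, q' i i j x ^ 2 ∂refMeasure := fun n => by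
      have i1 := ((H n).memLp_q i i j).integrable_sq.const_mul 2
      have i2 := (mq' i i j).integrable_sq.const_mul 2
      have h1 : ∫ x, (q n i i j x - q' i i j x) ^ 2 ∂refMeasure ≤
          ∫ x, (2 * q n i i j x ^ 2 + 2 * q' i i j x ^ 2) ∂refMeasure :=
        integral_mono_ae (hdq n).integrable_sq (i1.add i2) (Eventually.of_forall fun x => by
          simp only
          nlinarith [sq_nonneg (q n i i j x + q' i i j x)])
      rw [integral_add i1 i2, integral_const_mul, integral_const_mul] at h1
      linarith [hqb i i j n]
    have h2 : Tendsto (fun n => √((∫ x, (w n j x - v j x) ^ 2 ∂refMeasure) *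
        (2 * C + 2 * ∫ x, q' i i j x ^ 2 ∂refMeasure))) U (𝓝 0) := by
      simpa using ((hvconv j).tendsto.mul_const
        (2 * C + 2 * ∫ x, q' i i j x ^ 2 ∂refMeasure)).sqrt
    refine squeeze_zero_norm (fun n => ?_) h2
    rw [ibp, norm_neg]
    refine Real.abs_le_sqrt ((integral_mul_sq_le (hdw n) (hdq n)).trans ?_)
    exact mul_le_mul_of_nonneg_left (hD n) (integral_nonneg fun x => sq_nonneg _)
  have hs : ∀ i j, BddConv U (fun n x => jetSlope lam (p n) x i j)
      (fun x => jetSlope lam p' x i j) := fun i j =>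
    (hpconv i j).add (BddConv.const U (slope lam i j))
  have hstrain : ∀ i k, BddConv U (fun n => strain lam (w n) (p n) i k) (strain lam v p' i k) :=
    fun i k => ((((hs i 0).mul (hs k 0)).add
      (((hvconv 0).mul (hs i 1)).mul ((hvconv 0).mul (hs k 1)))).add
      ((hs i 2).mul (hs k 2))).sub (BddConv.const U _)
  have hbend : ∀ i k j, WeakLim U (fun n => bend lam (w n) (p n) (q n) i k j)
      (bend lam v p' q' i k j) := by
    intro i k j
    fin_cases j
    · have hb := (((hvconv 0).mul (hs i 1)).mul (hs k 1))
      have h1 := (hq' i k 0).add hb.weakLim.neg (fun n => (H n).memLp_q i k 0)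
        (fun n => ((hb.memLp n).mono_exponent le_top).neg) (mq' i k 0)
        (hb.memLp_lim.mono_exponent le_top).neg
      simpa only [← sub_eq_add_neg] using! h1
    · have hb := ((hs i 0).mul (hs k 1)).add ((hs k 0).mul (hs i 1))
      have hwq := (hq' i k 1).uniform_mul (fun n => (H n).memLp_q i k 1) (hqb i k 1)
        (fun n => (H n).continuous 0) (vl 0).continuous (vu 0)
      exact hb.weakLim.add hwq (fun n => (hb.memLp n).mono_exponent le_top)
        (fun n => memLp_mul_top ((H n).memLp_top_w 0) ((H n).memLp_q i k 1))
        (hb.memLp_lim.mono_exponent le_top) (memLp_mul_top (J.memLp_top_w 0) (mq' i k 1))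
    · exact hq' i k 2
  refine ⟨v, p', q', J, ?_⟩
  -- Lower semicontinuity through `b_n² ≥ 2 b_n b - b²`: the right side is affine in the weakly
  -- convergent `b_n`, and its integral tends to that of `b²`.
  have hlim : Tendsto (fun n =>
      (∑ i, ∑ k, ∫ x, strain lam (w n) (p n) i k x ^ 2 ∂refMeasure) +
      h ^ 2 * ∑ i, ∑ k, ∑ j,
        (2 * (∫ x, bend lam (w n) (p n) (q n) i k j x * bend lam v p' q' i k j x ∂refMeasure) -
          ∫ x, bend lam v p' q' i k j x ^ 2 ∂refMeasure)) U
      (𝓝 ((∑ i, ∑ k, ∫ x, strain lam v p' i k x ^ 2 ∂refMeasure) +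
      h ^ 2 * ∑ i, ∑ k, ∑ j,
        (2 * (∫ x, bend lam v p' q' i k j x * bend lam v p' q' i k j x ∂refMeasure) -
          ∫ x, bend lam v p' q' i k j x ^ 2 ∂refMeasure))) := by
    refine Tendsto.add ?_ (Tendsto.const_mul _ ?_)
    · exact tendsto_finsetSum _ fun i _ => tendsto_finsetSum _ fun k _ =>
        (hstrain i k).tendsto_integral_sq
    · exact tendsto_finsetSum _ fun i _ => tendsto_finsetSum _ fun k _ =>
        tendsto_finsetSum _ fun j _ =>
        ((hbend i k j _ (J.memLp_bend i k j)).const_mul 2).sub_const _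
  have e : (∑ i, ∑ k, ∫ x, strain lam v p' i k x ^ 2 ∂refMeasure) +
      h ^ 2 * ∑ i, ∑ k, ∑ j,
        (2 * (∫ x, bend lam v p' q' i k j x * bend lam v p' q' i k j x ∂refMeasure) -
          ∫ x, bend lam v p' q' i k j x ^ 2 ∂refMeasure) = jetEnergy h lam v p' q' := by
    rw [J.jetEnergy_eq]
    simp only [← sq, two_mul, add_sub_cancel_right]
  rw [e] at hlim
  refine le_of_tendsto_of_tendsto hlim hI' (Eventually.of_forall fun n => ?_)
  show _ ≤ jetEnergy h lam (w n) (p n) (q n)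
  rw [(H n).jetEnergy_eq]
  refine add_le_add le_rfl (mul_le_mul_of_nonneg_left ?_ (sq_nonneg h))
  refine Finset.sum_le_sum fun i _ => Finset.sum_le_sum fun k _ => Finset.sum_le_sum fun j _ => ?_
  have m1 := (H n).memLp_bend i k j
  have m2 := J.memLp_bend i k j
  have i1 : Integrable (fun x => bend lam (w n) (p n) (q n) i k j x * bend lam v p' q' i k j x)
    refMeasure := m1.integrable_mul m2
  rw [← integral_const_mul, ← integral_sub (i1.const_mul 2) m2.integrable_sq]
  refine integral_mono_ae ((i1.const_mul 2).sub m2.integrable_sq) m1.integrable_sq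
    (Eventually.of_forall fun x => ?_)
  simp only
  nlinarith [sq_nonneg (bend lam (w n) (p n) (q n) i k j x - bend lam v p' q' i k j x)]

/-- The minimum of the energy over the admissible set is attained. -/
lemma exists_isLeast {lam m h : ℝ} (hm : 1 ≤ m) (hl0 : 0 ≤ lam) (hl : lam ≤ 1 / 2) (hh : 0 < h)
    (hh1 : h ≤ 1 / 2) :
    ∃ w p q, IsJet lam m w p q ∧ IsLeast (energyNL h '' admissibleNL lam 1 (ENNReal.ofReal m))
      (jetEnergy h lam w p q) := by
  have hm0 : 0 ≤ m := by linarith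
  set S := energyNL h '' admissibleNL lam 1 (ENNReal.ofReal m) with hS
  have hjet : ∀ w p q, IsJet lam m w p q → jetEnergy h lam w p q ∈ S := fun w p q J => by
    obtain ⟨Φ, hΦ, he⟩ := J.exists_admissible hm0
    exact ⟨Φ, hΦ, he h⟩
  have hJ0 := isJet_unbuckled hm hl0 (by linarith)
  have hS0 : 2 * Real.pi * (((1 - lam) ^ 2 - 1) ^ 2 + h ^ 2) ∈ S :=
    jetEnergy_unbuckled h lam ▸ hjet _ _ _ hJ0
  have hbdd : BddBelow S := by
    refine ⟨0, ?_⟩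
    rintro _ ⟨Φ, -, rfl⟩
    rw [energyNL_eq]
    refine integral_nonneg fun x => ?_
    simp only [density]
    positivity
  -- The unbuckled energy for `λ, h ≤ 1/2` is at most `2π (9/16 + 1/4)`. The infimum is thus below
  -- the level 9 assumed in the a priori bounds, and so is the tail of a minimizing sequence.
  have hI8 : sInf S ≤ 5.2 := by
    refine (csInf_le hbdd hS0).trans ?_
    have h1 : h ^ 2 ≤ (1 / 2) ^ 2 := pow_le_pow_left₀ hh.le hh1 2
    have h2 : ((1 - lam) ^ 2 - 1) ^ 2 ≤ (3 / 4) ^ 2 := by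
      refine sq_le_sq.2 ?_
      rw [abs_of_nonpos (by nlinarith), abs_of_nonneg (by norm_num : (0 : ℝ) ≤ 3 / 4)]
      nlinarith
    have := Real.pi_lt_d2
    have h3 : Real.pi * (((1 - lam) ^ 2 - 1) ^ 2 + h ^ 2) ≤ 3.15 * ((3 / 4) ^ 2 + (1 / 2) ^ 2) :=
      mul_le_mul this.le (add_le_add h2 h1) (by positivity) (by norm_num)
    linarith
  obtain ⟨u, -, hu, huS⟩ := exists_seq_tendsto_sInf ⟨_, hS0⟩ hbdd
  obtain ⟨N, hN⟩ := eventually_atTop.1 (hu.eventually_le_const (by linarith : sInf S < 9))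
  have hex : ∀ n, ∃ w p q, IsJet lam m w p q ∧ jetEnergy h lam w p q = u (n + N) := fun n => by
    obtain ⟨Φ, hΦ, he⟩ := huS (n + N)
    obtain ⟨w, p, q, J, hJ⟩ := exists_jet hm hl0 (by linarith) hΦ
    exact ⟨w, p, q, J, (hJ h).symm.trans he⟩
  choose w p q J hJ using hex
  obtain ⟨w', p', q', J', hJ'⟩ := exists_jet_limit hm hl0 (by linarith) hh J
    (fun n => (hJ n).trans_le (hN _ (by omega)))
    (by simpa only [hJ] using (tendsto_add_atTop_iff_nat N).2 hu)
  exact ⟨w', p', q', J', hjet _ _ _ J', fun E hE => hJ'.trans (csInf_le hbdd hE)⟩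

lemma bulkEnergyNL_one (h : ℝ) : bulkEnergyNL 1 h = 2 * Real.pi * h ^ 2 := by
  rw [bulkEnergyNL, volume_real_refDomain]
  ring

end Cylinder

end

/-- For every slope bound `m ∈ [1, ∞)` there are constants `c, C > 0` depending only on `m` such
that, for all `h, λ ∈ (0, 1/2]` with `h ≥ λ^{5/6}`, the minimum of the nonlinear energy over the
admissible set with neutral mandrel `ϱ = 1` is attained, and its excess over the bulk energy lies
between `c λ²` and `C λ²`. -/
theorem mainTheorem7 (m : ℝ) (hm : 1 ≤ m) :
    ∃ c C : ℝ, 0 < c ∧ 0 < C ∧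
      ∀ h lam : ℝ, 0 < h → h ≤ 1 / 2 → 0 < lam → lam ≤ 1 / 2 → lam ^ (5 / 6 : ℝ) ≤ h →
        ∃ E : ℝ,
          IsLeast (Cylinder.energyNL h '' Cylinder.admissibleNL lam 1 (ENNReal.ofReal m)) E ∧
          c * lam ^ 2 ≤ E - Cylinder.bulkEnergyNL 1 h ∧
          E - Cylinder.bulkEnergyNL 1 h ≤ C * lam ^ 2 := by
  have hC : 0 < (Cylinder.IsJet.lowerConst m)⁻¹ := by
    rw [Cylinder.IsJet.lowerConst]
    positivity
  refine ⟨(Cylinder.IsJet.lowerConst m)⁻¹ ^ 2, 8 * Real.pi, by positivity, by positivity,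
    fun h lam hh hh1 hl hl1 hlh => ?_⟩
  obtain ⟨w, p, q, J, hmin⟩ := Cylinder.exists_isLeast hm hl.le hl1 hh hh1
  refine ⟨_, hmin, ?_, ?_⟩
  · rw [Cylinder.bulkEnergyNL_one, ← mul_pow]
    exact J.lower_bound hm hh hh1 hl hl1 hlh
  · obtain ⟨Φ, hΦ, he⟩ := (Cylinder.isJet_unbuckled hm hl.le
      (by linarith : lam ≤ 1)).exists_admissible (by linarith)
    have h1 := hmin.2 ⟨Φ, hΦ, he h⟩
    rw [Cylinder.jetEnergy_unbuckled] at h1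
    rw [Cylinder.bulkEnergyNL_one]
    -- With the area `2π` this gives the upper constant `8π`.
    have h2 : ((1 - lam) ^ 2 - 1) ^ 2 ≤ 4 * lam ^ 2 := by
      have e : ((1 - lam) ^ 2 - 1) ^ 2 = (2 - lam) ^ 2 * lam ^ 2 := by ring
      rw [e]
      refine mul_le_mul_of_nonneg_right ?_ (sq_nonneg lam)
      nlinarith
    have h3 := mul_le_mul_of_nonneg_left h2 (by positivity : 0 ≤ 2 * Real.pi)
    linarith
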